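/- Let $\delta,\gamma,\mu\in\mathbb C$ with $\delta\neq0$, $\gamma\neq0$. Let $\mathbf L$ be the five-dimensional complex Lie algebra with basis $H,E,A,B,J$ and brackets $$[H,E]=\delta E,\quad [H,A]=0,\quad [H,B]=\delta B,\quad [A,B]=\gamma E,\quad [E,A]=[E,B]=0,$$ $$[J,H]=[J,E]=0,\quad [J,A]=-\mu A,\quad [J,B]=\mu B,$$ and let $\mathbf L'$ be the five-dimensional complex Lie algebra with basis $H,E,A,B,J$ and brackets $$[H,E]=\delta E,\quad [H,A]=\delta A,\quad [H,B]=0,\quad [A,B]=\gamma E,\quad [E,A]=[E,B]=0,$$ $$[J,H]=[J,E]=0,\quad [J,A]=\mu A,\quad [J,B]=-\mu B.$$ Let $\mathbf g$ be $\mathbf L$ or $\mathbf L'$, and let $\Delta$, $\epsilon$ be the standard coproduct and counit of $U(\mathbf g)$, extended coefficientwise to formal power series in a deformation parameter $z$. All identities below hold in $U(\mathbf g)[[z]]$, $(U(\mathbf g)\otimes U(\mathbf g))[[z]]$ or $(U(\mathbf g)^{\otimes3})[[z]]$, where, for $\mathbf L$, the letters $E,B$ stand for $zE,zB$, and, for $\mathbf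 L'$, the letters $E,A$ stand for $zE,zA$ (the other generators are not rescaled). The functions $\exp$ and $\ln(1+\cdot)$ are given by their power series, and $\frac1\mu\ln(1+\mu x)$ denotes $\sum_{n\ge1}(-\mu)^{n-1}x^n/n$, which is $x$ for $\mu=0$. A twisting element is an invertible $\mathcal F\in(U(\mathbf g)\otimes U(\mathbf g))[[z]]$ with $$\mathcal F_{12}(\Delta\otimes\mathrm{id})(\mathcal F)=\mathcal F_{23}(\mathrm{id}\otimes\Delta)(\mathcal F),\qquad(\epsilon\otimes\mathrm{id})(\mathcal F)=(\mathrm{id}\otimes\epsilon)(\mathcal F)=1 .$$ For invertible $\mathcal G$ put $\Delta_{\mathcal G}(x)=\mathcal G\Delta(x)\mathcal G^{-1}$; an element $x$ is primitive for $\Delta_{\mathcal G}$ if $\Delta_{\mathcal G}(x)=x\otimes1+1\otimes x$. Let $\sigma=\frac1\delta\ln(1+\gamma E)$. (1) For $\mathbf L$ let $\mathcal F_P=\exp(A\otimes Be^{-\delta\sigma})\exp(H\otimes\sigma)$, $\rho=\frac1\mu\ln(1+\mu Be^{-\delta\sigma})$, $\Phi=\exp(J\otimes\rho)$. Then $\mathcal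 F=\Phi\mathcal F_P$ and $\tilde{\mathcal F}=\Phi_{21}\mathcal F_P$ are twisting elements. The element $J$ is primitive for $\Delta_{\mathcal F_P}$; the elements $\sigma$ and $\rho$ are primitive for $\Delta_{\mathcal F}$ and for $\Delta_{\tilde{\mathcal F}}$. Moreover $$\begin{aligned} \Delta_{\mathcal F}(J)&=J\otimes e^{-\mu\rho}+1\otimes J,\\ \Delta_{\mathcal F}(H)&=H\otimes e^{-\delta\sigma}+1\otimes H-\delta J\otimes Be^{-2\delta\sigma-\mu\rho}-\delta A\otimes Be^{-2\delta\sigma-\mu\rho},\\ \Delta_{\mathcal F}(A)&=A\otimes e^{-\delta\sigma-\mu\rho}+1\otimes A-\gamma J\otimes Ee^{-\delta\sigma-\mu\rho},\\ \Delta_{\mathcal F}(B)&=B\otimes e^{\delta\sigma+\mu\rho}+e^{\delta\sigma}\otimes B,\qquad \Delta_{\mathcal F}(E)=E\otimes e^{\delta\sigma}+1\otimes E,\\ \Delta_{\tilde{\mathcal F}}(J)&=J\otimes1+e^{-\mu\rho}\otimes J,\\ \Delta_{\tilde{\mathcal F}}(A)&=A\otimes e^{-\delta\sigma}+e^{-\mu\rho}\otimes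 A-\gamma Ee^{-\delta\sigma-\mu\rho}\otimes Je^{-\delta\sigma},\\ \Delta_{\tilde{\mathcal F}}(B)&=B\otimes e^{\delta\sigma}+e^{\delta\sigma+\mu\rho}\otimes B,\qquad \Delta_{\tilde{\mathcal F}}(E)=E\otimes e^{\delta\sigma}+1\otimes E, \end{aligned}$$ and $$(\Delta_{\mathcal F_P}\otimes\mathrm{id})(\Phi)=\Phi_{13}\Phi_{23},\qquad(\mathrm{id}\otimes\Delta_{\mathcal F})(\Phi)=\Phi_{12}\Phi_{13},$$ $$(\Delta_{\tilde{\mathcal F}}\otimes\mathrm{id})(\Psi)=\Psi_{13}\Psi_{23},\qquad(\mathrm{id}\otimes\Delta_{\mathcal F_P})(\Psi)=\Psi_{12}\Psi_{13}\qquad\text{for }\Psi=\Phi_{21}.$$ (2) For $\mathbf L'$ let $\mathcal F_{P'}=\exp(A\otimes B)\exp(H\otimes\sigma)$, $\rho'=\frac1\mu\ln(1+\mu A)$, $\Phi'=\exp(J\otimes\rho')$. Then $\mathcal F'=\Phi'\mathcal F_{P'}$ and $\tilde{\mathcal F}'=\Phi'_{21}\mathcal F_{P'}$ are twisting elements. The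 element $J$ is primitive for $\Delta_{\mathcal F_{P'}}$; the elements $\sigma$ and $\rho'$ are primitive for $\Delta_{\mathcal F'}$ and for $\Delta_{\tilde{\mathcal F}'}$. Moreover $$\begin{aligned} \Delta_{\mathcal F'}(J)&=J\otimes e^{-\mu\rho'}+1\otimes J,\qquad \Delta_{\mathcal F'}(A)=A\otimes e^{\mu\rho'}+1\otimes A,\\ \Delta_{\mathcal F'}(B)&=B\otimes e^{-\mu\rho'}+e^{\delta\sigma}\otimes B+\gamma Je^{\delta\sigma}\otimes Ee^{-\mu\rho'},\qquad \Delta_{\mathcal F'}(E)=E\otimes e^{\delta\sigma}+1\otimes E,\\ \Delta_{\tilde{\mathcal F}'}(J)&=J\otimes1+e^{-\mu\rho'}\otimes J,\\ \Delta_{\tilde{\mathcal F}'}(H)&=H\otimes e^{-\delta\sigma}+1\otimes H-\delta Ae^{-\mu\rho'}\otimes Je^{-\delta\sigma}-\delta Ae^{-\mu\rho'}\otimes Be^{-\delta\sigma},\\ \Delta_{\tilde{\mathcal F}'}(A)&=A\otimes1+e^{\mu\rho'}\otimes A,\\ \Delta_{\tilde{\mathcal F}'}(B)&=B\otimes1+e^{\delta\sigma-\mu\rho'}\otimes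 B+\gamma Ee^{-\mu\rho'}\otimes J,\qquad \Delta_{\tilde{\mathcal F}'}(E)=E\otimes e^{\delta\sigma}+1\otimes E, \end{aligned}$$ where for $\mu\neq0$ the third term of $\Delta_{\tilde{\mathcal F}'}(H)$ also equals $\frac\delta\mu(e^{-\mu\rho'}-1)\otimes Je^{-\delta\sigma}$; and $$(\Delta_{\mathcal F_{P'}}\otimes\mathrm{id})(\Phi')=\Phi'_{13}\Phi'_{23},\qquad(\mathrm{id}\otimes\Delta_{\mathcal F'})(\Phi')=\Phi'_{12}\Phi'_{13},$$ $$(\Delta_{\tilde{\mathcal F}'}\otimes\mathrm{id})(\Psi)=\Psi_{13}\Psi_{23},\qquad(\mathrm{id}\otimes\Delta_{\mathcal F_{P'}})(\Psi)=\Psi_{12}\Psi_{13}\qquad\text{for }\Psi=\Phi'_{21}.$$ -/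

import Mathlib

open scoped TensorProduct PowerSeries

noncomputable section

/-! ## The five-dimensional Lie algebras `L` and `L'` -/

namespace PET

/-- The complex Lie algebra `L` with parameters `δ, γ, μ`: the coordinates of a vector refer, in this
order, to the basis `H, E, A, B, J`. -/
def LieL (_δ _γ _μ : ℂ) : Type := Fin 5 → ℂ

/-- The complex Lie algebra `L'` with parameters `δ, γ, μ`: the coordinates of a vector refer, in this
order, to the basis `H, E, A, B, J`. -/
def LieL' (_δ _γ _μ : ℂ) : Type := Fin 5 → ℂ

section Lie

variable (δ γ μ : ℂ)

instance : AddCommGroup (LieL δ γ μ) := inferInstanceAs (AddCommGroup (Fin 5 → ℂ))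
instance : Module ℂ (LieL δ γ μ) := inferInstanceAs (Module ℂ (Fin 5 → ℂ))
instance : AddCommGroup (LieL' δ γ μ) := inferInstanceAs (AddCommGroup (Fin 5 → ℂ))
instance : Module ℂ (LieL' δ γ μ) := inferInstanceAs (Module ℂ (Fin 5 → ℂ))

/-- The bilinear extension of `[H,E] = δE`, `[H,A] = 0`, `[H,B] = δB`, `[A,B] = γE`,
`[E,A] = [E,B] = 0`, `[J,H] = [J,E] = 0`, `[J,A] = -μA`, `[J,B] = μB`. -/
instance : Bracket (LieL δ γ μ) (LieL δ γ μ) where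
  bracket x y :=
    ![0,
      δ * (x 0 * y 1 - x 1 * y 0) + γ * (x 2 * y 3 - x 3 * y 2),
      -μ * (x 4 * y 2 - x 2 * y 4),
      δ * (x 0 * y 3 - x 3 * y 0) + μ * (x 4 * y 3 - x 3 * y 4),
      0]

/-- The bilinear extension of `[H,E] = δE`, `[H,A] = δA`, `[H,B] = 0`, `[A,B] = γE`,
`[E,A] = [E,B] = 0`, `[J,H] = [J,E] = 0`, `[J,A] = μA`, `[J,B] = -μB`. -/
instance : Bracket (LieL' δ γ μ) (LieL' δ γ μ) where
  bracket x y :=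
    ![0,
      δ * (x 0 * y 1 - x 1 * y 0) + γ * (x 2 * y 3 - x 3 * y 2),
      δ * (x 0 * y 2 - x 2 * y 0) + μ * (x 4 * y 2 - x 2 * y 4),
      -μ * (x 4 * y 3 - x 3 * y 4),
      0]

variable {δ γ μ}

theorem LieL.ext {x y : LieL δ γ μ} (h0 : x 0 = y 0) (h1 : x 1 = y 1) (h2 : x 2 = y 2)
    (h3 : x 3 = y 3) (h4 : x 4 = y 4) : x = y := by
  funext i
  fin_cases i <;> assumption

@[simp] theorem LieL.add_apply (x y : LieL δ γ μ) (i : Fin 5) : (x + y) i = x i + y i := rfl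
@[simp] theorem LieL.smul_apply (c : ℂ) (x : LieL δ γ μ) (i : Fin 5) : (c • x) i = c * x i := rfl
@[simp] theorem LieL.zero_apply (i : Fin 5) : (0 : LieL δ γ μ) i = 0 := rfl
@[simp] theorem LieL.bracket_0 (x y : LieL δ γ μ) : ⁅x, y⁆ 0 =
    0 := rfl
@[simp] theorem LieL.bracket_1 (x y : LieL δ γ μ) : ⁅x, y⁆ 1 =
    δ * (x 0 * y 1 - x 1 * y 0) + γ * (x 2 * y 3 - x 3 * y 2) := rfl
@[simp] theorem LieL.bracket_2 (x y : LieL δ γ μ) : ⁅x, y⁆ 2 =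
    -μ * (x 4 * y 2 - x 2 * y 4) := rfl
@[simp] theorem LieL.bracket_3 (x y : LieL δ γ μ) : ⁅x, y⁆ 3 =
    δ * (x 0 * y 3 - x 3 * y 0) + μ * (x 4 * y 3 - x 3 * y 4) := rfl
@[simp] theorem LieL.bracket_4 (x y : LieL δ γ μ) : ⁅x, y⁆ 4 =
    0 := rfl

instance : LieRing (LieL δ γ μ) where
  add_lie x y z := by
    apply LieL.ext <;> simp <;> ring
  lie_add x y z := by
    apply LieL.ext <;> simp <;> ring
  lie_self x := by
    apply LieL.ext <;>
      simp only [LieL.zero_apply, LieL.bracket_0, LieL.bracket_1, LieL.bracket_2, LieL.bracket_3,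
        LieL.bracket_4] <;> ring
  leibniz_lie x y z := by
    apply LieL.ext <;> simp <;> ring

instance : LieAlgebra ℂ (LieL δ γ μ) where
  lie_smul c x y := by
    apply LieL.ext <;> simp <;> ring

theorem LieL'.ext {x y : LieL' δ γ μ} (h0 : x 0 = y 0) (h1 : x 1 = y 1) (h2 : x 2 = y 2)
    (h3 : x 3 = y 3) (h4 : x 4 = y 4) : x = y := by
  funext i
  fin_cases i <;> assumption

@[simp] theorem LieL'.add_apply (x y : LieL' δ γ μ) (i : Fin 5) : (x + y) i = x i + y i := rfl
@[simp] theorem LieL'.smul_apply (c : ℂ) (x : LieL' δ γ μ) (i : Fin 5) : (c • x) i = c * x i := rfl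
@[simp] theorem LieL'.zero_apply (i : Fin 5) : (0 : LieL' δ γ μ) i = 0 := rfl
@[simp] theorem LieL'.bracket_0 (x y : LieL' δ γ μ) : ⁅x, y⁆ 0 =
    0 := rfl
@[simp] theorem LieL'.bracket_1 (x y : LieL' δ γ μ) : ⁅x, y⁆ 1 =
    δ * (x 0 * y 1 - x 1 * y 0) + γ * (x 2 * y 3 - x 3 * y 2) := rfl
@[simp] theorem LieL'.bracket_2 (x y : LieL' δ γ μ) : ⁅x, y⁆ 2 =
    δ * (x 0 * y 2 - x 2 * y 0) + μ * (x 4 * y 2 - x 2 * y 4) := rfl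
@[simp] theorem LieL'.bracket_3 (x y : LieL' δ γ μ) : ⁅x, y⁆ 3 =
    -μ * (x 4 * y 3 - x 3 * y 4) := rfl
@[simp] theorem LieL'.bracket_4 (x y : LieL' δ γ μ) : ⁅x, y⁆ 4 =
    0 := rfl

instance : LieRing (LieL' δ γ μ) where
  add_lie x y z := by
    apply LieL'.ext <;> simp <;> ring
  lie_add x y z := by
    apply LieL'.ext <;> simp <;> ring
  lie_self x := by
    apply LieL'.ext <;>
      simp only [LieL'.zero_apply, LieL'.bracket_0, LieL'.bracket_1, LieL'.bracket_2, LieL'.bracket_3,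
        LieL'.bracket_4] <;> ring
  leibniz_lie x y z := by
    apply LieL'.ext <;> simp <;> ring

instance : LieAlgebra ℂ (LieL' δ γ μ) where
  lie_smul c x y := by
    apply LieL'.ext <;> simp <;> ring

variable (δ γ μ)

/-- The basis vectors `H, E, A, B, J` of `L`, numbered `0, …, 4`. -/
def LieL.gen (i : Fin 5) : LieL δ γ μ := (Pi.single i 1 : Fin 5 → ℂ)

theorem LieL.gen_apply (i j : Fin 5) : gen δ γ μ i j = if j = i then 1 else 0 :=
  Pi.single_apply i (1 : ℂ) j

/-- The basis vectors `H, E, A, B, J` of `L'`, numbered `0, …, 4`. -/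
def LieL'.gen (i : Fin 5) : LieL' δ γ μ := (Pi.single i 1 : Fin 5 → ℂ)

theorem LieL'.gen_apply (i j : Fin 5) : gen δ γ μ i j = if j = i then 1 else 0 :=
  Pi.single_apply i (1 : ℂ) j

/-- The defining commutation relations of `L`. -/
theorem LieL.relations :
    let H := gen δ γ μ 0; let E := gen δ γ μ 1; let A := gen δ γ μ 2
    let B := gen δ γ μ 3; let J := gen δ γ μ 4
    ⁅H, E⁆ = δ • E ∧ ⁅H, A⁆ = 0 ∧ ⁅H, B⁆ = δ • B ∧ ⁅A, B⁆ = γ • E ∧ ⁅E, A⁆ = 0 ∧ ⁅E, B⁆ = 0 ∧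
    ⁅J, H⁆ = 0 ∧ ⁅J, E⁆ = 0 ∧ ⁅J, A⁆ = (-μ) • A ∧ ⁅J, B⁆ = μ • B := by
  refine ⟨?_, ?_, ?_, ?_, ?_, ?_, ?_, ?_, ?_, ?_⟩ <;>
    (apply LieL.ext <;> simp [LieL.gen_apply])

/-- The defining commutation relations of `L'`. -/
theorem LieL'.relations :
    let H := gen δ γ μ 0; let E := gen δ γ μ 1; let A := gen δ γ μ 2
    let B := gen δ γ μ 3; let J := gen δ γ μ 4
    ⁅H, E⁆ = δ • E ∧ ⁅H, A⁆ = δ • A ∧ ⁅H, B⁆ = 0 ∧ ⁅A, B⁆ = γ • E ∧ ⁅E, A⁆ = 0 ∧ ⁅E, B⁆ = 0 ∧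
    ⁅J, H⁆ = 0 ∧ ⁅J, E⁆ = 0 ∧ ⁅J, A⁆ = μ • A ∧ ⁅J, B⁆ = (-μ) • B := by
  refine ⟨?_, ?_, ?_, ?_, ?_, ?_, ?_, ?_, ?_, ?_⟩ <;>
    (apply LieL'.ext <;> simp [LieL'.gen_apply])

end Lie

/-! ## The bialgebra structure of an enveloping algebra -/

section Enveloping

variable (𝔤 : Type) [LieRing 𝔤] [LieAlgebra ℂ 𝔤]

/-- The universal enveloping algebra `U(𝔤)`. -/
abbrev U : Type := UniversalEnvelopingAlgebra ℂ 𝔤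

attribute [local instance 100] LieRing.ofAssociativeRing

/-- The Lie algebra map `x ↦ x ⊗ 1 + 1 ⊗ x` from `𝔤` to `U(𝔤) ⊗ U(𝔤)`. -/
def comulLie : 𝔤 →ₗ⁅ℂ⁆ (U 𝔤 ⊗[ℂ] U 𝔤) where
  toFun x := UniversalEnvelopingAlgebra.ι ℂ x ⊗ₜ 1 + 1 ⊗ₜ UniversalEnvelopingAlgebra.ι ℂ x
  map_add' x y := by
    simp only [map_add, TensorProduct.add_tmul, TensorProduct.tmul_add]; abel
  map_smul' c x := by
    simp only [map_smul, TensorProduct.smul_tmul', TensorProduct.tmul_smul, smul_add,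
      RingHom.id_apply]
  map_lie' {x y} := by
    simp only [LieHom.map_lie, LieRing.of_associative_ring_bracket, TensorProduct.sub_tmul,
      TensorProduct.tmul_sub, add_mul, mul_add, Algebra.TensorProduct.tmul_mul_tmul, one_mul,
      mul_one]
    abel

/-- The coproduct `Δ` of `U(𝔤)`: the algebra map with `Δ(x) = x ⊗ 1 + 1 ⊗ x` for `x ∈ 𝔤`. -/
def comul : U 𝔤 →ₐ[ℂ] U 𝔤 ⊗[ℂ] U 𝔤 := UniversalEnvelopingAlgebra.lift ℂ (comulLie 𝔤)

/-- The counit `ε` of `U(𝔤)`: the algebra map with `ε(x) = 0` for `x ∈ 𝔤`. -/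
def counit : U 𝔤 →ₐ[ℂ] ℂ := UniversalEnvelopingAlgebra.lift ℂ 0

theorem comul_ι (x : 𝔤) : comul 𝔤 (UniversalEnvelopingAlgebra.ι ℂ x) =
    UniversalEnvelopingAlgebra.ι ℂ x ⊗ₜ 1 + 1 ⊗ₜ UniversalEnvelopingAlgebra.ι ℂ x :=
  UniversalEnvelopingAlgebra.lift_ι_apply ℂ _ x

theorem counit_ι (x : 𝔤) : counit 𝔤 (UniversalEnvelopingAlgebra.ι ℂ x) = 0 :=
  UniversalEnvelopingAlgebra.lift_ι_apply ℂ _ x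

end Enveloping

/-! ## Formal power series in the deformation parameter

The ring `U(𝔤)⟦X⟧` has the deformation parameter `z` as its (central) variable `X`. The completed
tensor powers of `U(𝔤)⟦X⟧` are `(U(𝔤) ⊗ U(𝔤))⟦X⟧` and `(U(𝔤) ⊗ (U(𝔤) ⊗ U(𝔤)))⟦X⟧`. -/

section Series

variable {R : Type*} [Ring R] [Algebra ℂ R]

/-- The value `a(f) = ∑ₖ aₖ fᵏ` of a power series `a ∈ ℂ⟦X⟧` at a series `f ∈ R⟦X⟧` without constant
term. As `fᵏ` is divisible by `Xᵏ`, the terms with `k > n` do not contribute in degree `n`. -/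
def evalSeries (a : ℂ⟦X⟧) (f : R⟦X⟧) : R⟦X⟧ :=
  PowerSeries.mk fun n =>
    ∑ k ∈ Finset.range (n + 1), PowerSeries.coeff k a • PowerSeries.coeff n (f ^ k)

/-- Every longer partial sum of `∑ₖ aₖ fᵏ` has the same coefficient in degree `n`. -/
theorem coeff_evalSeries (a : ℂ⟦X⟧) {f : R⟦X⟧} (hf : PowerSeries.constantCoeff f = 0)
    {n N : ℕ} (h : n < N) :
    PowerSeries.coeff n (evalSeries a f) =
      PowerSeries.coeff n (∑ k ∈ Finset.range N, PowerSeries.coeff k a • f ^ k) := by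
  have hsm : ∀ k, PowerSeries.coeff n (PowerSeries.coeff k a • f ^ k) =
      PowerSeries.coeff k a • PowerSeries.coeff n (f ^ k) := fun k => rfl
  rw [evalSeries, PowerSeries.coeff_mk, map_sum]
  simp only [hsm]
  refine Finset.sum_subset (Finset.range_mono h) fun k _ hk => ?_
  rw [PowerSeries.coeff_of_lt_order n, smul_zero]
  have hk' : n < k := by simpa using hk
  exact lt_of_lt_of_le (by exact_mod_cast hk')
    (PowerSeries.le_order_pow_of_constantCoeff_eq_zero k hf)

/-- `exp(f)`, for `f` without constant term. -/
def expS (f : R⟦X⟧) : R⟦X⟧ := evalSeries (PowerSeries.exp ℂ) f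

/-- `ln(1 + f)`, for `f` without constant term. -/
def lnS (f : R⟦X⟧) : R⟦X⟧ := evalSeries (PowerSeries.log ℂ) f

/-- The power series `(1/c) ln(1 + cX) = ∑_{n ≥ 1} (-c)ⁿ⁻¹ Xⁿ / n`, which is `X` for `c = 0`. -/
def lnDivSeries (c : ℂ) : ℂ⟦X⟧ :=
  PowerSeries.mk fun n => if n = 0 then 0 else (-c) ^ (n - 1) / n

/-- `(1/c) ln(1 + c f)`, for `f` without constant term. -/
def lnDiv (c : ℂ) (f : R⟦X⟧) : R⟦X⟧ := evalSeries (lnDivSeries c) f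

theorem lnDiv_eq {c : ℂ} (hc : c ≠ 0) (f : R⟦X⟧) : lnDiv c f = c⁻¹ • lnS (c • f) := by
  have hsm : ∀ (n : ℕ) (t : ℂ) (g : R⟦X⟧),
      PowerSeries.coeff n (t • g) = t • PowerSeries.coeff n g := fun n t g => rfl
  ext n
  rw [hsm, lnDiv, lnS, evalSeries, evalSeries, PowerSeries.coeff_mk, PowerSeries.coeff_mk,
    Finset.smul_sum]
  refine Finset.sum_congr rfl fun k _ => ?_
  rw [smul_pow, hsm, smul_smul, smul_smul]
  congr 1
  rcases k with _ | k
  · simp [lnDivSeries]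
  · simp only [lnDivSeries, PowerSeries.coeff_mk, PowerSeries.coeff_log]
    have : ((k : ℂ) + 1) ≠ 0 := by exact_mod_cast k.succ_ne_zero
    simp
    field_simp
    ring

end Series

section Tensor

variable {𝔤 : Type} [LieRing 𝔤] [LieAlgebra ℂ 𝔤]

/-- The element `f ⊗ g` of `(U(𝔤) ⊗ U(𝔤))⟦X⟧`. -/
def tensorS (f g : (U 𝔤)⟦X⟧) : (U 𝔤 ⊗[ℂ] U 𝔤)⟦X⟧ :=
  PowerSeries.map
      ((Algebra.TensorProduct.includeLeft : U 𝔤 →ₐ[ℂ] U 𝔤 ⊗[ℂ] U 𝔤) : U 𝔤 →+* U 𝔤 ⊗[ℂ] U 𝔤) f *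
    PowerSeries.map
      ((Algebra.TensorProduct.includeRight : U 𝔤 →ₐ[ℂ] U 𝔤 ⊗[ℂ] U 𝔤) : U 𝔤 →+* U 𝔤 ⊗[ℂ] U 𝔤) g

infixl:72 " ⊗ₚ " => tensorS

/-- The coproduct `Δ`, applied to the coefficients of a series. -/
def comulS : (U 𝔤)⟦X⟧ →+* (U 𝔤 ⊗[ℂ] U 𝔤)⟦X⟧ :=
  PowerSeries.map (comul 𝔤 : U 𝔤 →+* U 𝔤 ⊗[ℂ] U 𝔤)

/-- `Δ ⊗ id`, with values in `U(𝔤) ⊗ (U(𝔤) ⊗ U(𝔤))`, on series. -/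
def comulId : (U 𝔤 ⊗[ℂ] U 𝔤)⟦X⟧ →+* (U 𝔤 ⊗[ℂ] (U 𝔤 ⊗[ℂ] U 𝔤))⟦X⟧ :=
  PowerSeries.map
    (((Algebra.TensorProduct.assoc ℂ ℂ ℂ (U 𝔤) (U 𝔤) (U 𝔤)).toAlgHom.comp
      (Algebra.TensorProduct.map (comul 𝔤) (AlgHom.id ℂ (U 𝔤))) :
        U 𝔤 ⊗[ℂ] U 𝔤 →ₐ[ℂ] U 𝔤 ⊗[ℂ] (U 𝔤 ⊗[ℂ] U 𝔤)) :
      U 𝔤 ⊗[ℂ] U 𝔤 →+* U 𝔤 ⊗[ℂ] (U 𝔤 ⊗[ℂ] U 𝔤))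

/-- `id ⊗ Δ` on series. -/
def idComul : (U 𝔤 ⊗[ℂ] U 𝔤)⟦X⟧ →+* (U 𝔤 ⊗[ℂ] (U 𝔤 ⊗[ℂ] U 𝔤))⟦X⟧ :=
  PowerSeries.map
    ((Algebra.TensorProduct.map (AlgHom.id ℂ (U 𝔤)) (comul 𝔤) :
        U 𝔤 ⊗[ℂ] U 𝔤 →ₐ[ℂ] U 𝔤 ⊗[ℂ] (U 𝔤 ⊗[ℂ] U 𝔤)) :
      U 𝔤 ⊗[ℂ] U 𝔤 →+* U 𝔤 ⊗[ℂ] (U 𝔤 ⊗[ℂ] U 𝔤))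

/-- `ε ⊗ id` on series. -/
def counitId : (U 𝔤 ⊗[ℂ] U 𝔤)⟦X⟧ →+* (U 𝔤)⟦X⟧ :=
  PowerSeries.map
    (((Algebra.TensorProduct.lid ℂ (U 𝔤)).toAlgHom.comp
      (Algebra.TensorProduct.map (counit 𝔤) (AlgHom.id ℂ (U 𝔤))) :
        U 𝔤 ⊗[ℂ] U 𝔤 →ₐ[ℂ] U 𝔤) : U 𝔤 ⊗[ℂ] U 𝔤 →+* U 𝔤)

/-- `id ⊗ ε` on series. -/
def idCounit : (U 𝔤 ⊗[ℂ] U 𝔤)⟦X⟧ →+* (U 𝔤)⟦X⟧ :=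
  PowerSeries.map
    (((Algebra.TensorProduct.rid ℂ ℂ (U 𝔤)).toAlgHom.comp
      (Algebra.TensorProduct.map (AlgHom.id ℂ (U 𝔤)) (counit 𝔤)) :
        U 𝔤 ⊗[ℂ] U 𝔤 →ₐ[ℂ] U 𝔤) : U 𝔤 ⊗[ℂ] U 𝔤 →+* U 𝔤)

/-- `F ↦ F₁₂`, that is `a ⊗ b ↦ a ⊗ (b ⊗ 1)`, on series. -/
def leg12 : (U 𝔤 ⊗[ℂ] U 𝔤)⟦X⟧ →+* (U 𝔤 ⊗[ℂ] (U 𝔤 ⊗[ℂ] U 𝔤))⟦X⟧ :=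
  PowerSeries.map
    ((Algebra.TensorProduct.map (AlgHom.id ℂ (U 𝔤)) Algebra.TensorProduct.includeLeft :
        U 𝔤 ⊗[ℂ] U 𝔤 →ₐ[ℂ] U 𝔤 ⊗[ℂ] (U 𝔤 ⊗[ℂ] U 𝔤)) :
      U 𝔤 ⊗[ℂ] U 𝔤 →+* U 𝔤 ⊗[ℂ] (U 𝔤 ⊗[ℂ] U 𝔤))

/-- `F ↦ F₁₃`, that is `a ⊗ b ↦ a ⊗ (1 ⊗ b)`, on series. -/
def leg13 : (U 𝔤 ⊗[ℂ] U 𝔤)⟦X⟧ →+* (U 𝔤 ⊗[ℂ] (U 𝔤 ⊗[ℂ] U 𝔤))⟦X⟧ :=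
  PowerSeries.map
    ((Algebra.TensorProduct.map (AlgHom.id ℂ (U 𝔤)) Algebra.TensorProduct.includeRight :
        U 𝔤 ⊗[ℂ] U 𝔤 →ₐ[ℂ] U 𝔤 ⊗[ℂ] (U 𝔤 ⊗[ℂ] U 𝔤)) :
      U 𝔤 ⊗[ℂ] U 𝔤 →+* U 𝔤 ⊗[ℂ] (U 𝔤 ⊗[ℂ] U 𝔤))

/-- `F ↦ F₂₃`, that is `a ⊗ b ↦ 1 ⊗ (a ⊗ b)`, on series. -/
def leg23 : (U 𝔤 ⊗[ℂ] U 𝔤)⟦X⟧ →+* (U 𝔤 ⊗[ℂ] (U 𝔤 ⊗[ℂ] U 𝔤))⟦X⟧ :=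
  PowerSeries.map
    ((Algebra.TensorProduct.includeRight :
        U 𝔤 ⊗[ℂ] U 𝔤 →ₐ[ℂ] U 𝔤 ⊗[ℂ] (U 𝔤 ⊗[ℂ] U 𝔤)) :
      U 𝔤 ⊗[ℂ] U 𝔤 →+* U 𝔤 ⊗[ℂ] (U 𝔤 ⊗[ℂ] U 𝔤))

/-- `F ↦ F₂₁`, that is `a ⊗ b ↦ b ⊗ a`, on series. -/
def flip21 : (U 𝔤 ⊗[ℂ] U 𝔤)⟦X⟧ →+* (U 𝔤 ⊗[ℂ] U 𝔤)⟦X⟧ :=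
  PowerSeries.map
    (((Algebra.TensorProduct.comm ℂ (U 𝔤) (U 𝔤)).toAlgHom :
        U 𝔤 ⊗[ℂ] U 𝔤 →ₐ[ℂ] U 𝔤 ⊗[ℂ] U 𝔤) : U 𝔤 ⊗[ℂ] U 𝔤 →+* U 𝔤 ⊗[ℂ] U 𝔤)

/-! ## Drinfel'd twists -/

/-- `F` is a twisting element: it is invertible and satisfies the cocycle condition
`F₁₂ (Δ ⊗ id)(F) = F₂₃ (id ⊗ Δ)(F)` and the counit condition `(ε ⊗ id)(F) = (id ⊗ ε)(F) = 1`. -/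
structure IsTwist (F : (U 𝔤 ⊗[ℂ] U 𝔤)⟦X⟧) : Prop where
  isUnit : IsUnit F
  cocycle : leg12 F * comulId F = leg23 F * idComul F
  counit_left : counitId F = 1
  counit_right : idCounit F = 1

/-- The twisted coproduct `Δ_F(x) = F Δ(x) F⁻¹`, for `F` invertible. -/
def twComul (F : (U 𝔤 ⊗[ℂ] U 𝔤)⟦X⟧) (x : (U 𝔤)⟦X⟧) : (U 𝔤 ⊗[ℂ] U 𝔤)⟦X⟧ :=
  F * comulS x * Ring.inverse F

/-- `Δ_F ⊗ id`, that is `Ψ ↦ F₁₂ (Δ ⊗ id)(Ψ) F₁₂⁻¹`, for `F` invertible. -/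
def twComulId (F Ψ : (U 𝔤 ⊗[ℂ] U 𝔤)⟦X⟧) : (U 𝔤 ⊗[ℂ] (U 𝔤 ⊗[ℂ] U 𝔤))⟦X⟧ :=
  leg12 F * comulId Ψ * Ring.inverse (leg12 F)

/-- `id ⊗ Δ_F`, that is `Ψ ↦ F₂₃ (id ⊗ Δ)(Ψ) F₂₃⁻¹`, for `F` invertible. -/
def idTwComul (F Ψ : (U 𝔤 ⊗[ℂ] U 𝔤)⟦X⟧) : (U 𝔤 ⊗[ℂ] (U 𝔤 ⊗[ℂ] U 𝔤))⟦X⟧ :=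
  leg23 F * idComul Ψ * Ring.inverse (leg23 F)

/-- `x` is primitive with respect to the twisted coproduct `Δ_F`. -/
def IsTwPrimitive (F : (U 𝔤 ⊗[ℂ] U 𝔤)⟦X⟧) (x : (U 𝔤)⟦X⟧) : Prop :=
  twComul F x = x ⊗ₚ 1 + 1 ⊗ₚ x

/-- An element of `𝔤` as a constant series. -/
def cst (x : 𝔤) : (U 𝔤)⟦X⟧ := PowerSeries.C (UniversalEnvelopingAlgebra.ι ℂ x)

/-- The series `z x`, for `x` in `𝔤`. -/
def zcst (x : 𝔤) : (U 𝔤)⟦X⟧ := PowerSeries.X * cst x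

end Tensor

/-! ## The twisting elements

The exponential and the logarithm need arguments without constant term. For this the deformation
parameter is introduced by `E → zE`, `B → zB` in `L`, and by `E → zE`, `A → zA` in `L'`. -/

section Twists

variable (δ γ μ : ℂ)

namespace LieL

/-- `H` in `U(L)⟦X⟧`. -/
def H : (U (LieL δ γ μ))⟦X⟧ := cst (gen δ γ μ 0)
/-- `zE` in `U(L)⟦X⟧`. -/
def E : (U (LieL δ γ μ))⟦X⟧ := zcst (gen δ γ μ 1)
/-- `A` in `U(L)⟦X⟧`. -/
def A : (U (LieL δ γ μ))⟦X⟧ := cst (gen δ γ μ 2)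
/-- `zB` in `U(L)⟦X⟧`. -/
def B : (U (LieL δ γ μ))⟦X⟧ := zcst (gen δ γ μ 3)
/-- `J` in `U(L)⟦X⟧`. -/
def J : (U (LieL δ γ μ))⟦X⟧ := cst (gen δ γ μ 4)

/-- `σ = (1/δ) ln(1 + γE)`. -/
def sigma : (U (LieL δ γ μ))⟦X⟧ := δ⁻¹ • lnS (γ • E δ γ μ)

/-- `F_P = exp(A ⊗ B e^{-δσ}) exp(H ⊗ σ)`. -/
def FP : (U (LieL δ γ μ) ⊗[ℂ] U (LieL δ γ μ))⟦X⟧ :=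
  expS (A δ γ μ ⊗ₚ (B δ γ μ * expS (-(δ • sigma δ γ μ)))) * expS (H δ γ μ ⊗ₚ sigma δ γ μ)

/-- `ρ = (1/μ) ln(1 + μ B e^{-δσ})`. -/
def rho : (U (LieL δ γ μ))⟦X⟧ := lnDiv μ (B δ γ μ * expS (-(δ • sigma δ γ μ)))

/-- `Φ = exp(J ⊗ ρ)`. -/
def Phi : (U (LieL δ γ μ) ⊗[ℂ] U (LieL δ γ μ))⟦X⟧ := expS (J δ γ μ ⊗ₚ rho δ γ μ)

/-- `F = Φ F_P`. -/
def F : (U (LieL δ γ μ) ⊗[ℂ] U (LieL δ γ μ))⟦X⟧ := Phi δ γ μ * FP δ γ μ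

/-- `F̃ = Φ₂₁ F_P`. -/
def Ft : (U (LieL δ γ μ) ⊗[ℂ] U (LieL δ γ μ))⟦X⟧ := flip21 (Phi δ γ μ) * FP δ γ μ

end LieL

namespace LieL'

/-- `H` in `U(L')⟦X⟧`. -/
def H : (U (LieL' δ γ μ))⟦X⟧ := cst (gen δ γ μ 0)
/-- `zE` in `U(L')⟦X⟧`. -/
def E : (U (LieL' δ γ μ))⟦X⟧ := zcst (gen δ γ μ 1)
/-- `zA` in `U(L')⟦X⟧`. -/
def A : (U (LieL' δ γ μ))⟦X⟧ := zcst (gen δ γ μ 2)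
/-- `B` in `U(L')⟦X⟧`. -/
def B : (U (LieL' δ γ μ))⟦X⟧ := cst (gen δ γ μ 3)
/-- `J` in `U(L')⟦X⟧`. -/
def J : (U (LieL' δ γ μ))⟦X⟧ := cst (gen δ γ μ 4)

/-- `σ = (1/δ) ln(1 + γE)`. -/
def sigma : (U (LieL' δ γ μ))⟦X⟧ := δ⁻¹ • lnS (γ • E δ γ μ)

/-- `F_{P'} = exp(A ⊗ B) exp(H ⊗ σ)`. -/
def FP : (U (LieL' δ γ μ) ⊗[ℂ] U (LieL' δ γ μ))⟦X⟧ :=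
  expS (A δ γ μ ⊗ₚ B δ γ μ) * expS (H δ γ μ ⊗ₚ sigma δ γ μ)

/-- `ρ' = (1/μ) ln(1 + μA)`. -/
def rho : (U (LieL' δ γ μ))⟦X⟧ := lnDiv μ (A δ γ μ)

/-- `Φ' = exp(J ⊗ ρ')`. -/
def Phi : (U (LieL' δ γ μ) ⊗[ℂ] U (LieL' δ γ μ))⟦X⟧ := expS (J δ γ μ ⊗ₚ rho δ γ μ)

/-- `F' = Φ' F_{P'}`. -/
def F : (U (LieL' δ γ μ) ⊗[ℂ] U (LieL' δ γ μ))⟦X⟧ := Phi δ γ μ * FP δ γ μ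

/-- `F̃' = Φ'₂₁ F_{P'}`. -/
def Ft : (U (LieL' δ γ μ) ⊗[ℂ] U (LieL' δ γ μ))⟦X⟧ := flip21 (Phi δ γ μ) * FP δ γ μ

end LieL'

end Twists

end PET

end

/-! Each twist is a product of exponentials exp(x ⊗ y), so every coproduct is found by moving such
exponentials past simple tensors. Only two mechanisms occur. If x or y acts on a tensor factor by a
scalar weight k, that factor stays and the other one gains exp(k y) or exp(k x)
(`expS_tensorS_shift_left`, `expS_tensorS_shift_right`). If the commutator with x ⊗ y commutes with
x ⊗ y, the adjoint series stops after its linear term (`expS_tensorS_commutator_left`,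
`expS_tensorS_commutator_right`).

The cocycle condition for the inner twist exp(A ⊗ W) exp(H ⊗ σ) follows from the commutator [A, W] =
v - u, where u and v are the factors in Δ_F(A) = A ⊗ u + 1 ⊗ A and Δ_F(W) = W ⊗ 1 + v ⊗ W
(`isTwist_expS_mul_expS`). This covers both algebras: for L, W = B e^{-δσ}, u = e^{-δσ}, v = 1; for
L', W = B, u = 1, v = e^{δσ}. The relation 1 + γE = e^{δσ} makes the commutators come out right.

The element J commutes with H and E and gives A and B opposite weights, so it remains primitive
after the inner twist. So does an eigenvector w of ad J of weight μ, namely B e^{-δσ} for L and A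
for L'. Twisting further by exp(J ⊗ ρ) or exp(ρ ⊗ J) makes 1 + μw = e^{μρ} group-like, hence ρ
primitive (`isTwPrimitive_lnDiv`). Primitivity of J before and of ρ after the outer twist gives the
factorization formulas, and these formally imply the cocycle condition (`isTwist_expS_mul`,
`isTwist_expS_mul'`).

Two devices keep this elementary. Identities between power series in noncommuting elements are
checked below each degree N, where only finitely many terms count. Conjugations are written as F x =
y F (`SemiconjBy`), so inverses of the twists hardly ever appear. -/

noncomputable section

namespace PET

/-! ## Truncated equality of series -/

section Agree

variable {R : Type*} [Ring R]

/-- Two series have the same coefficients in all degrees below `N`. -/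
def AgreeBelow (N : ℕ) (f g : R⟦X⟧) : Prop :=
  ∀ n < N, PowerSeries.coeff n f = PowerSeries.coeff n g

theorem AgreeBelow.refl (N : ℕ) (f : R⟦X⟧) : AgreeBelow N f f := fun _ _ => rfl

theorem AgreeBelow.symm {N : ℕ} {f g : R⟦X⟧} (h : AgreeBelow N f g) : AgreeBelow N g f :=
  fun n hn => (h n hn).symm

theorem AgreeBelow.trans {N : ℕ} {f g k : R⟦X⟧} (h : AgreeBelow N f g) (h' : AgreeBelow N g k) :
    AgreeBelow N f k :=
  fun n hn => (h n hn).trans (h' n hn)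

theorem AgreeBelow.add {N : ℕ} {f g f' g' : R⟦X⟧} (h : AgreeBelow N f g)
    (h' : AgreeBelow N f' g') : AgreeBelow N (f + f') (g + g') :=
  fun n hn => by rw [map_add, map_add, h n hn, h' n hn]

theorem AgreeBelow.mul {N : ℕ} {f g f' g' : R⟦X⟧} (h : AgreeBelow N f g)
    (h' : AgreeBelow N f' g') : AgreeBelow N (f * f') (g * g') := fun n hn => by
  rw [PowerSeries.coeff_mul, PowerSeries.coeff_mul]
  refine Finset.sum_congr rfl fun p hp => ?_
  rw [Finset.HasAntidiagonal.mem_antidiagonal] at hp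
  rw [h p.1 (by omega), h' p.2 (by omega)]

/-- This replaces convergence: an infinite sum is exchanged for a partial sum below an arbitrary N,
and N is then released. -/
theorem AgreeBelow.eq {f g : R⟦X⟧} (h : ∀ N, AgreeBelow N f g) : f = g :=
  PowerSeries.ext fun n => h (n + 1) n n.lt_succ_self

theorem agreeBelow_zero_of_le_order {N : ℕ} {f : R⟦X⟧} (h : (N : ℕ∞) ≤ f.order) :
    AgreeBelow N f 0 := fun n hn => by
  rw [PowerSeries.coeff_of_lt_order n (lt_of_lt_of_le (by exact_mod_cast hn) h), map_zero]

theorem constantCoeff_mul_left {f : R⟦X⟧} (g : R⟦X⟧) (hf : PowerSeries.constantCoeff f = 0) :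
    PowerSeries.constantCoeff (f * g) = 0 := by
  rw [map_mul, hf, zero_mul]

theorem constantCoeff_mul_right (f : R⟦X⟧) {g : R⟦X⟧} (hg : PowerSeries.constantCoeff g = 0) :
    PowerSeries.constantCoeff (f * g) = 0 := by
  rw [map_mul, hg, mul_zero]

theorem constantCoeff_neg {f : R⟦X⟧} (hf : PowerSeries.constantCoeff f = 0) :
    PowerSeries.constantCoeff (-f) = 0 := by
  rw [map_neg, hf, neg_zero]

theorem constantCoeff_add {f g : R⟦X⟧} (hf : PowerSeries.constantCoeff f = 0)
    (hg : PowerSeries.constantCoeff g = 0) : PowerSeries.constantCoeff (f + g) = 0 := by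
  rw [map_add, hf, hg, add_zero]

theorem agreeBelow_pow_zero {N k : ℕ} (h : N ≤ k) {f : R⟦X⟧}
    (hf : PowerSeries.constantCoeff f = 0) : AgreeBelow N (f ^ k) 0 :=
  agreeBelow_zero_of_le_order
    (le_trans (by exact_mod_cast h) (PowerSeries.le_order_pow_of_constantCoeff_eq_zero k hf))

end Agree

/-! ## Evaluation of power series -/

section Eval

variable {R : Type*} [Ring R] [Algebra ℂ R]

theorem coeff_smulS (n : ℕ) (c : ℂ) (f : R⟦X⟧) :
    PowerSeries.coeff n (c • f) = c • PowerSeries.coeff n f := rfl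

theorem constantCoeff_smulS (c : ℂ) {f : R⟦X⟧} (hf : PowerSeries.constantCoeff f = 0) :
    PowerSeries.constantCoeff (c • f) = 0 := by
  rw [← PowerSeries.coeff_zero_eq_constantCoeff_apply] at hf ⊢
  rw [coeff_smulS, hf, smul_zero]

theorem agreeBelow_evalSeries (a : ℂ⟦X⟧) {f : R⟦X⟧} (hf : PowerSeries.constantCoeff f = 0)
    (N : ℕ) : AgreeBelow N (evalSeries a f)
      (∑ k ∈ Finset.range N, PowerSeries.coeff k a • f ^ k) :=
  fun _ hn => coeff_evalSeries a hf hn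

/-- A polynomial which agrees with `a` below degree `N` may be used to compute `a(f)` there. -/
theorem agreeBelow_evalSeries_aeval {a : ℂ⟦X⟧} {f : R⟦X⟧}
    (hf : PowerSeries.constantCoeff f = 0) {N : ℕ} {p : Polynomial ℂ}
    (hp : AgreeBelow N a (p : ℂ⟦X⟧)) : AgreeBelow N (evalSeries a f) (Polynomial.aeval f p) := by
  intro n hn
  -- The range must exceed N, so that it computes a(f) in degree n, and also the degree of p. Terms
  -- of p of index at least N may differ from those of a, but there the power of f has no
  -- coefficient in degree n.
  have hM : p.natDegree < max N (p.natDegree + 1) := lt_max_of_lt_right (Nat.lt_succ_self _)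
  rw [coeff_evalSeries a hf (lt_max_of_lt_left hn : n < max N (p.natDegree + 1)),
    Polynomial.aeval_eq_sum_range' hM, map_sum, map_sum]
  refine Finset.sum_congr rfl fun k _ => ?_
  rw [coeff_smulS, coeff_smulS]
  by_cases hk : k < N
  · rw [hp k hk, Polynomial.coeff_coe]
  · rw [agreeBelow_pow_zero (not_lt.mp hk) hf n hn, map_zero, smul_zero, smul_zero]

theorem agreeBelow_trunc (N : ℕ) (a : ℂ⟦X⟧) :
    AgreeBelow N a ((PowerSeries.trunc N a : Polynomial ℂ) : ℂ⟦X⟧) :=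
  fun n hn => by rw [PowerSeries.coeff_coe_trunc_of_lt hn]

/-- Only powers of the single element f occur, so polynomial evaluation at f is multiplicative
although R is not commutative. The product of the two truncations need not be the truncation of a *
b, but it agrees with a * b below N. -/
theorem evalSeries_mul (a b : ℂ⟦X⟧) {f : R⟦X⟧} (hf : PowerSeries.constantCoeff f = 0) :
    evalSeries (a * b) f = evalSeries a f * evalSeries b f := by
  refine AgreeBelow.eq fun N => ?_
  refine (agreeBelow_evalSeries_aeval hf (p := PowerSeries.trunc N a * PowerSeries.trunc N b)
    ?_).trans ?_
  · rw [Polynomial.coe_mul]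
    exact (agreeBelow_trunc N a).mul (agreeBelow_trunc N b)
  · rw [map_mul]
    exact ((agreeBelow_evalSeries_aeval hf (agreeBelow_trunc N a)).mul
      (agreeBelow_evalSeries_aeval hf (agreeBelow_trunc N b))).symm

theorem evalSeries_congr {N : ℕ} {a b : ℂ⟦X⟧} (h : AgreeBelow N a b) {f : R⟦X⟧}
    (hf : PowerSeries.constantCoeff f = 0) :
    AgreeBelow N (evalSeries a f) (evalSeries b f) :=
  (agreeBelow_evalSeries_aeval hf (h.trans (agreeBelow_trunc N b))).trans
    (agreeBelow_evalSeries_aeval hf (agreeBelow_trunc N b)).symm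

theorem evalSeries_coe (p : Polynomial ℂ) {f : R⟦X⟧} (hf : PowerSeries.constantCoeff f = 0) :
    evalSeries (p : ℂ⟦X⟧) f = Polynomial.aeval f p :=
  AgreeBelow.eq fun N => agreeBelow_evalSeries_aeval hf (AgreeBelow.refl N _)

theorem evalSeries_add (a b : ℂ⟦X⟧) (f : R⟦X⟧) :
    evalSeries (a + b) f = evalSeries a f + evalSeries b f := by
  ext n
  simp only [evalSeries, map_add, PowerSeries.coeff_mk, add_smul, Finset.sum_add_distrib]

theorem evalSeries_smul (c : ℂ) (a : ℂ⟦X⟧) (f : R⟦X⟧) :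
    evalSeries (c • a) f = c • evalSeries a f := by
  ext n
  rw [coeff_smulS]
  simp only [evalSeries, PowerSeries.coeff_mk, Finset.smul_sum, coeff_smulS, smul_smul,
    smul_eq_mul]

theorem evalSeries_one {f : R⟦X⟧} (hf : PowerSeries.constantCoeff f = 0) :
    evalSeries 1 f = 1 := by
  simpa using evalSeries_coe 1 hf

theorem evalSeries_X {f : R⟦X⟧} (hf : PowerSeries.constantCoeff f = 0) :
    evalSeries PowerSeries.X f = f := by
  simpa using evalSeries_coe Polynomial.X hf

theorem evalSeries_zero_left (f : R⟦X⟧) : evalSeries 0 f = 0 := by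
  ext n
  simp [evalSeries]

theorem evalSeries_pow (a : ℂ⟦X⟧) (k : ℕ) {f : R⟦X⟧} (hf : PowerSeries.constantCoeff f = 0) :
    evalSeries (a ^ k) f = evalSeries a f ^ k := by
  induction k with
  | zero => rw [pow_zero, pow_zero, evalSeries_one hf]
  | succ k ih => rw [pow_succ, pow_succ, evalSeries_mul _ _ hf, ih]

theorem evalSeries_sum {ι : Type*} (s : Finset ι) (a : ι → ℂ⟦X⟧) (f : R⟦X⟧) :
    evalSeries (∑ i ∈ s, a i) f = ∑ i ∈ s, evalSeries (a i) f := by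
  classical
  induction s using Finset.induction_on with
  | empty => simp [evalSeries_zero_left]
  | insert i s hi ih => rw [Finset.sum_insert hi, Finset.sum_insert hi, evalSeries_add, ih]

theorem constantCoeff_evalSeries (a : ℂ⟦X⟧) (f : R⟦X⟧) :
    PowerSeries.constantCoeff (evalSeries a f) =
      PowerSeries.constantCoeff a • (1 : R) := by
  rw [← PowerSeries.coeff_zero_eq_constantCoeff_apply, evalSeries, PowerSeries.coeff_mk]
  simp

theorem constantCoeff_evalSeries_eq_zero {a : ℂ⟦X⟧} (ha : PowerSeries.constantCoeff a = 0)
    (f : R⟦X⟧) : PowerSeries.constantCoeff (evalSeries a f) = 0 := by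
  rw [constantCoeff_evalSeries, ha, zero_smul]

theorem evalSeries_zero_right (a : ℂ⟦X⟧) :
    evalSeries a (0 : R⟦X⟧) = PowerSeries.constantCoeff a • 1 := by
  ext n
  rw [evalSeries, PowerSeries.coeff_mk, Finset.sum_range_succ', coeff_smulS]
  simp

/-- Composition: `a(b(f)) = (a ∘ b)(f)`. -/
theorem evalSeries_evalSeries (a : ℂ⟦X⟧) {b : ℂ⟦X⟧} (hb : PowerSeries.constantCoeff b = 0)
    {f : R⟦X⟧} (hf : PowerSeries.constantCoeff f = 0) :
    evalSeries a (evalSeries b f) = evalSeries (evalSeries a b) f := by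
  refine AgreeBelow.eq fun N => ?_
  refine (agreeBelow_evalSeries a (constantCoeff_evalSeries_eq_zero hb f) N).trans ?_
  -- The partial sums of a ∘ b are formed in ℂ⟦X⟧ and approximate it there; evaluation at f
  -- preserves the approximation.
  have h := evalSeries_congr (agreeBelow_evalSeries a hb N) hf
  refine AgreeBelow.trans (fun n _ => ?_) h.symm
  rw [evalSeries_sum]
  simp only [evalSeries_smul, evalSeries_pow _ _ hf]

/-- Coproduct, counit, flip and leg embeddings are all coefficientwise algebra maps, so this carries
each of them inside exponentials and logarithms. -/
theorem evalSeries_map {S : Type*} [Ring S] [Algebra ℂ S] (φ : R →ₐ[ℂ] S) (a : ℂ⟦X⟧)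
    (f : R⟦X⟧) :
    PowerSeries.map (φ : R →+* S) (evalSeries a f) =
      evalSeries a (PowerSeries.map (φ : R →+* S) f) := by
  ext n
  simp only [evalSeries, PowerSeries.coeff_map, PowerSeries.coeff_mk, ← map_pow, map_sum]
  refine Finset.sum_congr rfl fun k _ => ?_
  exact map_smul φ _ _

theorem map_smulS {S : Type*} [Ring S] [Algebra ℂ S] (φ : R →ₐ[ℂ] S) (c : ℂ) (f : R⟦X⟧) :
    PowerSeries.map (φ : R →+* S) (c • f) = c • PowerSeries.map (φ : R →+* S) f := by
  ext n
  simp only [PowerSeries.coeff_map, coeff_smulS]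
  exact map_smul φ _ _

/-! ### Commutation rules -/

theorem semiconjBy_smul {g x y : R⟦X⟧} (c : ℂ) (h : SemiconjBy g x y) :
    SemiconjBy g (c • x) (c • y) := by
  rw [SemiconjBy, mul_smul_comm, smul_mul_assoc, h.eq]

/-- The relation g f = f' g passes to all powers, hence to power series; g need not be invertible.
-/
theorem semiconjBy_evalSeries (a : ℂ⟦X⟧) {g f f' : R⟦X⟧}
    (hf : PowerSeries.constantCoeff f = 0) (hf' : PowerSeries.constantCoeff f' = 0)
    (h : SemiconjBy g f f') : SemiconjBy g (evalSeries a f) (evalSeries a f') := by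
  refine AgreeBelow.eq fun N => ?_
  refine ((AgreeBelow.refl N g).mul (agreeBelow_evalSeries a hf N)).trans ?_
  refine AgreeBelow.trans ?_ ((agreeBelow_evalSeries a hf' N).mul (AgreeBelow.refl N g)).symm
  rw [Finset.mul_sum, Finset.sum_mul]
  refine fun n _ => congrArg _ (Finset.sum_congr rfl fun k _ => ?_)
  exact semiconjBy_smul _ (h.pow_right k)

theorem commute_evalSeries (a : ℂ⟦X⟧) {f g : R⟦X⟧} (hf : PowerSeries.constantCoeff f = 0)
    (h : Commute g f) : Commute g (evalSeries a f) :=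
  semiconjBy_evalSeries a hf hf h

/-- The commutator with g is a derivation, and as h commutes with f the n terms of the Leibniz rule
coincide. For n = 0 the truncated exponent is harmless because its coefficient is zero. -/
theorem pow_mul_of_commutator {f g h : R⟦X⟧} (hfg : g * f = f * g + h) (hh : Commute f h)
    (n : ℕ) : g * f ^ n = f ^ n * g + (n : ℂ) • (h * f ^ (n - 1)) := by
  induction n with
  | zero => simp
  | succ n ih =>
    rw [pow_succ, ← mul_assoc, ih, add_mul, mul_assoc, hfg, mul_add, ← mul_assoc, add_assoc,
      smul_mul_assoc, mul_assoc h]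
    congr 1
    rw [(hh.pow_left n).eq, Nat.add_sub_cancel, Nat.cast_succ, add_smul, one_smul, add_comm]
    congr 1
    rcases n with _ | n
    · simp
    · rw [Nat.add_sub_cancel, pow_succ]

/-- `[g, a(f)] = [g, f] a'(f)` if `f` commutes with `[g, f]`. -/
theorem mul_evalSeries_of_commutator (a : ℂ⟦X⟧) {f g h : R⟦X⟧}
    (hf : PowerSeries.constantCoeff f = 0) (hfg : g * f = f * g + h) (hh : Commute f h) :
    g * evalSeries a f =
      evalSeries a f * g + h * evalSeries (PowerSeries.derivative ℂ a) f := by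
  refine AgreeBelow.eq fun N => ?_
  -- One extra term of a is taken because differentiation lowers indices by one: once the constant
  -- term drops out, exactly N terms of a' remain.
  have h1 := agreeBelow_evalSeries a hf (N + 1)
  have h2 := agreeBelow_evalSeries (PowerSeries.derivative ℂ a) hf N
  have h1' : AgreeBelow N (evalSeries a f) _ := fun n hn => h1 n (by omega)
  refine ((AgreeBelow.refl N g).mul h1').trans ?_
  refine AgreeBelow.trans ?_
    ((h1'.mul (AgreeBelow.refl N g)).add ((AgreeBelow.refl N h).mul h2)).symm
  refine fun n _ => congrArg _ ?_
  rw [Finset.mul_sum, Finset.sum_mul, Finset.mul_sum]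
  simp only [mul_smul_comm, pow_mul_of_commutator hfg hh, smul_add, Finset.sum_add_distrib,
    smul_mul_assoc]
  congr 1
  rw [Finset.sum_range_succ']
  simp only [Nat.cast_zero, zero_smul, smul_zero, add_zero, Nat.add_sub_cancel, smul_smul]
  refine Finset.sum_congr rfl fun k _ => ?_
  rw [PowerSeries.coeff_derivative, Nat.cast_succ]

/-! ### Exponentials -/

theorem expS_zero : expS (0 : R⟦X⟧) = 1 := by
  rw [expS, evalSeries_zero_right, PowerSeries.constantCoeff_exp, one_smul]

/-- By the binomial theorem for commuting elements, the partial sum for f + g runs over the triangle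
p₁ + p₂ < N, while the product of the partial sums runs over the whole square. The terms outside the
triangle have order at least N and are invisible below N. -/
theorem expS_add {f g : R⟦X⟧} (hf : PowerSeries.constantCoeff f = 0)
    (hg : PowerSeries.constantCoeff g = 0) (h : Commute f g) :
    expS (f + g) = expS f * expS g := by
  refine AgreeBelow.eq fun N => ?_
  refine (agreeBelow_evalSeries _ (constantCoeff_add hf hg) N).trans ?_
  refine AgreeBelow.trans ?_
    ((agreeBelow_evalSeries _ hf N).mul (agreeBelow_evalSeries _ hg N)).symm
  intro n hn
  have hfin : (Finset.range N).biUnion (fun k => Finset.HasAntidiagonal.antidiagonal k) =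
      (Finset.range N ×ˢ Finset.range N).filter (fun p => p.1 + p.2 < N) := by
    ext p
    simp only [Finset.mem_biUnion, Finset.mem_range, Finset.HasAntidiagonal.mem_antidiagonal,
      Finset.mem_filter, Finset.mem_product]
    constructor
    · rintro ⟨k, hk, rfl⟩; omega
    · rintro ⟨_, h⟩; exact ⟨_, h, rfl⟩
  have key : ∀ k, PowerSeries.coeff k (PowerSeries.exp ℂ) • (f + g) ^ k =
      ∑ p ∈ Finset.HasAntidiagonal.antidiagonal k,
        (PowerSeries.coeff p.1 (PowerSeries.exp ℂ) • f ^ p.1) *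
        (PowerSeries.coeff p.2 (PowerSeries.exp ℂ) • g ^ p.2) := by
    intro k
    rw [h.add_pow', Finset.smul_sum]
    refine Finset.sum_congr rfl fun p hp => ?_
    rw [Finset.HasAntidiagonal.mem_antidiagonal] at hp
    rw [smul_mul_smul_comm, ← Nat.cast_smul_eq_nsmul ℂ, smul_smul]
    congr 1
    simp only [PowerSeries.coeff_exp, map_div₀, map_one, map_natCast]
    subst hp
    have h1 : ((p.1 + p.2).factorial : ℂ) ≠ 0 := by exact_mod_cast Nat.factorial_ne_zero _
    have h2 : (p.1.factorial : ℂ) ≠ 0 := by exact_mod_cast Nat.factorial_ne_zero _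
    have h3 : (p.2.factorial : ℂ) ≠ 0 := by exact_mod_cast Nat.factorial_ne_zero _
    have h4 := Nat.add_choose_mul_factorial_mul_factorial p.1 p.2
    have h5 : (((p.1 + p.2).choose p.1 : ℕ) : ℂ) * p.1.factorial * p.2.factorial =
        (p.1 + p.2).factorial := by
      rw [Nat.choose_symm_add]; exact_mod_cast h4
    field_simp
    linear_combination h5
  rw [Finset.sum_congr rfl fun k _ => key k, Finset.sum_mul_sum, ← Finset.sum_product',
    ← Finset.sum_biUnion, hfin, map_sum, map_sum]
  · refine Finset.sum_subset (Finset.filter_subset _ _) fun p hp hp' => ?_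
    have hp'' : N ≤ p.1 + p.2 := by
      by_contra hlt
      exact hp' (Finset.mem_filter.2 ⟨hp, not_le.mp hlt⟩)
    rw [smul_mul_smul_comm, coeff_smulS, PowerSeries.coeff_of_lt_order n, smul_zero]
    refine lt_of_lt_of_le (b := ((p.1 + p.2 : ℕ) : ℕ∞)) (by exact_mod_cast (by omega)) ?_
    refine le_trans ?_ (PowerSeries.le_order_mul (f ^ p.1) (g ^ p.2))
    rw [Nat.cast_add]
    exact add_le_add (PowerSeries.le_order_pow_of_constantCoeff_eq_zero _ hf)
      (PowerSeries.le_order_pow_of_constantCoeff_eq_zero _ hg)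
  · intro i _ j _ hij
    refine Finset.disjoint_left.2 fun p hp hp' => hij ?_
    rw [Finset.HasAntidiagonal.mem_antidiagonal] at hp hp'
    omega

theorem expS_mul_expS_neg {f : R⟦X⟧} (hf : PowerSeries.constantCoeff f = 0) :
    expS f * expS (-f) = 1 := by
  rw [← expS_add hf (constantCoeff_neg hf) (Commute.refl f).neg_right, add_neg_cancel, expS_zero]

theorem expS_neg_mul_expS {f : R⟦X⟧} (hf : PowerSeries.constantCoeff f = 0) :
    expS (-f) * expS f = 1 := by
  simpa using expS_mul_expS_neg (constantCoeff_neg hf)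

theorem isUnit_expS {f : R⟦X⟧} (hf : PowerSeries.constantCoeff f = 0) : IsUnit (expS f) :=
  ⟨⟨_, _, expS_mul_expS_neg hf, expS_neg_mul_expS hf⟩, rfl⟩

theorem commute_expS {f g : R⟦X⟧} (hf : PowerSeries.constantCoeff f = 0)
    (h : Commute g f) : Commute g (expS f) :=
  commute_evalSeries _ hf h

theorem semiconjBy_expS {g f f' : R⟦X⟧} (hf : PowerSeries.constantCoeff f = 0)
    (hf' : PowerSeries.constantCoeff f' = 0) (h : SemiconjBy g f f') :
    SemiconjBy g (expS f) (expS f') :=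
  semiconjBy_evalSeries _ hf hf' h

/-- `exp(f) g exp(f)⁻¹ = g + [f, g]` if `f` commutes with `[f, g]`. -/
theorem expS_semiconjBy_of_commutator {f g h : R⟦X⟧} (hf : PowerSeries.constantCoeff f = 0)
    (hfg : f * g = g * f + h) (hh : Commute f h) : SemiconjBy (expS f) g (g + h) := by
  have hfg' : g * f = f * g + -h := by rw [hfg]; abel
  have := mul_evalSeries_of_commutator (PowerSeries.exp ℂ) hf hfg' hh.neg_right
  rw [PowerSeries.derivative_exp] at this
  change g * expS f = expS f * g + -h * expS f at this
  rw [SemiconjBy, add_mul, this, neg_mul]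
  abel

/-- `exp(f) g exp(f)⁻¹ = g exp(k)` if `f g = g (f + k)` and `k` commutes with `f`. -/
theorem expS_semiconjBy_of_shift {f g k : R⟦X⟧} (hf : PowerSeries.constantCoeff f = 0)
    (hk : PowerSeries.constantCoeff k = 0) (hfg : f * g = g * (f + k)) (hh : Commute f k) :
    SemiconjBy (expS f) g (g * expS k) := by
  -- Read backwards, the hypothesis says that g intertwines f + k with f, hence also their
  -- exponentials.
  have h : SemiconjBy g (f + k) f := hfg.symm
  have := (semiconjBy_expS (constantCoeff_add hf hk) hf h).eq
  rw [expS_add hf hk hh] at this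
  rw [SemiconjBy, ← this, mul_assoc,
    ((commute_expS hf (commute_expS hk hh).symm).symm).eq]

/-- Commutation reduces the claim to exp(d) = 1 for d = f - g. Write exp(X) - 1 = X u with u of
constant term 1; then d u(d) = 0, and u(d) has a right inverse, so d = 0. -/
theorem expS_injective_of_commute {f g : R⟦X⟧} (hf : PowerSeries.constantCoeff f = 0)
    (hg : PowerSeries.constantCoeff g = 0) (h : Commute f g) (he : expS f = expS g) : f = g := by
  have hd : PowerSeries.constantCoeff (f - g) = 0 := by rw [map_sub, hf, hg, sub_zero]
  have h1 : expS (f - g) = 1 := by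
    rw [sub_eq_add_neg, expS_add hf (constantCoeff_neg hg) h.neg_right, he, expS_mul_expS_neg hg]
  obtain ⟨u, hu⟩ : PowerSeries.X ∣ (PowerSeries.exp ℂ - 1 : ℂ⟦X⟧) := by
    rw [PowerSeries.X_dvd_iff]; simp
  have hu0 : PowerSeries.constantCoeff u = 1 := by
    have := congrArg (PowerSeries.coeff 1) hu
    rw [show (1 : ℕ) = 0 + 1 from rfl, PowerSeries.coeff_succ_X_mul] at this
    simpa [PowerSeries.coeff_exp, PowerSeries.coeff_one] using this.symm
  obtain ⟨v, hv⟩ : ∃ v, u * v = 1 :=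
    (PowerSeries.isUnit_iff_constantCoeff.2 (by rw [hu0]; exact isUnit_one)).exists_right_inv
  have h2 : evalSeries (PowerSeries.exp ℂ) (f - g) = (f - g) * evalSeries u (f - g) + 1 := by
    rw [eq_add_of_sub_eq hu, evalSeries_add, evalSeries_mul _ _ hd, evalSeries_X hd,
      evalSeries_one hd]
  have h3 : (f - g) * evalSeries u (f - g) = 0 := by
    have h1' : evalSeries (PowerSeries.exp ℂ) (f - g) = 1 := h1
    rw [h2] at h1'
    exact add_eq_right.mp h1'
  have h4 : f - g = 0 := by
    rw [← mul_one (f - g), ← evalSeries_one hd, ← hv, evalSeries_mul _ _ hd, ← mul_assoc, h3,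
      zero_mul]
  exact sub_eq_zero.mp h4

/-! ### Logarithms -/

theorem constantCoeff_lnDivSeries (c : ℂ) : PowerSeries.constantCoeff (lnDivSeries c) = 0 := by
  rw [← PowerSeries.coeff_zero_eq_constantCoeff_apply, lnDivSeries, PowerSeries.coeff_mk,
    if_pos rfl]

theorem constantCoeff_lnDiv (c : ℂ) (f : R⟦X⟧) : PowerSeries.constantCoeff (lnDiv c f) = 0 :=
  constantCoeff_evalSeries_eq_zero (constantCoeff_lnDivSeries c) f

/-- The derivative is the geometric series of -cX, for c = 0 as well. -/
theorem derivative_lnDivSeries_mul (c : ℂ) :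
    PowerSeries.derivative ℂ (lnDivSeries c) * (1 + c • PowerSeries.X) = 1 := by
  have hd : ∀ n, PowerSeries.coeff n (PowerSeries.derivative ℂ (lnDivSeries c)) = (-c) ^ n := by
    intro n
    rw [PowerSeries.coeff_derivative, lnDivSeries, PowerSeries.coeff_mk, if_neg n.succ_ne_zero]
    have : (n : ℂ) + 1 ≠ 0 := by exact_mod_cast n.succ_ne_zero
    push_cast
    field_simp
  ext n
  rw [mul_add, mul_one, mul_smul_comm, map_add, coeff_smulS, hd]
  rcases n with _ | n
  · simp
  · rw [PowerSeries.coeff_succ_mul_X, hd, PowerSeries.coeff_one, if_neg n.succ_ne_zero, pow_succ,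
      smul_eq_mul]
    ring

theorem evalSeries_derivative_chain (a : ℂ⟦X⟧) {b : ℂ⟦X⟧}
    (hb : PowerSeries.constantCoeff b = 0) :
    PowerSeries.derivative ℂ (evalSeries a b) =
      PowerSeries.derivative ℂ b * evalSeries (PowerSeries.derivative ℂ a) b := by
  refine AgreeBelow.eq fun N => ?_
  have h1 := agreeBelow_evalSeries a hb (N + 1)
  have h2 := agreeBelow_evalSeries (PowerSeries.derivative ℂ a) hb N
  refine AgreeBelow.trans (g := PowerSeries.derivative ℂ
    (∑ k ∈ Finset.range (N + 1), PowerSeries.coeff k a • b ^ k)) ?_ ?_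
  · intro n hn
    rw [PowerSeries.coeff_derivative, PowerSeries.coeff_derivative, h1 (n + 1) (by omega)]
  · refine AgreeBelow.trans ?_ ((AgreeBelow.refl N _).mul h2).symm
    refine fun n _ => congrArg (PowerSeries.coeff n) ?_
    rw [map_sum, Finset.sum_range_succ', Finset.mul_sum]
    simp only [Derivation.map_smul, Derivation.leibniz_pow, pow_zero,
      Derivation.map_one_eq_zero, smul_zero, add_zero, Nat.add_sub_cancel]
    refine Finset.sum_congr rfl fun k _ => ?_
    rw [PowerSeries.coeff_derivative, ← Nat.cast_smul_eq_nsmul ℂ, smul_smul, Nat.cast_succ,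
      smul_eq_mul, mul_smul_comm, mul_comm (b ^ k)]

/-- The left side y solves y' (1 + cX) = c y with y(0) = 1. In coefficients, (n + 1) yₙ₊₁ = c (1 -
n) yₙ; the factor 1 - n vanishes at n = 1 and kills everything from degree 2 on. -/
theorem expS_smul_lnDivSeries (c : ℂ) :
    expS (c • lnDivSeries c) = (1 + c • PowerSeries.X : ℂ⟦X⟧) := by
  have h0 := constantCoeff_smulS c (constantCoeff_lnDivSeries c)
  set y : ℂ⟦X⟧ := expS (c • lnDivSeries c) with hy
  have hy' : PowerSeries.derivative ℂ y * (1 + c • PowerSeries.X) = c • y := by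
    rw [hy, expS, evalSeries_derivative_chain _ h0, PowerSeries.derivative_exp, Derivation.map_smul,
      mul_right_comm, smul_mul_assoc, derivative_lnDivSeries_mul, smul_mul_assoc, one_mul]
  have hy0 : PowerSeries.coeff 0 y = 1 := by
    rw [PowerSeries.coeff_zero_eq_constantCoeff_apply, hy, expS, constantCoeff_evalSeries,
      PowerSeries.constantCoeff_exp, one_smul]
  have hrec : ∀ n : ℕ, PowerSeries.coeff (n + 1) y * (n + 1) =
      c * (1 - n) * PowerSeries.coeff n y := by
    intro n
    have := congrArg (PowerSeries.coeff n) hy'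
    rw [mul_add, mul_one, mul_smul_comm, map_add, coeff_smulS, coeff_smulS,
      PowerSeries.coeff_derivative, smul_eq_mul, smul_eq_mul] at this
    rcases n with _ | n
    · simpa using this
    · rw [PowerSeries.coeff_succ_mul_X, PowerSeries.coeff_derivative] at this
      push_cast at this ⊢
      linear_combination this
  have hne : ∀ n : ℕ, (n : ℂ) + 1 ≠ 0 := fun n => by exact_mod_cast n.succ_ne_zero
  have hy1 : PowerSeries.coeff 1 y = c := by simpa [hy0] using hrec 0
  have hy2 : ∀ n, PowerSeries.coeff (n + 2) y = 0 := by
    intro n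
    induction n with
    | zero =>
      have := hrec 1
      norm_num at this
      simpa using this
    | succ n ih =>
      have := hrec (n + 2)
      rw [ih, mul_zero] at this
      exact (mul_eq_zero.mp this).resolve_right (hne _)
  ext n
  rw [map_add, coeff_smulS]
  rcases n with _ | _ | n
  · simp [hy0]
  · simp [hy1, PowerSeries.coeff_one]
  · rw [hy2, PowerSeries.coeff_one, if_neg (by omega), PowerSeries.coeff_X, if_neg (by omega)]
    simp

/-- `exp(ln(1 + c f)) = 1 + c f`. -/
theorem expS_smul_lnDiv (c : ℂ) {f : R⟦X⟧} (hf : PowerSeries.constantCoeff f = 0) :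
    expS (c • lnDiv c f) = 1 + c • f := by
  rw [lnDiv, ← evalSeries_smul, expS,
    evalSeries_evalSeries _ (constantCoeff_smulS c (constantCoeff_lnDivSeries c)) hf]
  change evalSeries (expS (c • lnDivSeries c)) f = _
  rw [expS_smul_lnDivSeries, evalSeries_add, evalSeries_smul, evalSeries_one hf, evalSeries_X hf]

theorem lnDiv_zero_left {f : R⟦X⟧} (hf : PowerSeries.constantCoeff f = 0) : lnDiv 0 f = f := by
  have : lnDivSeries 0 = PowerSeries.X := by
    ext n
    rw [lnDivSeries, PowerSeries.coeff_mk, PowerSeries.coeff_X]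
    rcases n with _ | _ | n <;> simp
  rw [lnDiv, this, evalSeries_X hf]

theorem lnDiv_zero_right (c : ℂ) : lnDiv c (0 : R⟦X⟧) = 0 := by
  rw [lnDiv, evalSeries_zero_right, constantCoeff_lnDivSeries, zero_smul]

/-- The functional equation of the logarithm. -/
theorem lnDiv_add_add_mul (c : ℂ) {f g : R⟦X⟧} (hf : PowerSeries.constantCoeff f = 0)
    (hg : PowerSeries.constantCoeff g = 0) (h : Commute f g) :
    lnDiv c (f + g + c • (f * g)) = lnDiv c f + lnDiv c g := by
  have hfg : PowerSeries.constantCoeff (f + g + c • (f * g)) = 0 :=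
    constantCoeff_add (constantCoeff_add hf hg)
      (constantCoeff_smulS c (constantCoeff_mul_left g hf))
  rcases eq_or_ne c 0 with rfl | hc
  · rw [lnDiv_zero_left hfg, lnDiv_zero_left hf, lnDiv_zero_left hg, zero_smul, add_zero]
  -- For c ≠ 0 the exponentials of c times both sides equal (1 + cf)(1 + cg), and injectivity of exp
  -- on commuting elements applies. For c = 0 multiplication by c would lose all information, hence
  -- the separate case.
  · have h1 : Commute (lnDiv c f) (lnDiv c g) :=
      commute_evalSeries _ hg (commute_evalSeries _ hf h.symm).symm
    have h2 : ∀ k, Commute k f → Commute k g → Commute k (lnDiv c (f + g + c • (f * g))) :=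
      fun k h1 h2 => commute_evalSeries _ hfg
        ((h1.add_right h2).add_right ((h1.mul_right h2).smul_right c))
    have h3 : Commute (lnDiv c (f + g + c • (f * g))) (lnDiv c f + lnDiv c g) :=
      (commute_evalSeries _ hf (h2 f (Commute.refl f) h).symm).add_right
        (commute_evalSeries _ hg (h2 g h.symm (Commute.refl g)).symm)
    have hc' : ∀ k l : R⟦X⟧, c • k = c • l → k = l := fun k l hkl => by
      rw [← inv_smul_smul₀ hc k, hkl, inv_smul_smul₀ hc]
    refine hc' _ _ (expS_injective_of_commute (constantCoeff_smulS c (constantCoeff_lnDiv c _))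
      (constantCoeff_smulS c (constantCoeff_add (constantCoeff_lnDiv c _)
        (constantCoeff_lnDiv c _))) ((h3.smul_left c).smul_right c) ?_)
    rw [smul_add, expS_add (constantCoeff_smulS c (constantCoeff_lnDiv c _))
      (constantCoeff_smulS c (constantCoeff_lnDiv c _)) ((h1.smul_left c).smul_right c),
      expS_smul_lnDiv c hf, expS_smul_lnDiv c hg, expS_smul_lnDiv c hfg, add_mul, mul_add, mul_add,
      one_mul, one_mul, mul_one, smul_add, smul_add, smul_mul_smul_comm, smul_smul]
    abel

/-- Both sides invert 1 + c f. The exponential form is the useful one, because such inverses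
reappear in the coproducts as e^{-δσ} and e^{-μρ}. -/
theorem evalSeries_derivative_lnDivSeries (c : ℂ) {f : R⟦X⟧}
    (hf : PowerSeries.constantCoeff f = 0) :
    evalSeries (PowerSeries.derivative ℂ (lnDivSeries c)) f = expS (-(c • lnDiv c f)) := by
  have h1 : evalSeries (PowerSeries.derivative ℂ (lnDivSeries c)) f * expS (c • lnDiv c f) = 1 := by
    have := congrArg (fun a => evalSeries a f) (derivative_lnDivSeries_mul c)
    simp only [evalSeries_mul _ _ hf, evalSeries_add, evalSeries_smul, evalSeries_one hf,
      evalSeries_X hf] at this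
    rw [expS_smul_lnDiv c hf, this]
  exact left_inv_eq_right_inv h1
    (expS_mul_expS_neg (constantCoeff_smulS c (constantCoeff_lnDiv c f)))

/-- `[g, (1/c) ln(1 + c f)] = [g, f] (1 + c f)⁻¹` if `f` commutes with `[g, f]`. -/
theorem mul_lnDiv_of_commutator (c : ℂ) {f g h : R⟦X⟧} (hf : PowerSeries.constantCoeff f = 0)
    (hfg : g * f = f * g + h) (hh : Commute f h) :
    g * lnDiv c f = lnDiv c f * g + h * expS (-(c • lnDiv c f)) := by
  rw [← evalSeries_derivative_lnDivSeries c hf]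
  exact mul_evalSeries_of_commutator _ hf hfg hh

/-- `1 - (1 + c f)⁻¹ = c f (1 + c f)⁻¹`. -/
theorem smul_mul_expS_neg_lnDiv (c : ℂ) {f : R⟦X⟧} (hf : PowerSeries.constantCoeff f = 0) :
    (c • f) * expS (-(c • lnDiv c f)) = 1 - expS (-(c • lnDiv c f)) := by
  have h := expS_mul_expS_neg (constantCoeff_smulS c (constantCoeff_lnDiv c f))
  rw [expS_smul_lnDiv c hf, add_mul, one_mul] at h
  exact eq_sub_of_add_eq' h

end Eval

/-! ### Coefficientwise ring maps of power series -/

theorem map_mapS {R S T : Type*} [Ring R] [Ring S] [Ring T] (φ : R →+* S) (ψ : S →+* T)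
    (χ : R →+* T) (h : ∀ x, ψ (φ x) = χ x) (f : R⟦X⟧) :
    PowerSeries.map ψ (PowerSeries.map φ f) = PowerSeries.map χ f := by
  ext n
  simp only [PowerSeries.coeff_map, h]

theorem commute_mapS {R S T : Type*} [Ring R] [Ring S] [Ring T] (φ : R →+* T) (ψ : S →+* T)
    (h : ∀ x y, Commute (φ x) (ψ y)) (f : R⟦X⟧) (g : S⟦X⟧) :
    Commute (PowerSeries.map φ f) (PowerSeries.map ψ g) := by
  refine PowerSeries.ext fun n => ?_
  rw [PowerSeries.coeff_mul, PowerSeries.coeff_mul, ← Finset.Nat.sum_antidiagonal_swap]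
  refine Finset.sum_congr rfl fun p _ => ?_
  simp only [PowerSeries.coeff_map, Prod.fst_swap, Prod.snd_swap]
  exact h _ _

theorem constantCoeff_mapS {R S : Type*} [Ring R] [Ring S] (φ : R →+* S) {f : R⟦X⟧}
    (hf : PowerSeries.constantCoeff f = 0) :
    PowerSeries.constantCoeff (PowerSeries.map φ f) = 0 := by
  rw [← PowerSeries.coeff_zero_eq_constantCoeff_apply] at hf ⊢
  rw [PowerSeries.coeff_map, hf, map_zero]

/-! ## Products of series in two tensor factors -/

section Two

variable {𝔤 : Type} [LieRing 𝔤] [LieAlgebra ℂ 𝔤]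

/-- `f ↦ f ⊗ 1` on series. -/
def inlS : (U 𝔤)⟦X⟧ →+* (U 𝔤 ⊗[ℂ] U 𝔤)⟦X⟧ :=
  PowerSeries.map
    ((Algebra.TensorProduct.includeLeft : U 𝔤 →ₐ[ℂ] U 𝔤 ⊗[ℂ] U 𝔤) : U 𝔤 →+* U 𝔤 ⊗[ℂ] U 𝔤)

/-- `f ↦ 1 ⊗ f` on series. -/
def inrS : (U 𝔤)⟦X⟧ →+* (U 𝔤 ⊗[ℂ] U 𝔤)⟦X⟧ :=
  PowerSeries.map
    ((Algebra.TensorProduct.includeRight : U 𝔤 →ₐ[ℂ] U 𝔤 ⊗[ℂ] U 𝔤) : U 𝔤 →+* U 𝔤 ⊗[ℂ] U 𝔤)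

theorem tensorS_eq (f g : (U 𝔤)⟦X⟧) : f ⊗ₚ g = inlS f * inrS g := rfl

theorem commute_inlS_inrS (f g : (U 𝔤)⟦X⟧) : Commute (inlS f) (inrS g) :=
  commute_mapS _ _ (fun x y => by simp [Commute, SemiconjBy]) f g

theorem tensorS_one (f : (U 𝔤)⟦X⟧) : f ⊗ₚ 1 = inlS f := by
  rw [tensorS_eq, map_one, mul_one]

theorem one_tensorS (f : (U 𝔤)⟦X⟧) : 1 ⊗ₚ f = inrS f := by
  rw [tensorS_eq, map_one, one_mul]

theorem tensorS_mul (a b c d : (U 𝔤)⟦X⟧) : a ⊗ₚ b * c ⊗ₚ d = (a * c) ⊗ₚ (b * d) := by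
  simp only [tensorS_eq, map_mul]
  rw [mul_assoc, ← mul_assoc (inrS b), ← (commute_inlS_inrS c b).eq, mul_assoc, mul_assoc]

theorem add_tensorS (a b c : (U 𝔤)⟦X⟧) : (a + b) ⊗ₚ c = a ⊗ₚ c + b ⊗ₚ c := by
  simp only [tensorS_eq, map_add, add_mul]

theorem tensorS_add (a b c : (U 𝔤)⟦X⟧) : a ⊗ₚ (b + c) = a ⊗ₚ b + a ⊗ₚ c := by
  simp only [tensorS_eq, map_add, mul_add]

theorem sub_tensorS (a b c : (U 𝔤)⟦X⟧) : (a - b) ⊗ₚ c = a ⊗ₚ c - b ⊗ₚ c := by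
  simp only [tensorS_eq, map_sub, sub_mul]

theorem tensorS_sub (a b c : (U 𝔤)⟦X⟧) : a ⊗ₚ (b - c) = a ⊗ₚ b - a ⊗ₚ c := by
  simp only [tensorS_eq, map_sub, mul_sub]

theorem neg_tensorS (a b : (U 𝔤)⟦X⟧) : (-a) ⊗ₚ b = -(a ⊗ₚ b) := by
  simp only [tensorS_eq, map_neg, neg_mul]

theorem tensorS_neg (a b : (U 𝔤)⟦X⟧) : a ⊗ₚ (-b) = -(a ⊗ₚ b) := by
  simp only [tensorS_eq, map_neg, mul_neg]

theorem inlS_smul (c : ℂ) (f : (U 𝔤)⟦X⟧) : inlS (c • f) = c • inlS f := map_smulS _ c f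

theorem inrS_smul (c : ℂ) (f : (U 𝔤)⟦X⟧) : inrS (c • f) = c • inrS f := map_smulS _ c f

theorem smul_tensorS (c : ℂ) (a b : (U 𝔤)⟦X⟧) : (c • a) ⊗ₚ b = c • (a ⊗ₚ b) := by
  rw [tensorS_eq, tensorS_eq, inlS_smul, smul_mul_assoc]

theorem tensorS_smul (c : ℂ) (a b : (U 𝔤)⟦X⟧) : a ⊗ₚ (c • b) = c • (a ⊗ₚ b) := by
  rw [tensorS_eq, tensorS_eq, inrS_smul, mul_smul_comm]

theorem constantCoeff_tensorS {a b : (U 𝔤)⟦X⟧}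
    (h : PowerSeries.constantCoeff a = 0 ∨ PowerSeries.constantCoeff b = 0) :
    PowerSeries.constantCoeff (a ⊗ₚ b) = 0 := by
  rcases h with h | h
  · exact constantCoeff_mul_left _ (constantCoeff_mapS _ h)
  · exact constantCoeff_mul_right _ (constantCoeff_mapS _ h)

theorem commute_tensorS {a b c d : (U 𝔤)⟦X⟧} (h : Commute a c) (h' : Commute b d) :
    Commute (a ⊗ₚ b) (c ⊗ₚ d) := by
  rw [Commute, SemiconjBy, tensorS_mul, tensorS_mul, h.eq, h'.eq]

theorem inlS_evalSeries (a : ℂ⟦X⟧) (f : (U 𝔤)⟦X⟧) :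
    inlS (evalSeries a f) = evalSeries a (inlS f) := evalSeries_map _ a f

theorem inrS_evalSeries (a : ℂ⟦X⟧) (f : (U 𝔤)⟦X⟧) :
    inrS (evalSeries a f) = evalSeries a (inrS f) := evalSeries_map _ a f

theorem inlS_expS (f : (U 𝔤)⟦X⟧) : inlS (expS f) = expS (inlS f) := inlS_evalSeries _ f

theorem inrS_expS (f : (U 𝔤)⟦X⟧) : inrS (expS f) = expS (inrS f) := inrS_evalSeries _ f

theorem comulS_evalSeries (a : ℂ⟦X⟧) (f : (U 𝔤)⟦X⟧) :
    comulS (evalSeries a f) = evalSeries a (comulS f) := evalSeries_map _ a f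

theorem comulS_smul (c : ℂ) (f : (U 𝔤)⟦X⟧) : comulS (c • f) = c • comulS f := map_smulS _ c f

theorem constantCoeff_comulS {f : (U 𝔤)⟦X⟧} (hf : PowerSeries.constantCoeff f = 0) :
    PowerSeries.constantCoeff (comulS f) = 0 := constantCoeff_mapS _ hf

theorem flip21_evalSeries (a : ℂ⟦X⟧) (f : (U 𝔤 ⊗[ℂ] U 𝔤)⟦X⟧) :
    flip21 (evalSeries a f) = evalSeries a (flip21 f) := evalSeries_map _ a f

theorem flip21_tensorS (a b : (U 𝔤)⟦X⟧) : flip21 (a ⊗ₚ b) = b ⊗ₚ a := by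
  rw [tensorS_eq, map_mul, tensorS_eq, (commute_inlS_inrS b a).eq]
  congr 1

/-! ### Conjugation by `exp(x ⊗ y)` -/

theorem expS_tensorS_commute {x y c d : (U 𝔤)⟦X⟧}
    (h0 : PowerSeries.constantCoeff x = 0 ∨ PowerSeries.constantCoeff y = 0)
    (hx : Commute x c) (hy : Commute y d) : SemiconjBy (expS (x ⊗ₚ y)) (c ⊗ₚ d) (c ⊗ₚ d) :=
  (commute_expS (constantCoeff_tensorS h0) (commute_tensorS hx hy).symm).symm

/-- Moving x past c produces the weight k, so x ⊗ y moves past c ⊗ d at the cost of the summand 1 ⊗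
k y, which commutes with x ⊗ y and exponentiates separately. Here y itself must have no constant
term, since exp(k y) occurs alone. -/
theorem expS_tensorS_shift_left {x y c d : (U 𝔤)⟦X⟧} {k : ℂ}
    (h0 : PowerSeries.constantCoeff y = 0) (hx : x * c = c * x + k • c) (hy : Commute y d) :
    SemiconjBy (expS (x ⊗ₚ y)) (c ⊗ₚ d) (c ⊗ₚ (d * expS (k • y))) := by
  have hk : PowerSeries.constantCoeff (1 ⊗ₚ (k • y)) = 0 :=
    constantCoeff_tensorS (Or.inr (constantCoeff_smulS k h0))
  have h := expS_semiconjBy_of_shift (f := x ⊗ₚ y) (g := c ⊗ₚ d) (k := 1 ⊗ₚ (k • y))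
    (constantCoeff_tensorS (Or.inr h0)) hk ?_
    (commute_tensorS (Commute.one_right x) ((Commute.refl y).smul_right k))
  · rwa [one_tensorS, ← inrS_expS, ← one_tensorS, tensorS_mul, mul_one] at h
  · rw [mul_add, tensorS_mul, tensorS_mul, tensorS_mul, hx, hy.eq, add_tensorS, mul_one,
      mul_smul_comm, tensorS_smul, smul_tensorS]

theorem expS_tensorS_shift_right {x y c d : (U 𝔤)⟦X⟧} {k : ℂ}
    (h0 : PowerSeries.constantCoeff x = 0) (hx : Commute x c) (hy : y * d = d * y + k • d) :
    SemiconjBy (expS (x ⊗ₚ y)) (c ⊗ₚ d) ((c * expS (k • x)) ⊗ₚ d) := by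
  have hk : PowerSeries.constantCoeff ((k • x) ⊗ₚ 1) = 0 :=
    constantCoeff_tensorS (Or.inl (constantCoeff_smulS k h0))
  have h := expS_semiconjBy_of_shift (f := x ⊗ₚ y) (g := c ⊗ₚ d) (k := (k • x) ⊗ₚ 1)
    (constantCoeff_tensorS (Or.inl h0)) hk ?_
    (commute_tensorS ((Commute.refl x).smul_right k) (Commute.one_right y))
  · rwa [tensorS_one, ← inlS_expS, ← tensorS_one, tensorS_mul, mul_one] at h
  · rw [mul_add, tensorS_mul, tensorS_mul, tensorS_mul, hy, hx.eq, tensorS_add, mul_one,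
      mul_smul_comm, tensorS_smul, smul_tensorS]

/-- The commutator of x ⊗ y with c ⊗ d is cx ⊗ h, which commutes with x ⊗ y; the adjoint series
therefore stops after the linear term. -/
theorem expS_tensorS_commutator_right {x y c d h : (U 𝔤)⟦X⟧}
    (h0 : PowerSeries.constantCoeff x = 0 ∨ PowerSeries.constantCoeff y = 0)
    (hx : Commute x c) (hy : y * d = d * y + h) (hh : Commute y h) :
    SemiconjBy (expS (x ⊗ₚ y)) (c ⊗ₚ d) (c ⊗ₚ d + (c * x) ⊗ₚ h) := by
  refine expS_semiconjBy_of_commutator (constantCoeff_tensorS h0) ?_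
    (commute_tensorS (hx.mul_right (Commute.refl x)) hh)
  rw [tensorS_mul, tensorS_mul, hy, tensorS_add, hx.eq]

theorem expS_tensorS_commutator_left {x y c d h : (U 𝔤)⟦X⟧}
    (h0 : PowerSeries.constantCoeff x = 0 ∨ PowerSeries.constantCoeff y = 0)
    (hx : x * c = c * x + h) (hh : Commute x h) (hy : Commute y d) :
    SemiconjBy (expS (x ⊗ₚ y)) (c ⊗ₚ d) (c ⊗ₚ d + h ⊗ₚ (d * y)) := by
  refine expS_semiconjBy_of_commutator (constantCoeff_tensorS h0) ?_
    (commute_tensorS hh (hy.mul_right (Commute.refl y)))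
  rw [tensorS_mul, tensorS_mul, hx, add_tensorS, hy.eq]

/-! ### Twisted coproducts -/

/-- Twisted coproducts are computed as relations F Δ(x) = y F; being a unit is only needed to turn
such a relation into a statement about F⁻¹. -/
theorem twComul_eq {F : (U 𝔤 ⊗[ℂ] U 𝔤)⟦X⟧} (hF : IsUnit F) {x : (U 𝔤)⟦X⟧}
    {y : (U 𝔤 ⊗[ℂ] U 𝔤)⟦X⟧} (h : SemiconjBy F (comulS x) y) : twComul F x = y := by
  rw [twComul, h.eq, mul_assoc, Ring.mul_inverse_cancel F hF, mul_one]

theorem semiconjBy_of_twComul_eq {F : (U 𝔤 ⊗[ℂ] U 𝔤)⟦X⟧} (hF : IsUnit F) {x : (U 𝔤)⟦X⟧}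
    {y : (U 𝔤 ⊗[ℂ] U 𝔤)⟦X⟧} (h : twComul F x = y) : SemiconjBy F (comulS x) y := by
  rw [SemiconjBy, ← h, twComul, mul_assoc (F * comulS x), Ring.inverse_mul_cancel F hF, mul_one]

/-- `(1/c) ln(1 + c f)` is primitive if `1 + c f` is group-like. -/
theorem isTwPrimitive_lnDiv {F : (U 𝔤 ⊗[ℂ] U 𝔤)⟦X⟧} (hF : IsUnit F) (c : ℂ) {f : (U 𝔤)⟦X⟧}
    (hf : PowerSeries.constantCoeff f = 0)
    (h : SemiconjBy F (comulS f) (f ⊗ₚ 1 + 1 ⊗ₚ f + c • (f ⊗ₚ f))) :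
    IsTwPrimitive F (lnDiv c f) := by
  have h1 : PowerSeries.constantCoeff (f ⊗ₚ 1) = 0 := constantCoeff_tensorS (Or.inl hf)
  have h2 : PowerSeries.constantCoeff (1 ⊗ₚ f) = 0 := constantCoeff_tensorS (Or.inr hf)
  -- With f ⊗ f written as a product of the commuting elements f ⊗ 1 and 1 ⊗ f, the functional
  -- equation of the logarithm applies.
  have h12 : f ⊗ₚ 1 * 1 ⊗ₚ f = f ⊗ₚ f := by rw [tensorS_mul, one_mul, mul_one]
  rw [← h12] at h
  refine twComul_eq hF ?_
  rw [tensorS_one (lnDiv c f), one_tensorS (lnDiv c f), lnDiv, comulS_evalSeries, inlS_evalSeries,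
    inrS_evalSeries, ← tensorS_one, ← one_tensorS]
  have := semiconjBy_evalSeries (lnDivSeries c) (constantCoeff_comulS hf)
    (constantCoeff_add (constantCoeff_add h1 h2)
      (constantCoeff_smulS c (constantCoeff_mul_left _ h1))) h
  change SemiconjBy F _ (lnDiv c _) at this
  rwa [lnDiv_add_add_mul c h1 h2
    (commute_tensorS (Commute.one_right f) (Commute.one_left f))] at this

/-- The exponential of a multiple of a primitive element is group-like. -/
theorem semiconjBy_comulS_expS {F : (U 𝔤 ⊗[ℂ] U 𝔤)⟦X⟧} (hF : IsUnit F) {x : (U 𝔤)⟦X⟧}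
    (hx : PowerSeries.constantCoeff x = 0) (h : IsTwPrimitive F x) (c : ℂ) :
    SemiconjBy F (comulS (expS (c • x))) (expS (c • x) ⊗ₚ expS (c • x)) := by
  have h1 : PowerSeries.constantCoeff ((c • x) ⊗ₚ 1) = 0 :=
    constantCoeff_tensorS (Or.inl (constantCoeff_smulS c hx))
  have h2 : PowerSeries.constantCoeff (1 ⊗ₚ (c • x)) = 0 :=
    constantCoeff_tensorS (Or.inr (constantCoeff_smulS c hx))
  have h3 := semiconjBy_smul c (semiconjBy_of_twComul_eq hF h)
  rw [smul_add, ← smul_tensorS, ← tensorS_smul, ← comulS_smul] at h3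
  have h4 := semiconjBy_expS (constantCoeff_comulS (constantCoeff_smulS c hx))
    (constantCoeff_add h1 h2) h3
  rwa [expS_add h1 h2 (commute_tensorS (Commute.one_right _) (Commute.one_left _)), tensorS_one,
    one_tensorS, ← inlS_expS, ← inrS_expS, expS, ← comulS_evalSeries] at h4

theorem comulS_cst (x : 𝔤) : comulS (cst x) = cst x ⊗ₚ 1 + 1 ⊗ₚ cst x := by
  rw [tensorS_one, one_tensorS]
  simp only [comulS, inlS, inrS, cst, PowerSeries.map_C]
  rw [← map_add]
  exact congrArg _ (comul_ι 𝔤 x)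

theorem comulS_zcst (x : 𝔤) : comulS (zcst x) = zcst x ⊗ₚ 1 + 1 ⊗ₚ zcst x := by
  have h := comulS_cst x
  rw [tensorS_one, one_tensorS] at h ⊢
  have hX : ∀ φ : U 𝔤 →+* U 𝔤 ⊗[ℂ] U 𝔤, PowerSeries.map φ (PowerSeries.X : (U 𝔤)⟦X⟧) =
      PowerSeries.X := fun φ => PowerSeries.map_X φ
  have h1 : comulS (PowerSeries.X : (U 𝔤)⟦X⟧) = PowerSeries.X := hX _
  have h2 : inlS (PowerSeries.X : (U 𝔤)⟦X⟧) = PowerSeries.X := hX _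
  have h3 : inrS (PowerSeries.X : (U 𝔤)⟦X⟧) = PowerSeries.X := hX _
  rw [zcst, map_mul, map_mul, map_mul, h1, h2, h3, h, mul_add]

end Two

/-! ## Products of series in three tensor factors -/

section Three

variable {𝔤 : Type} [LieRing 𝔤] [LieAlgebra ℂ 𝔤]

/-- `f ↦ f ⊗ (1 ⊗ 1)` on series. -/
def in1S : (U 𝔤)⟦X⟧ →+* (U 𝔤 ⊗[ℂ] (U 𝔤 ⊗[ℂ] U 𝔤))⟦X⟧ :=
  PowerSeries.map
    ((Algebra.TensorProduct.includeLeft : U 𝔤 →ₐ[ℂ] U 𝔤 ⊗[ℂ] (U 𝔤 ⊗[ℂ] U 𝔤)) :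
      U 𝔤 →+* U 𝔤 ⊗[ℂ] (U 𝔤 ⊗[ℂ] U 𝔤))

/-- The element `a ⊗ (b ⊗ c)` of `(U(𝔤) ⊗ (U(𝔤) ⊗ U(𝔤)))⟦X⟧`. -/
def tensor3 (a b c : (U 𝔤)⟦X⟧) : (U 𝔤 ⊗[ℂ] (U 𝔤 ⊗[ℂ] U 𝔤))⟦X⟧ := in1S a * leg23 (b ⊗ₚ c)

theorem commute_in1S_leg23 (f : (U 𝔤)⟦X⟧) (g : (U 𝔤 ⊗[ℂ] U 𝔤)⟦X⟧) :
    Commute (in1S f) (leg23 g) :=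
  commute_mapS _ _ (fun x y => by simp [Commute, SemiconjBy]) f g

theorem tensor3_mul (a b c a' b' c' : (U 𝔤)⟦X⟧) :
    tensor3 a b c * tensor3 a' b' c' = tensor3 (a * a') (b * b') (c * c') := by
  simp only [tensor3, ← tensorS_mul, map_mul]
  rw [mul_assoc, ← mul_assoc (leg23 _), ← (commute_in1S_leg23 a' (b ⊗ₚ c)).eq]
  simp only [mul_assoc]

theorem commute_tensor3 {a b c a' b' c' : (U 𝔤)⟦X⟧} (ha : Commute a a') (hb : Commute b b')
    (hc : Commute c c') : Commute (tensor3 a b c) (tensor3 a' b' c') := by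
  rw [Commute, SemiconjBy, tensor3_mul, tensor3_mul, ha.eq, hb.eq, hc.eq]

theorem tensor3_add_mid (a b b' c : (U 𝔤)⟦X⟧) :
    tensor3 a (b + b') c = tensor3 a b c + tensor3 a b' c := by
  simp only [tensor3, add_tensorS, map_add, mul_add]

theorem constantCoeff_tensor3 {a b c : (U 𝔤)⟦X⟧} (h : PowerSeries.constantCoeff a = 0 ∨
      PowerSeries.constantCoeff b = 0 ∨ PowerSeries.constantCoeff c = 0) :
    PowerSeries.constantCoeff (tensor3 a b c) = 0 := by
  rcases h with h | h
  · exact constantCoeff_mul_left _ (constantCoeff_mapS _ h)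
  · exact constantCoeff_mul_right _ (constantCoeff_mapS _ (constantCoeff_tensorS h))

theorem leg23_tensorS (a b : (U 𝔤)⟦X⟧) : leg23 (a ⊗ₚ b) = tensor3 1 a b := by
  rw [tensor3, map_one, one_mul]

theorem leg12_inlS (a : (U 𝔤)⟦X⟧) : leg12 (inlS a) = in1S a :=
  map_mapS _ _ _ (fun x => by simp [Algebra.TensorProduct.one_def]) a

theorem leg13_inlS (a : (U 𝔤)⟦X⟧) : leg13 (inlS a) = in1S a :=
  map_mapS _ _ _ (fun x => by simp [Algebra.TensorProduct.one_def]) a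

theorem leg12_inrS (a : (U 𝔤)⟦X⟧) : leg12 (inrS a) = leg23 (inlS a) := by
  refine PowerSeries.ext fun n => ?_
  simp [leg12, inrS, leg23, inlS]

theorem leg13_inrS (a : (U 𝔤)⟦X⟧) : leg13 (inrS a) = leg23 (inrS a) := by
  refine PowerSeries.ext fun n => ?_
  simp [leg13, inrS, leg23]

theorem leg12_tensorS (a b : (U 𝔤)⟦X⟧) : leg12 (a ⊗ₚ b) = tensor3 a b 1 := by
  rw [tensor3, tensorS_one, tensorS_eq, map_mul, leg12_inlS, leg12_inrS]

theorem leg13_tensorS (a b : (U 𝔤)⟦X⟧) : leg13 (a ⊗ₚ b) = tensor3 a 1 b := by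
  rw [tensor3, one_tensorS, tensorS_eq, map_mul, leg13_inlS, leg13_inrS]

theorem idComul_tensorS (a b : (U 𝔤)⟦X⟧) : idComul (a ⊗ₚ b) = in1S a * leg23 (comulS b) := by
  rw [tensorS_eq, map_mul]
  congr 1
  exact map_mapS _ _ _ (fun x => by simp [Algebra.TensorProduct.one_def]) a

/-- The map Δ ⊗ id lands in the other bracketing of the triple tensor product; this identifies the
reassociated first two legs with `leg12`. -/
theorem assoc_tmul_one (t : U 𝔤 ⊗[ℂ] U 𝔤) :
    Algebra.TensorProduct.assoc ℂ ℂ ℂ (U 𝔤) (U 𝔤) (U 𝔤) (t ⊗ₜ 1) =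
      Algebra.TensorProduct.map (AlgHom.id ℂ (U 𝔤))
        (Algebra.TensorProduct.includeLeft : U 𝔤 →ₐ[ℂ] U 𝔤 ⊗[ℂ] U 𝔤) t := by
  induction t using TensorProduct.induction_on with
  | zero => simp
  | tmul x y => simp
  | add x y hx hy => rw [TensorProduct.add_tmul, map_add, map_add, hx, hy]

theorem comulId_tensorS (a b : (U 𝔤)⟦X⟧) :
    comulId (a ⊗ₚ b) = leg12 (comulS a) * tensor3 1 1 b := by
  rw [tensorS_eq, map_mul, ← leg23_tensorS, one_tensorS]
  congr 1
  · refine PowerSeries.ext fun n => ?_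
    simp only [comulId, inlS, leg12, comulS, PowerSeries.coeff_map]
    simp [assoc_tmul_one]
  · refine PowerSeries.ext fun n => ?_
    simp only [comulId, inrS, leg23, PowerSeries.coeff_map]
    simp [Algebra.TensorProduct.one_def]

theorem leg12_evalSeries (a : ℂ⟦X⟧) (f : (U 𝔤 ⊗[ℂ] U 𝔤)⟦X⟧) :
    leg12 (evalSeries a f) = evalSeries a (leg12 f) := evalSeries_map _ a f

theorem leg13_evalSeries (a : ℂ⟦X⟧) (f : (U 𝔤 ⊗[ℂ] U 𝔤)⟦X⟧) :
    leg13 (evalSeries a f) = evalSeries a (leg13 f) := evalSeries_map _ a f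

theorem leg23_evalSeries (a : ℂ⟦X⟧) (f : (U 𝔤 ⊗[ℂ] U 𝔤)⟦X⟧) :
    leg23 (evalSeries a f) = evalSeries a (leg23 f) := evalSeries_map _ a f

theorem comulId_evalSeries (a : ℂ⟦X⟧) (f : (U 𝔤 ⊗[ℂ] U 𝔤)⟦X⟧) :
    comulId (evalSeries a f) = evalSeries a (comulId f) := evalSeries_map _ a f

theorem idComul_evalSeries (a : ℂ⟦X⟧) (f : (U 𝔤 ⊗[ℂ] U 𝔤)⟦X⟧) :
    idComul (evalSeries a f) = evalSeries a (idComul f) := evalSeries_map _ a f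

theorem commute_leg12_tensor3 (f : (U 𝔤 ⊗[ℂ] U 𝔤)⟦X⟧) (g : (U 𝔤)⟦X⟧) :
    Commute (leg12 f) (tensor3 1 1 g) := by
  have h : leg23 (inrS g) = PowerSeries.map
      (((Algebra.TensorProduct.includeRight : U 𝔤 ⊗[ℂ] U 𝔤 →ₐ[ℂ] U 𝔤 ⊗[ℂ] (U 𝔤 ⊗[ℂ] U 𝔤)).comp
        (Algebra.TensorProduct.includeRight : U 𝔤 →ₐ[ℂ] U 𝔤 ⊗[ℂ] U 𝔤) :
          U 𝔤 →ₐ[ℂ] U 𝔤 ⊗[ℂ] (U 𝔤 ⊗[ℂ] U 𝔤)) : U 𝔤 →+* U 𝔤 ⊗[ℂ] (U 𝔤 ⊗[ℂ] U 𝔤)) g :=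
    map_mapS _ _ _ (fun _ => rfl) g
  rw [← leg23_tensorS, one_tensorS, h]
  refine commute_mapS _ _ (fun x y => ?_) f g
  induction x using TensorProduct.induction_on with
  | zero => rw [map_zero]; exact Commute.zero_left _
  | tmul s t => simp [Commute, SemiconjBy]
  | add s t hs ht => rw [map_add]; exact hs.add_left ht

/-- Conjugation by F in legs one and two does not touch leg three, so a twisted coproduct of a lifts
directly to Δ_F ⊗ id on a ⊗ b. -/
theorem semiconjBy_comulId {F y : (U 𝔤 ⊗[ℂ] U 𝔤)⟦X⟧} {a : (U 𝔤)⟦X⟧} (b : (U 𝔤)⟦X⟧)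
    (h : SemiconjBy F (comulS a) y) :
    SemiconjBy (leg12 F) (comulId (a ⊗ₚ b)) (leg12 y * tensor3 1 1 b) := by
  rw [comulId_tensorS]
  refine SemiconjBy.mul_right (h.map leg12) ?_
  exact commute_leg12_tensor3 F b

theorem semiconjBy_idComul {F y : (U 𝔤 ⊗[ℂ] U 𝔤)⟦X⟧} (a : (U 𝔤)⟦X⟧) {b : (U 𝔤)⟦X⟧}
    (h : SemiconjBy F (comulS b) y) :
    SemiconjBy (leg23 F) (idComul (a ⊗ₚ b)) (in1S a * leg23 y) := by
  rw [idComul_tensorS]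
  exact SemiconjBy.mul_right (commute_in1S_leg23 a F).symm (h.map leg23)

theorem leg12_mul_tensor3 (a b c : (U 𝔤)⟦X⟧) :
    leg12 (a ⊗ₚ b) * tensor3 1 1 c = tensor3 a b c := by
  rw [leg12_tensorS, tensor3_mul, mul_one, mul_one, one_mul]

theorem in1S_mul_leg23 (a b c : (U 𝔤)⟦X⟧) : in1S a * leg23 (b ⊗ₚ c) = tensor3 a b c := rfl

/-! ### The counit condition -/

/-- The elements of `U(𝔤)⟦X⟧` whose counit vanishes. -/
def CounitZero (f : (U 𝔤)⟦X⟧) : Prop := PowerSeries.map (counit 𝔤 : U 𝔤 →+* ℂ) f = 0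

theorem counitZero_cst (x : 𝔤) : CounitZero (cst x) := by
  rw [CounitZero, cst, PowerSeries.map_C]
  exact (congrArg _ (counit_ι 𝔤 x)).trans (map_zero _)

theorem CounitZero.mul_left {f : (U 𝔤)⟦X⟧} (g : (U 𝔤)⟦X⟧) (hf : CounitZero f) :
    CounitZero (g * f) := by
  rw [CounitZero, map_mul, hf, mul_zero]

theorem CounitZero.mul_right {f : (U 𝔤)⟦X⟧} (hf : CounitZero f) (g : (U 𝔤)⟦X⟧) :
    CounitZero (f * g) := by
  rw [CounitZero, map_mul, hf, zero_mul]

theorem CounitZero.smul {f : (U 𝔤)⟦X⟧} (c : ℂ) (hf : CounitZero f) : CounitZero (c • f) := by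
  rw [CounitZero, map_smulS, hf, smul_zero]

theorem counitZero_zcst (x : 𝔤) : CounitZero (zcst x) := (counitZero_cst x).mul_left _

theorem CounitZero.lnDiv {f : (U 𝔤)⟦X⟧} (c : ℂ) (hf : CounitZero f) :
    CounitZero (lnDiv c f) := by
  rw [CounitZero, PET.lnDiv, evalSeries_map, hf]
  exact lnDiv_zero_right c

theorem counitId_tensorS {a : (U 𝔤)⟦X⟧} (b : (U 𝔤)⟦X⟧) (ha : CounitZero a) :
    counitId (a ⊗ₚ b) = 0 := by
  rw [tensorS_eq, map_mul]
  have : counitId (inlS a) = PowerSeries.map (algebraMap ℂ (U 𝔤))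
      (PowerSeries.map (counit 𝔤 : U 𝔤 →+* ℂ) a) := by
    refine PowerSeries.ext fun n => ?_
    simp [counitId, inlS, Algebra.algebraMap_eq_smul_one]
  rw [this, ha, map_zero, zero_mul]

theorem idCounit_tensorS (a : (U 𝔤)⟦X⟧) {b : (U 𝔤)⟦X⟧} (hb : CounitZero b) :
    idCounit (a ⊗ₚ b) = 0 := by
  rw [tensorS_eq, map_mul]
  have : idCounit (inrS b) = PowerSeries.map (algebraMap ℂ (U 𝔤))
      (PowerSeries.map (counit 𝔤 : U 𝔤 →+* ℂ) b) := by
    refine PowerSeries.ext fun n => ?_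
    simp [idCounit, inrS, Algebra.algebraMap_eq_smul_one]
  rw [this, hb, map_zero, mul_zero]

theorem counitId_expS_tensorS {a : (U 𝔤)⟦X⟧} (b : (U 𝔤)⟦X⟧) (ha : CounitZero a) :
    counitId (expS (a ⊗ₚ b)) = 1 := by
  have : counitId (expS (a ⊗ₚ b)) = expS (counitId (a ⊗ₚ b)) := evalSeries_map _ _ _
  rw [this, counitId_tensorS b ha, expS_zero]

theorem idCounit_expS_tensorS (a : (U 𝔤)⟦X⟧) {b : (U 𝔤)⟦X⟧} (hb : CounitZero b) :
    idCounit (expS (a ⊗ₚ b)) = 1 := by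
  have : idCounit (expS (a ⊗ₚ b)) = expS (idCounit (a ⊗ₚ b)) := evalSeries_map _ _ _
  rw [this, idCounit_tensorS a hb, expS_zero]

end Three

/-! ## Criteria for twisting elements -/

section Criteria

variable {𝔤 : Type} [LieRing 𝔤] [LieAlgebra ℂ 𝔤]

theorem leg12_expS_tensorS (a b : (U 𝔤)⟦X⟧) :
    leg12 (expS (a ⊗ₚ b)) = expS (tensor3 a b 1) := by
  rw [expS, leg12_evalSeries, leg12_tensorS, expS]

theorem leg13_expS_tensorS (a b : (U 𝔤)⟦X⟧) :
    leg13 (expS (a ⊗ₚ b)) = expS (tensor3 a 1 b) := by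
  rw [expS, leg13_evalSeries, leg13_tensorS, expS]

theorem leg23_expS_tensorS (a b : (U 𝔤)⟦X⟧) :
    leg23 (expS (a ⊗ₚ b)) = expS (tensor3 1 a b) := by
  rw [expS, leg23_evalSeries, leg23_tensorS, expS]

/-- `(Δ_F ⊗ id)(exp(a ⊗ b))` for `Δ_F(a) = a ⊗ u + 1 ⊗ a`. -/
theorem semiconjBy_comulId_expS {F : (U 𝔤 ⊗[ℂ] U 𝔤)⟦X⟧} {a b u : (U 𝔤)⟦X⟧}
    (h0 : PowerSeries.constantCoeff a = 0 ∨ PowerSeries.constantCoeff b = 0)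
    (h : SemiconjBy F (comulS a) (a ⊗ₚ u + 1 ⊗ₚ a)) (hu : Commute u a) :
    SemiconjBy (leg12 F) (comulId (expS (a ⊗ₚ b)))
      (expS (tensor3 a u b) * expS (tensor3 1 a b)) := by
  have h1 : PowerSeries.constantCoeff (tensor3 a u b) = 0 :=
    constantCoeff_tensor3 (h0.imp_right Or.inr)
  have h2 : PowerSeries.constantCoeff (tensor3 1 a b) = 0 :=
    constantCoeff_tensor3 (Or.inr h0)
  rw [← expS_add h1 h2 (commute_tensor3 (Commute.one_right a) hu (Commute.refl b)), expS,
    comulId_evalSeries]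
  refine semiconjBy_expS (constantCoeff_mapS _ (constantCoeff_tensorS h0))
    (constantCoeff_add h1 h2) ?_
  have := semiconjBy_comulId b h
  rwa [map_add, add_mul, leg12_mul_tensor3, leg12_mul_tensor3] at this

/-- `(id ⊗ Δ_F)(exp(a ⊗ b))` for `Δ_F(b) = b ⊗ 1 + v ⊗ b`. -/
theorem semiconjBy_idComul_expS {F : (U 𝔤 ⊗[ℂ] U 𝔤)⟦X⟧} {a b v : (U 𝔤)⟦X⟧}
    (h0 : PowerSeries.constantCoeff a = 0 ∨ PowerSeries.constantCoeff b = 0)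
    (h : SemiconjBy F (comulS b) (b ⊗ₚ 1 + v ⊗ₚ b)) (hv : Commute b v) :
    SemiconjBy (leg23 F) (idComul (expS (a ⊗ₚ b)))
      (expS (tensor3 a b 1) * expS (tensor3 a v b)) := by
  have h1 : PowerSeries.constantCoeff (tensor3 a b 1) = 0 :=
    constantCoeff_tensor3 (h0.imp_right Or.inl)
  have h2 : PowerSeries.constantCoeff (tensor3 a v b) = 0 :=
    constantCoeff_tensor3 (h0.imp_right Or.inr)
  rw [← expS_add h1 h2 (commute_tensor3 (Commute.refl a) hv (Commute.one_left b)), expS,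
    idComul_evalSeries]
  refine semiconjBy_expS (constantCoeff_mapS _ (constantCoeff_tensorS h0))
    (constantCoeff_add h1 h2) ?_
  have := semiconjBy_idComul a h
  rwa [map_add, mul_add, in1S_mul_leg23, in1S_mul_leg23] at this

theorem twComulId_eq {F Ψ : (U 𝔤 ⊗[ℂ] U 𝔤)⟦X⟧} (hF : IsUnit F)
    {y : (U 𝔤 ⊗[ℂ] (U 𝔤 ⊗[ℂ] U 𝔤))⟦X⟧} (h : SemiconjBy (leg12 F) (comulId Ψ) y) :
    twComulId F Ψ = y := by
  rw [twComulId, h.eq, mul_assoc, Ring.mul_inverse_cancel _ (hF.map leg12), mul_one]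

theorem idTwComul_eq {F Ψ : (U 𝔤 ⊗[ℂ] U 𝔤)⟦X⟧} (hF : IsUnit F)
    {y : (U 𝔤 ⊗[ℂ] (U 𝔤 ⊗[ℂ] U 𝔤))⟦X⟧} (h : SemiconjBy (leg23 F) (idComul Ψ) y) :
    idTwComul F Ψ = y := by
  rw [idTwComul, h.eq, mul_assoc, Ring.mul_inverse_cancel _ (hF.map leg23), mul_one]

/-- The cocycle condition for `exp(A ⊗ W) exp(H ⊗ σ)`, when `[A, W] = v - u`, the coproducts are
`Δ_F(A) = A ⊗ u + 1 ⊗ A` and `Δ_F(W) = W ⊗ 1 + v ⊗ W`, and `σ` is primitive for `Δ_F`. -/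
theorem isTwist_expS_mul_expS {F : (U 𝔤 ⊗[ℂ] U 𝔤)⟦X⟧} {H A W σ u v : (U 𝔤)⟦X⟧}
    (hF : F = expS (A ⊗ₚ W) * expS (H ⊗ₚ σ))
    (h0 : PowerSeries.constantCoeff A = 0 ∨ PowerSeries.constantCoeff W = 0)
    (hσ0 : PowerSeries.constantCoeff σ = 0)
    (eA : CounitZero A) (eW : CounitZero W) (eH : CounitZero H) (eσ : CounitZero σ)
    (hH : comulS H = H ⊗ₚ 1 + 1 ⊗ₚ H)
    (hA : SemiconjBy F (comulS A) (A ⊗ₚ u + 1 ⊗ₚ A))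
    (hW : SemiconjBy F (comulS W) (W ⊗ₚ 1 + v ⊗ₚ W))
    (hσ : SemiconjBy F (comulS σ) (σ ⊗ₚ 1 + 1 ⊗ₚ σ))
    (hAW : A * W = W * A + (v - u))
    (hAσ : Commute A σ) (hWσ : Commute W σ) (hAu : Commute A u) (hAv : Commute A v)
    (hWu : Commute W u) (hWv : Commute W v) : IsTwist F := by
  have hU : IsUnit F := by
    rw [hF]
    exact (isUnit_expS (constantCoeff_tensorS h0)).mul
      (isUnit_expS (constantCoeff_tensorS (Or.inr hσ0)))
  refine ⟨hU, ?_, ?_, ?_⟩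
  · have hL1 := semiconjBy_comulId_expS (b := W) h0 hA hAu.symm
    have hR1 := semiconjBy_idComul_expS (a := A) h0 hW hWv
    have hR2 := semiconjBy_idComul_expS (a := H) (Or.inr hσ0) hσ (Commute.one_right σ)
    -- On the left side of the cocycle condition only exp(A ⊗ W) is carried past F₁₂. The factor
    -- with H stays to its right and is expanded by the untwisted coproduct, that is with the
    -- trivial twist 1.
    have hL2 : comulId (expS (H ⊗ₚ σ)) =
        expS (tensor3 H 1 σ) * expS (tensor3 1 H σ) := by
      have := semiconjBy_comulId_expS (F := 1) (b := σ) (u := 1) (Or.inr hσ0)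
        (by rw [hH]; exact SemiconjBy.one_left _) (Commute.one_left H)
      rwa [map_one, SemiconjBy, one_mul, mul_one] at this
    have h12 : leg12 F = expS (tensor3 A W 1) * expS (tensor3 H σ 1) := by
      rw [hF, map_mul, leg12_expS_tensorS, leg12_expS_tensorS]
    have h23 : leg23 F = expS (tensor3 1 A W) * expS (tensor3 1 H σ) := by
      rw [hF, map_mul, leg23_expS_tensorS, leg23_expS_tensorS]
    have c1 : PowerSeries.constantCoeff (tensor3 A W 1) = 0 :=
      constantCoeff_tensor3 (h0.imp_right Or.inl)
    have c2 : PowerSeries.constantCoeff (tensor3 1 A W) = 0 :=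
      constantCoeff_tensor3 (Or.inr h0)
    have c3 : PowerSeries.constantCoeff (tensor3 A u W) = 0 :=
      constantCoeff_tensor3 (h0.imp_right Or.inr)
    have c4 : PowerSeries.constantCoeff (tensor3 A v W) = 0 :=
      constantCoeff_tensor3 (h0.imp_right Or.inr)
    have c5 : PowerSeries.constantCoeff (tensor3 A (v - u) W) = 0 :=
      constantCoeff_tensor3 (h0.imp_right Or.inr)
    have c6 : PowerSeries.constantCoeff (tensor3 H σ 1) = 0 :=
      constantCoeff_tensor3 (Or.inr (Or.inl hσ0))
    have c7 : PowerSeries.constantCoeff (tensor3 H 1 σ) = 0 :=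
      constantCoeff_tensor3 (Or.inr (Or.inr hσ0))
    -- The heart of the cocycle condition: conjugating A ⊗ W ⊗ 1 by exp(1 ⊗ A ⊗ W) adds A ⊗ [A, W] ⊗
    -- W = A ⊗ (v - u) ⊗ W, which turns the exponent A ⊗ u ⊗ W into A ⊗ v ⊗ W.
    have hbch : expS (tensor3 A u W) * expS (tensor3 1 A W) * expS (tensor3 A W 1) =
        expS (tensor3 A W 1) * expS (tensor3 A v W) * expS (tensor3 1 A W) := by
      have e1 : SemiconjBy (expS (tensor3 1 A W)) (tensor3 A W 1)
          (tensor3 A W 1 + tensor3 A (v - u) W) := by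
        refine expS_semiconjBy_of_commutator c2 ?_
          (commute_tensor3 (Commute.one_left A) (hAv.sub_right hAu) (Commute.refl W))
        rw [tensor3_mul, tensor3_mul, hAW, tensor3_add_mid]
        simp only [one_mul, mul_one]
      have e2 := (semiconjBy_expS c1 (constantCoeff_add c1 c5) e1).eq
      rw [mul_assoc, e2, ← mul_assoc]
      congr 1
      rw [← expS_add c3 (constantCoeff_add c1 c5), ← expS_add c1 c4
        (commute_tensor3 (Commute.refl A) hWv (Commute.one_left W))]
      · congr 1
        have : tensor3 A u W + tensor3 A (v - u) W = tensor3 A v W := by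
          rw [← tensor3_add_mid, add_sub_cancel]
        rw [← this]
        abel
      · refine (commute_tensor3 (Commute.refl A) hWu.symm (Commute.one_right W)).add_right ?_
        refine commute_tensor3 (Commute.refl A) ?_ (Commute.refl W)
        -- Commutation of u with v is not assumed: u commutes with A and W, hence with [A, W] = v -
        -- u.
        have hAWu : Commute (A * W - W * A) u :=
          (hAu.mul_left hWu).sub_left (hWu.mul_left hAu)
        rw [hAW, add_sub_cancel_left] at hAWu
        exact hAWu.symm
    -- The two sides now differ only in the position of exp(1 ⊗ A ⊗ W) relative to the factors with
    -- H in leg one; it commutes with them because σ commutes with A and W.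
    have k1 : Commute (expS (tensor3 1 A W)) (expS (tensor3 H σ 1)) :=
      commute_expS c6 (commute_expS c2 (commute_tensor3 (Commute.one_right H) hAσ.symm
        (Commute.one_left W))).symm
    have k2 : Commute (expS (tensor3 1 A W)) (expS (tensor3 H 1 σ)) :=
      commute_expS c7 (commute_expS c2 (commute_tensor3 (Commute.one_right H)
        (Commute.one_left A) hWσ.symm)).symm
    have hL : leg12 F * comulId F = expS (tensor3 A u W) * expS (tensor3 1 A W) *
        leg12 F * comulId (expS (H ⊗ₚ σ)) := by
      rw [← hL1.eq, mul_assoc, ← map_mul, ← hF]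
    have hR : leg23 F * idComul F = expS (tensor3 A W 1) * expS (tensor3 A v W) *
        (expS (tensor3 H σ 1) * expS (tensor3 H 1 σ)) * leg23 F := by
      rw [mul_assoc _ _ (leg23 F), ← hR2.eq, ← mul_assoc, ← hR1.eq, mul_assoc, ← map_mul, ← hF]
    rw [hL, hR, hL2, h12, h23, ← mul_assoc (expS (tensor3 A u W) * _), hbch]
    simp only [mul_assoc]
    congr 2
    rw [← mul_assoc, k1.eq, mul_assoc]
    congr 1
    rw [← mul_assoc, k2.eq, mul_assoc]
  · rw [hF, map_mul, counitId_expS_tensorS _ eA, counitId_expS_tensorS _ eH, one_mul]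
  · rw [hF, map_mul, idCounit_expS_tensorS _ eW, idCounit_expS_tensorS _ eσ, one_mul]

/-- If `J` is primitive for `Δ_F` and `ρ` is primitive for `Δ_{exp(J ⊗ ρ) F}`, then `exp(J ⊗ ρ) F`
is a twisting element. -/
theorem isTwist_expS_mul {F : (U 𝔤 ⊗[ℂ] U 𝔤)⟦X⟧} {J ρ : (U 𝔤)⟦X⟧} (hF : IsTwist F)
    (hρ0 : PowerSeries.constantCoeff ρ = 0) (eJ : CounitZero J) (eρ : CounitZero ρ)
    (hJ : IsTwPrimitive F J) (hρ : IsTwPrimitive (expS (J ⊗ₚ ρ) * F) ρ) :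
    IsTwist (expS (J ⊗ₚ ρ) * F) ∧
    twComulId F (expS (J ⊗ₚ ρ)) = leg13 (expS (J ⊗ₚ ρ)) * leg23 (expS (J ⊗ₚ ρ)) ∧
    idTwComul (expS (J ⊗ₚ ρ) * F) (expS (J ⊗ₚ ρ)) =
      leg12 (expS (J ⊗ₚ ρ)) * leg13 (expS (J ⊗ₚ ρ)) := by
  have hU : IsUnit (expS (J ⊗ₚ ρ) * F) :=
    (isUnit_expS (constantCoeff_tensorS (Or.inr hρ0))).mul hF.isUnit
  have h1 := semiconjBy_comulId_expS (b := ρ) (Or.inr hρ0)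
    (semiconjBy_of_twComul_eq hF.isUnit hJ) (Commute.one_left J)
  have h2 := semiconjBy_idComul_expS (a := J) (Or.inr hρ0)
    (semiconjBy_of_twComul_eq hU hρ) (Commute.one_right ρ)
  rw [← leg13_expS_tensorS, ← leg23_expS_tensorS] at h1
  rw [← leg13_expS_tensorS, ← leg12_expS_tensorS] at h2
  refine ⟨⟨hU, ?_, ?_, ?_⟩, twComulId_eq hF.isUnit h1, idTwComul_eq hU h2⟩
  -- Both sides become Φ₁₂ Φ₁₃ Φ₂₃ times the corresponding side of the cocycle condition for F.
  · rw [map_mul comulId, map_mul idComul, ← mul_assoc (leg23 _), h2.eq, map_mul leg12,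
      map_mul leg23, mul_assoc (leg12 _), ← mul_assoc (leg12 F), h1.eq]
    simp only [mul_assoc]
    rw [hF.cocycle]
  · rw [map_mul, counitId_expS_tensorS _ eJ, hF.counit_left, one_mul]
  · rw [map_mul, idCounit_expS_tensorS _ eρ, hF.counit_right, one_mul]

/-- If `J` is primitive for `Δ_F` and `ρ` is primitive for `Δ_{exp(ρ ⊗ J) F}`, then `exp(ρ ⊗ J) F`
is a twisting element. -/
theorem isTwist_expS_mul' {F : (U 𝔤 ⊗[ℂ] U 𝔤)⟦X⟧} {J ρ : (U 𝔤)⟦X⟧} (hF : IsTwist F)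
    (hρ0 : PowerSeries.constantCoeff ρ = 0) (eJ : CounitZero J) (eρ : CounitZero ρ)
    (hJ : IsTwPrimitive F J) (hρ : IsTwPrimitive (expS (ρ ⊗ₚ J) * F) ρ) :
    IsTwist (expS (ρ ⊗ₚ J) * F) ∧
    twComulId (expS (ρ ⊗ₚ J) * F) (expS (ρ ⊗ₚ J)) =
      leg13 (expS (ρ ⊗ₚ J)) * leg23 (expS (ρ ⊗ₚ J)) ∧
    idTwComul F (expS (ρ ⊗ₚ J)) = leg12 (expS (ρ ⊗ₚ J)) * leg13 (expS (ρ ⊗ₚ J)) := by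
  have hU : IsUnit (expS (ρ ⊗ₚ J) * F) :=
    (isUnit_expS (constantCoeff_tensorS (Or.inl hρ0))).mul hF.isUnit
  have h1 := semiconjBy_comulId_expS (b := J) (Or.inl hρ0)
    (semiconjBy_of_twComul_eq hU hρ) (Commute.one_left ρ)
  have h2 := semiconjBy_idComul_expS (a := ρ) (Or.inl hρ0)
    (semiconjBy_of_twComul_eq hF.isUnit hJ) (Commute.one_right J)
  rw [← leg13_expS_tensorS, ← leg23_expS_tensorS] at h1
  rw [← leg13_expS_tensorS, ← leg12_expS_tensorS] at h2
  refine ⟨⟨hU, ?_, ?_, ?_⟩, twComulId_eq hU h1, idTwComul_eq hF.isUnit h2⟩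
  -- With Ψ = exp(ρ ⊗ J) the two sides begin with Ψ₁₃ Ψ₂₃ Ψ₁₂ and Ψ₂₃ Ψ₁₂ Ψ₁₃. These agree because
  -- Ψ₁₃ commutes with Ψ₂₃ (both have J in leg three) and with Ψ₁₂ (both have ρ in leg one).
  · have hc : Commute (leg13 (expS (ρ ⊗ₚ J))) (leg23 (expS (ρ ⊗ₚ J))) := by
      rw [leg13_expS_tensorS, leg23_expS_tensorS]
      have c1 : PowerSeries.constantCoeff (tensor3 ρ 1 J) = 0 :=
        constantCoeff_tensor3 (Or.inl hρ0)
      have c2 : PowerSeries.constantCoeff (tensor3 1 ρ J) = 0 :=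
        constantCoeff_tensor3 (Or.inr (Or.inl hρ0))
      exact commute_expS c2 (commute_expS c1 (commute_tensor3 (Commute.one_left ρ)
        (Commute.one_right ρ) (Commute.refl J))).symm
    have hc' : Commute (leg12 (expS (ρ ⊗ₚ J))) (leg13 (expS (ρ ⊗ₚ J))) := by
      rw [leg13_expS_tensorS, leg12_expS_tensorS]
      have c1 : PowerSeries.constantCoeff (tensor3 ρ 1 J) = 0 :=
        constantCoeff_tensor3 (Or.inl hρ0)
      have c2 : PowerSeries.constantCoeff (tensor3 ρ J 1) = 0 :=
        constantCoeff_tensor3 (Or.inl hρ0)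
      exact commute_expS c1 (commute_expS c2 (commute_tensor3 (Commute.refl ρ)
        (Commute.one_left J) (Commute.one_right J))).symm
    rw [map_mul comulId, map_mul idComul, ← mul_assoc (leg12 _), h1.eq, map_mul leg12,
      map_mul leg23, mul_assoc (leg23 _), ← mul_assoc (leg23 F), h2.eq]
    simp only [mul_assoc]
    rw [← hF.cocycle]
    simp only [← mul_assoc]
    rw [hc.eq, mul_assoc (leg23 _), ← hc'.eq, ← mul_assoc]
  · rw [map_mul, counitId_expS_tensorS _ eρ, hF.counit_left, one_mul]
  · rw [map_mul, idCounit_expS_tensorS _ eJ, hF.counit_right, one_mul]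

end Criteria

/-! ## Relations in the enveloping algebras -/

section Relations

variable {𝔤 : Type} [LieRing 𝔤] [LieAlgebra ℂ 𝔤]

theorem cst_mul_cst (x y : 𝔤) : cst x * cst y = cst y * cst x + cst ⁅x, y⁆ := by
  let _ : LieRing (U 𝔤) := LieRing.ofAssociativeRing
  have h : UniversalEnvelopingAlgebra.ι ℂ ⁅x, y⁆ =
      UniversalEnvelopingAlgebra.ι ℂ x * UniversalEnvelopingAlgebra.ι ℂ y -
        UniversalEnvelopingAlgebra.ι ℂ y * UniversalEnvelopingAlgebra.ι ℂ x := by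
    rw [LieHom.map_lie, LieRing.of_associative_ring_bracket]
  rw [cst, cst, cst, h, map_sub, map_mul, map_mul]
  abel

theorem cst_mul_zcst (x y : 𝔤) : cst x * zcst y = zcst y * cst x + zcst ⁅x, y⁆ := by
  rw [zcst, zcst, ← mul_assoc, (PowerSeries.commute_X (cst x)).eq, mul_assoc, cst_mul_cst,
    mul_add, mul_assoc]

theorem zcst_mul_cst (x y : 𝔤) : zcst x * cst y = cst y * zcst x + zcst ⁅x, y⁆ := by
  rw [zcst, zcst, mul_assoc, cst_mul_cst, mul_add, ← mul_assoc (cst y),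
    (PowerSeries.commute_X (cst y)).eq, mul_assoc]

/-- Two rescaled generators give a factor z² on their bracket. In both algebras the bracket of the
two rescaled generators is zero, so this surplus factor never matters. -/
theorem zcst_mul_zcst (x y : 𝔤) :
    zcst x * zcst y = zcst y * zcst x + PowerSeries.X * zcst ⁅x, y⁆ := by
  rw [zcst, mul_assoc, cst_mul_zcst, mul_add, ← mul_assoc, ← mul_assoc,
    (PowerSeries.commute_X (zcst y)).eq]

theorem cst_smul (c : ℂ) (x : 𝔤) : cst (c • x) = c • cst x := by
  refine PowerSeries.ext fun n => ?_
  rw [coeff_smulS, cst, cst, PowerSeries.coeff_C, PowerSeries.coeff_C, map_smul]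
  split_ifs
  · rfl
  · rw [smul_zero]

theorem zcst_smul (c : ℂ) (x : 𝔤) : zcst (c • x) = c • zcst x := by
  rw [zcst, cst_smul, mul_smul_comm, zcst]

theorem cst_zero : cst (0 : 𝔤) = 0 := by rw [cst, map_zero, map_zero]

theorem zcst_zero : zcst (0 : 𝔤) = 0 := by rw [zcst, cst_zero, mul_zero]

theorem constantCoeff_zcst (x : 𝔤) : PowerSeries.constantCoeff (zcst x) = 0 := by
  rw [zcst, map_mul, PowerSeries.constantCoeff_X, zero_mul]

end Relations

/-! ### The relations of L and L' for series -/

section LRel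

variable {R : Type*} [Ring R] [Algebra ℂ R]

/-- The commutation relations of `L` for series, together with the definitions of `σ` and `ρ`. -/
structure RelL (δ γ μ : ℂ) (H E A B J σ ρ : R⟦X⟧) : Prop where
  delta_ne : δ ≠ 0
  cE : PowerSeries.constantCoeff E = 0
  cB : PowerSeries.constantCoeff B = 0
  HE : H * E = E * H + δ • E
  HA : Commute H A
  HB : H * B = B * H + δ • B
  AB : A * B = B * A + γ • E
  EA : Commute E A
  EB : Commute E B
  JH : Commute J H
  JE : Commute J E
  JA : J * A = A * J + (-μ) • A
  JB : J * B = B * J + μ • B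
  sigma : σ = δ⁻¹ • lnS (γ • E)
  rho : ρ = lnDiv μ (B * expS (-(δ • σ)))

/-- The commutation relations of `L'` for series, together with the definitions of `σ` and `ρ`. -/
structure RelL' (δ γ μ : ℂ) (H E A B J σ ρ : R⟦X⟧) : Prop where
  delta_ne : δ ≠ 0
  cE : PowerSeries.constantCoeff E = 0
  cA : PowerSeries.constantCoeff A = 0
  HE : H * E = E * H + δ • E
  HA : H * A = A * H + δ • A
  HB : Commute H B
  AB : A * B = B * A + γ • E
  EA : Commute E A
  EB : Commute E B
  JH : Commute J H
  JE : Commute J E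
  JA : J * A = A * J + μ • A
  JB : J * B = B * J + (-μ) • B
  sigma : σ = δ⁻¹ • lnS (γ • E)
  rho : ρ = lnDiv μ A

variable {δ γ μ : ℂ} {H E A B J σ ρ : R⟦X⟧}

/-- This form makes σ and ρ values of the same function, so one set of logarithm lemmas serves both.
-/
theorem sigma_eq_lnDiv (hδ : δ ≠ 0) : δ⁻¹ • lnS (γ • E) = lnDiv δ ((γ / δ) • E) := by
  rw [lnDiv_eq hδ, smul_smul, mul_div_cancel₀ _ hδ]

/-- The facts on `H`, `E` and `σ = (1/δ) ln(1 + γE)` which follow from `[H, E] = δE`. -/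
theorem sigma_facts (hδ : δ ≠ 0) (cE : PowerSeries.constantCoeff E = 0)
    (HE : H * E = E * H + δ • E) (hσ : σ = δ⁻¹ • lnS (γ • E)) :
    PowerSeries.constantCoeff σ = 0 ∧ (∀ x, Commute x E → Commute x σ) ∧
    expS (δ • σ) = 1 + γ • E ∧ (γ • E) * expS (-(δ • σ)) = 1 - expS (-(δ • σ)) ∧
    H * σ = σ * H + (1 - expS (-(δ • σ))) := by
  rw [sigma_eq_lnDiv hδ] at hσ
  subst hσ
  have cE' := constantCoeff_smulS (γ / δ) cE
  have hE' : δ • (γ / δ) • E = γ • E := by rw [smul_smul, mul_div_cancel₀ _ hδ]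
  have h := smul_mul_expS_neg_lnDiv δ cE'
  refine ⟨constantCoeff_lnDiv _ _, fun x hx => commute_evalSeries _ cE' (hx.smul_right _), ?_, ?_,
    ?_⟩
  · rw [expS_smul_lnDiv δ cE', hE']
  · rw [← h, hE']
  -- Put f = (γ/δ)E. Then [H, f] = δ f, and δ f (1 + δ f)⁻¹ = 1 - e^{-δσ}.
  · rw [← h]
    refine mul_lnDiv_of_commutator δ cE' ?_
      (((Commute.refl E).smul_right _).smul_left _ |>.smul_right _)
    rw [mul_smul_comm, HE, smul_add, smul_mul_assoc, smul_comm]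

/-- The facts on `J`, `W` and `ρ = (1/μ) ln(1 + μW)` which follow from `[J, W] = μW`. -/
theorem rho_facts {W : R⟦X⟧} (cW : PowerSeries.constantCoeff W = 0)
    (JW : J * W = W * J + μ • W) (hρ : ρ = lnDiv μ W) :
    PowerSeries.constantCoeff ρ = 0 ∧ (∀ x, Commute x W → Commute x ρ) ∧
    expS (μ • ρ) = 1 + μ • W ∧ (μ • W) * expS (-(μ • ρ)) = 1 - expS (-(μ • ρ)) ∧
    J * ρ = ρ * J + (1 - expS (-(μ • ρ))) ∧
    ∀ g h, g * W = W * g + h → Commute W h → g * ρ = ρ * g + h * expS (-(μ • ρ)) := by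
  subst hρ
  have h := smul_mul_expS_neg_lnDiv μ cW
  refine ⟨constantCoeff_lnDiv _ _, fun x hx => commute_evalSeries _ cW hx,
    expS_smul_lnDiv μ cW, h, ?_, fun g h hg hh => mul_lnDiv_of_commutator μ cW hg hh⟩
  rw [← h]
  exact mul_lnDiv_of_commutator μ cW JW ((Commute.refl W).smul_right _)

end LRel

/-! ## Twists of `U(L)` -/

/-! ### Commutators with σ and ρ for L -/

section DerivedRelations

variable {R : Type*} [Ring R] [Algebra ℂ R]

theorem semiconjBy_of_eq {M : Type*} [Mul M] {g x y y' : M} (h : SemiconjBy g x y) (e : y = y') :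
    SemiconjBy g x y' := e ▸ h

theorem expS_add_of_commute_smul {f g : R⟦X⟧} (hf : PowerSeries.constantCoeff f = 0)
    (hg : PowerSeries.constantCoeff g = 0) (h : Commute f g) (a b : ℂ) :
    expS (a • f + b • g) = expS (a • f) * expS (b • g) :=
  expS_add (constantCoeff_smulS a hf) (constantCoeff_smulS b hg)
    ((h.smul_left a).smul_right b)

/-- Consequences of the relations of `L`, for `u = e^{-δσ}`, `s = e^{δσ}`, `r = e^{-μρ}`,
`t = e^{μρ}` and `W = B e^{-δσ}`. -/
structure DerivedL (δ γ μ : ℂ) (H E A B J σ ρ u s r t W : R⟦X⟧) : Prop where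
  u_eq : u = expS (-(δ • σ))
  s_eq : s = expS (δ • σ)
  r_eq : r = expS (-(μ • ρ))
  t_eq : t = expS (μ • ρ)
  W_eq : W = B * u
  s_eq' : s = 1 + γ • E
  t_eq' : t = 1 + μ • W
  su : s * u = 1
  cσ : PowerSeries.constantCoeff σ = 0
  cρ : PowerSeries.constantCoeff ρ = 0
  cW : PowerSeries.constantCoeff W = 0
  σu : Commute σ u
  comm_σ : ∀ x, Commute x E → Commute x σ
  comm_u : ∀ x, Commute x E → Commute x u
  comm_s : ∀ x, Commute x E → Commute x s
  comm_ρ : ∀ x, Commute x E → Commute x B → Commute x ρ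
  comm_r : ∀ x, Commute x E → Commute x B → Commute x r
  comm_W : ∀ x, Commute x E → Commute x B → Commute x W
  Hσ : H * σ = σ * H + (1 - u)
  HW : H * W = W * H + δ • (W * u)
  AW : A * W = W * A + (1 - u)
  JW : J * W = W * J + μ • W
  Jρ : J * ρ = ρ * J + (1 - r)
  Aρ : A * ρ = ρ * A + γ • (E * (u * r))
  Hρ : H * ρ = ρ * H + δ • (B * (u * (u * r)))

/-- Everything rests on e^{δσ} = 1 + γE. It gives γE u = 1 - u, so [A, W] = [A, B] u = 1 - u; the
commutators with ρ then follow from those with W by the derivative of the logarithm, which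
contributes the factor r. -/
theorem RelL.derived {δ γ μ : ℂ} {H E A B J σ ρ : R⟦X⟧} (h : RelL δ γ μ H E A B J σ ρ) :
    DerivedL δ γ μ H E A B J σ ρ (expS (-(δ • σ))) (expS (δ • σ)) (expS (-(μ • ρ)))
      (expS (μ • ρ)) (B * expS (-(δ • σ))) := by
  obtain ⟨cσ, comm_σ, s_eq', Eu, Hσ⟩ := sigma_facts h.delta_ne h.cE h.HE h.sigma
  have cδσ := constantCoeff_smulS δ cσ
  have cu := constantCoeff_neg cδσ
  have hρ := h.rho
  have su := expS_mul_expS_neg cδσ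
  have comm_u : ∀ x, Commute x E → Commute x (expS (-(δ • σ))) := fun x hx =>
    commute_expS cu ((comm_σ x hx).smul_right δ).neg_right
  have comm_s : ∀ x, Commute x E → Commute x (expS (δ • σ)) := fun x hx =>
    commute_expS cδσ ((comm_σ x hx).smul_right δ)
  have σu : Commute σ (expS (-(δ • σ))) :=
    commute_expS cu ((Commute.refl σ).smul_right δ).neg_right
  have Hu : H * expS (-(δ • σ)) = expS (-(δ • σ)) * H +
      -(δ • (1 - expS (-(δ • σ)))) * expS (-(δ • σ)) := by
    have := mul_evalSeries_of_commutator (PowerSeries.exp ℂ) (f := -(δ • σ)) (g := H)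
      (h := -(δ • (1 - expS (-(δ • σ))))) cu
      (by rw [mul_neg, mul_smul_comm, Hσ, smul_add, neg_add, neg_mul, smul_mul_assoc])
      (((((Commute.one_right σ).sub_right σu).smul_left δ).neg_left.smul_right δ).neg_right)
    rwa [PowerSeries.derivative_exp] at this
  generalize hu : expS (-(δ • σ)) = u at *
  generalize hs : expS (δ • σ) = s at *
  have cW : PowerSeries.constantCoeff (B * u) = 0 := constantCoeff_mul_left _ h.cB
  have comm_W : ∀ x, Commute x E → Commute x B → Commute x (B * u) :=
    fun x hx hx' => hx'.mul_right (comm_u x hx)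
  have uB := comm_u B h.EB.symm
  have uA := comm_u A h.EA.symm
  have uJ := comm_u J h.JE
  -- The term δBu from [H, B] cancels against part of B [H, u] = -δB(1 - u)u, leaving δBu².
  have HW : H * (B * u) = B * u * H + δ • (B * u * u) := by
    rw [← mul_assoc, h.HB, add_mul, mul_assoc, Hu]
    simp only [mul_add, smul_mul_assoc, sub_mul, one_mul, smul_sub, neg_sub,
      mul_sub, mul_smul_comm, mul_assoc]
    abel
  have AW : A * (B * u) = B * u * A + (1 - u) := by
    rw [← Eu, ← mul_assoc, h.AB, add_mul, mul_assoc, uA.eq, mul_assoc]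
  have JW : J * (B * u) = B * u * J + μ • (B * u) := by
    rw [← mul_assoc, h.JB, add_mul, mul_assoc, uJ.eq, mul_assoc, smul_mul_assoc]
  obtain ⟨cρ, comm_ρ', t_eq', _, Jρ, hcomm⟩ := rho_facts cW JW hρ
  have comm_ρ : ∀ x, Commute x E → Commute x B → Commute x ρ :=
    fun x hx hx' => comm_ρ' x (comm_W x hx hx')
  have cr := constantCoeff_neg (constantCoeff_smulS μ cρ)
  have comm_r : ∀ x, Commute x E → Commute x B → Commute x (expS (-(μ • ρ))) :=
    fun x hx hx' => commute_expS cr ((comm_ρ x hx hx').smul_right μ).neg_right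
  have Wu : Commute (B * u) u := uB.mul_left (Commute.refl u)
  refine ⟨hu.symm, hs.symm, rfl, rfl, rfl, s_eq', t_eq', su, cσ, cρ, cW, σu, comm_σ,
    comm_u, comm_s, comm_ρ, comm_r, comm_W, Hσ, HW, AW, JW, Jρ, ?_, ?_⟩
  · have := hcomm A (1 - u) AW ((Commute.one_right _).sub_right Wu)
    rwa [← Eu, smul_mul_assoc, smul_mul_assoc, mul_assoc] at this
  · have := hcomm H (δ • (B * u * u)) HW (((Commute.refl _).mul_right Wu).smul_right δ)
    rwa [smul_mul_assoc, mul_assoc, mul_assoc] at this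

end DerivedRelations

/-! ### Coproducts twisted by F_P for L -/

section TwistL

variable {𝔤 : Type} [LieRing 𝔤] [LieAlgebra ℂ 𝔤]

/-- `x` is primitive for the standard coproduct and has counit zero. -/
structure IsPrimS (x : (U 𝔤)⟦X⟧) : Prop where
  comul : comulS x = x ⊗ₚ 1 + 1 ⊗ₚ x
  counit : CounitZero x

variable {δ γ μ : ℂ} {H E A B J σ ρ u s r t W : (U 𝔤)⟦X⟧}

/-- The coproducts twisted by `exp(A ⊗ W) exp(H ⊗ σ)`, for `L`. -/
theorem semiconjBy_FP_L (h : RelL δ γ μ H E A B J σ ρ)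
    (d : DerivedL δ γ μ H E A B J σ ρ u s r t W) (pH : IsPrimS H) (pE : IsPrimS E)
    (pA : IsPrimS A) (pB : IsPrimS B) (pJ : IsPrimS J)
    {F : (U 𝔤 ⊗[ℂ] U 𝔤)⟦X⟧} (hF : F = expS (A ⊗ₚ W) * expS (H ⊗ₚ σ)) :
    SemiconjBy F (comulS E) (E ⊗ₚ s + 1 ⊗ₚ E) ∧
    SemiconjBy F (comulS B) (B ⊗ₚ s + s ⊗ₚ B) ∧
    SemiconjBy F (comulS A) (A ⊗ₚ u + 1 ⊗ₚ A) ∧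
    SemiconjBy F (comulS H) (H ⊗ₚ u + 1 ⊗ₚ H - δ • (A ⊗ₚ (W * u))) ∧
    SemiconjBy F (comulS J) (J ⊗ₚ 1 + 1 ⊗ₚ J) := by
  have EW := d.comm_W E (Commute.refl E) h.EB
  have BW := d.comm_W B h.EB.symm (Commute.refl B)
  have Wu : Commute W u := d.comm_u W EW.symm
  subst hF
  refine ⟨?_, ?_, ?_, ?_, ?_⟩
  · rw [pE.comul]
    -- Here and below, y is the result of conjugating by the inner factor exp(H ⊗ σ) alone; the
    -- first goal then treats the outer exponential.
    refine SemiconjBy.mul_left (y := E ⊗ₚ s + 1 ⊗ₚ E) ?_ ?_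
    · exact (expS_tensorS_commute (Or.inr d.cW) h.EA.symm (d.comm_s W EW.symm)).add_right
        (expS_tensorS_commute (Or.inr d.cW) (Commute.one_right A) EW.symm)
    · refine SemiconjBy.add_right ?_ ?_
      · have := expS_tensorS_shift_left (d := 1) d.cσ h.HE (Commute.one_right σ)
        rwa [one_mul, ← d.s_eq] at this
      · exact expS_tensorS_commute (Or.inr d.cσ) (Commute.one_right H)
          (d.comm_σ E (Commute.refl E)).symm
  · rw [pB.comul]
    refine SemiconjBy.mul_left (y := B ⊗ₚ s + 1 ⊗ₚ B) ?_ ?_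
    · have h1 := expS_tensorS_commutator_left (x := A) (y := W) (c := B) (d := s)
        (h := γ • E) (Or.inr d.cW) h.AB (h.EA.symm.smul_right γ) (d.comm_s W EW.symm)
      have h2 := expS_tensorS_commute (x := A) (y := W) (c := 1) (d := B) (Or.inr d.cW)
        (Commute.one_right A) BW.symm
      have h3 := h1.add_right h2
      -- Since s W = s B u = B, the correction γE ⊗ sW is γE ⊗ B, and together with 1 ⊗ B it makes s
      -- ⊗ B.
      rwa [d.W_eq, ← mul_assoc, (d.comm_s B h.EB.symm).symm.eq, mul_assoc, d.su, mul_one,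
        ← d.W_eq, add_assoc, ← add_tensorS, add_comm _ 1, ← d.s_eq'] at h3
    · refine SemiconjBy.add_right ?_ ?_
      · have := expS_tensorS_shift_left (d := 1) d.cσ h.HB (Commute.one_right σ)
        rwa [one_mul, ← d.s_eq] at this
      · exact expS_tensorS_commute (Or.inr d.cσ) (Commute.one_right H)
          (d.comm_σ B h.EB.symm).symm
  · rw [pA.comul]
    refine SemiconjBy.mul_left (y := A ⊗ₚ 1 + 1 ⊗ₚ A) ?_ ?_
    · have h1 := expS_tensorS_commute (x := A) (y := W) (c := A) (d := 1) (Or.inr d.cW)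
        (Commute.refl A) (Commute.one_right W)
      have h2 := expS_tensorS_commutator_right (x := A) (y := W) (c := 1) (d := A)
        (h := -(1 - u)) (Or.inr d.cW) (Commute.one_right A) (by rw [d.AW]; abel)
        ((Commute.one_right W).sub_right Wu).neg_right
      have h3 := h1.add_right h2
      refine semiconjBy_of_eq h3 ?_
      rw [one_mul, tensorS_neg, tensorS_sub]
      abel
    · exact (expS_tensorS_commute (Or.inr d.cσ) h.HA (Commute.one_right σ)).add_right
        (expS_tensorS_commute (Or.inr d.cσ) (Commute.one_right H) (d.comm_σ A h.EA.symm).symm)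
  · rw [pH.comul]
    refine SemiconjBy.mul_left (y := H ⊗ₚ u + 1 ⊗ₚ H) ?_ ?_
    · have h1 := expS_tensorS_commute (x := A) (y := W) (c := H) (d := u) (Or.inr d.cW)
        h.HA.symm Wu
      have h2 := expS_tensorS_commutator_right (x := A) (y := W) (c := 1) (d := H)
        (h := -(δ • (W * u))) (Or.inr d.cW) (Commute.one_right A) (by rw [d.HW]; abel)
        (((Commute.refl W).mul_right Wu).smul_right δ).neg_right
      have h3 := h1.add_right h2
      refine semiconjBy_of_eq h3 ?_
      rw [one_mul, tensorS_neg, tensorS_smul]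
      abel
    · have h1 := expS_tensorS_commute (x := H) (y := σ) (c := H) (d := 1) (Or.inr d.cσ)
        (Commute.refl H) (Commute.one_right σ)
      have h2 := expS_tensorS_commutator_right (x := H) (y := σ) (c := 1) (d := H)
        (h := -(1 - u)) (Or.inr d.cσ) (Commute.one_right H) (by rw [d.Hσ]; abel)
        ((Commute.one_right σ).sub_right d.σu).neg_right
      have h3 := h1.add_right h2
      refine semiconjBy_of_eq h3 ?_
      rw [one_mul, tensorS_neg, tensorS_sub]
      abel
  · rw [pJ.comul]
    refine SemiconjBy.mul_left (y := J ⊗ₚ 1 + 1 ⊗ₚ J) ?_ ?_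
    -- A and W have weights -μ and μ under J, so the two corrections ±μ A ⊗ W cancel and J stays
    -- primitive.
    · have h1 := expS_tensorS_commutator_left (x := A) (y := W) (c := J) (d := 1)
        (h := μ • A) (Or.inr d.cW) (by rw [h.JA, neg_smul]; abel)
        ((Commute.refl A).smul_right μ) (Commute.one_right W)
      have h2 := expS_tensorS_commutator_right (x := A) (y := W) (c := 1) (d := J)
        (h := -(μ • W)) (Or.inr d.cW) (Commute.one_right A) (by rw [d.JW]; abel)
        ((Commute.refl W).smul_right μ).neg_right
      have h3 := h1.add_right h2
      refine semiconjBy_of_eq h3 ?_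
      rw [one_mul, one_mul, tensorS_neg, tensorS_smul, smul_tensorS]
      abel
    · exact (expS_tensorS_commute (Or.inr d.cσ) h.JH.symm (Commute.one_right σ)).add_right
        (expS_tensorS_commute (Or.inr d.cσ) (Commute.one_right H) (d.comm_σ J h.JE).symm)

/-- `σ` is primitive if `Δ_F(E) = E ⊗ e^{δσ} + 1 ⊗ E`. -/
theorem isTwPrimitive_sigma {F : (U 𝔤 ⊗[ℂ] U 𝔤)⟦X⟧} (hU : IsUnit F) (hδ : δ ≠ 0)
    (cE : PowerSeries.constantCoeff E = 0) (hσ : σ = δ⁻¹ • lnS (γ • E)) (hs : s = 1 + γ • E)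
    (hE : SemiconjBy F (comulS E) (E ⊗ₚ s + 1 ⊗ₚ E)) : IsTwPrimitive F σ := by
  rw [hσ, sigma_eq_lnDiv hδ]
  refine isTwPrimitive_lnDiv hU δ (constantCoeff_smulS _ cE) ?_
  have h := semiconjBy_smul (γ / δ) hE
  rw [← comulS_smul] at h
  refine semiconjBy_of_eq h ?_
  -- For f = (γ/δ)E the cross term (γ/δ)E ⊗ γE is δ f ⊗ f, as the functional equation requires.
  rw [hs, tensorS_add, tensorS_smul, smul_tensorS, smul_tensorS, tensorS_smul, tensorS_smul,
    smul_add, smul_add, smul_smul δ, mul_div_cancel₀ _ hδ, smul_comm γ]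
  abel

/-- `Δ_F(W) = W ⊗ 1 + 1 ⊗ W` for `W = B e^{-δσ}`, if `Δ_F(B) = B ⊗ e^{δσ} + e^{δσ} ⊗ B`. -/
theorem semiconjBy_comulS_W
    (d : DerivedL δ γ μ H E A B J σ ρ u s r t W) {F : (U 𝔤 ⊗[ℂ] U 𝔤)⟦X⟧} {a b : (U 𝔤)⟦X⟧}
    (hU : IsUnit F) (hσ : IsTwPrimitive F σ)
    (hB : SemiconjBy F (comulS B) (B ⊗ₚ (s * a) + (s * b) ⊗ₚ B)) (ha : Commute a E)
    (hb : Commute b E) :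
    SemiconjBy F (comulS W) (W ⊗ₚ a + b ⊗ₚ W) := by
  -- Multiplying by the group-like u removes the factors s. The parameters a, b are both 1 for F_P,
  -- while one of them is e^{μρ} for F and for F̃.
  have h1 := semiconjBy_comulS_expS hU d.cσ hσ (-δ)
  rw [neg_smul, ← d.u_eq] at h1
  have h2 := hB.mul_right h1
  rw [add_mul, tensorS_mul, tensorS_mul, ← d.W_eq, mul_assoc s, mul_assoc s,
    (d.comm_u a ha).eq, (d.comm_u b hb).eq, ← mul_assoc, ← mul_assoc, d.su, one_mul, one_mul,
    ← map_mul, ← d.W_eq] at h2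
  exact h2

end TwistL

/-! ### The full twists for L -/

section MainL

variable {𝔤 : Type} [LieRing 𝔤] [LieAlgebra ℂ 𝔤]
variable {δ γ μ : ℂ} {H E A B J σ ρ u s r t W : (U 𝔤)⟦X⟧}

/-- The coproducts twisted by `exp(J ⊗ ρ) exp(A ⊗ W) exp(H ⊗ σ)`, for `L`. -/
theorem semiconjBy_F_L (h : RelL δ γ μ H E A B J σ ρ)
    (d : DerivedL δ γ μ H E A B J σ ρ u s r t W) (pH : IsPrimS H) (pE : IsPrimS E)
    (pA : IsPrimS A) (pB : IsPrimS B) (pJ : IsPrimS J) {F : (U 𝔤 ⊗[ℂ] U 𝔤)⟦X⟧}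
    (hF : F = expS (J ⊗ₚ ρ) * (expS (A ⊗ₚ W) * expS (H ⊗ₚ σ))) :
    SemiconjBy F (comulS E) (E ⊗ₚ s + 1 ⊗ₚ E) ∧
    SemiconjBy F (comulS B) (B ⊗ₚ (s * t) + s ⊗ₚ B) ∧
    SemiconjBy F (comulS A) (A ⊗ₚ (u * r) + 1 ⊗ₚ A - γ • (J ⊗ₚ (E * (u * r)))) ∧
    SemiconjBy F (comulS H) (H ⊗ₚ u + 1 ⊗ₚ H - δ • (J ⊗ₚ (B * (u * (u * r))))
      - δ • (A ⊗ₚ (B * (u * (u * r))))) ∧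
    SemiconjBy F (comulS J) (J ⊗ₚ r + 1 ⊗ₚ J) := by
  obtain ⟨gE, gB, gA, gH, gJ⟩ := semiconjBy_FP_L h d pH pE pA pB pJ rfl
  have Eρ := d.comm_ρ E (Commute.refl E) h.EB
  have Bρ := d.comm_ρ B h.EB.symm (Commute.refl B)
  have ρu := d.comm_u ρ Eρ.symm
  have ρs := d.comm_s ρ Eρ.symm
  have ρρ := Commute.refl ρ
  have ρr : Commute ρ r := d.comm_r ρ Eρ.symm Bρ.symm
  have c0 : PowerSeries.constantCoeff J = 0 ∨ PowerSeries.constantCoeff ρ = 0 := Or.inr d.cρ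
  have r_eq : r = expS ((-μ) • ρ) := by rw [neg_smul, d.r_eq]
  subst hF
  refine ⟨?_, ?_, ?_, ?_, ?_⟩
  · exact SemiconjBy.mul_left ((expS_tensorS_commute c0 h.JE ρs).add_right
      (expS_tensorS_commute c0 (Commute.one_right J) Eρ.symm)) gE
  · refine SemiconjBy.mul_left (SemiconjBy.add_right ?_
      (expS_tensorS_commute c0 (d.comm_s J h.JE) Bρ.symm)) gB
    have := expS_tensorS_shift_left d.cρ h.JB ρs
    rwa [← d.t_eq] at this
  · have h1 := expS_tensorS_shift_left d.cρ h.JA ρu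
    have h2 := expS_tensorS_commutator_right (x := J) (y := ρ) (c := 1) (d := A)
      (h := -(γ • (E * (u * r)))) c0 (Commute.one_right J) (by rw [d.Aρ]; abel)
      (((Eρ.symm.mul_right (ρu.mul_right ρr)).smul_right γ).neg_right)
    refine SemiconjBy.mul_left (semiconjBy_of_eq (h1.add_right h2) ?_) gA
    rw [← r_eq, one_mul, tensorS_neg, tensorS_smul]
    abel
  · have h1 := expS_tensorS_commute (x := J) (y := ρ) (c := H) (d := u) c0 h.JH ρu
    have h2 := expS_tensorS_commutator_right (x := J) (y := ρ) (c := 1) (d := H)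
      (h := -(δ • (B * (u * (u * r))))) c0 (Commute.one_right J) (by rw [d.Hρ]; abel)
      (((Bρ.symm.mul_right (ρu.mul_right (ρu.mul_right ρr))).smul_right δ).neg_right)
    -- The term A ⊗ Wu already present in the coproduct of H acquires r, because A has weight -μ
    -- under J.
    have h3 := expS_tensorS_shift_left (d := W * u) d.cρ h.JA
      ((d.comm_W ρ Eρ.symm Bρ.symm).mul_right ρu)
    refine SemiconjBy.mul_left (semiconjBy_of_eq
      ((h1.add_right h2).sub_right (semiconjBy_smul δ h3)) ?_) gH
    rw [← r_eq, one_mul, tensorS_neg, tensorS_smul, d.W_eq, mul_assoc, mul_assoc]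
    abel
  · have h1 := expS_tensorS_commute (x := J) (y := ρ) (c := J) (d := 1) c0 (Commute.refl J)
      (Commute.one_right ρ)
    have h2 := expS_tensorS_commutator_right (x := J) (y := ρ) (c := 1) (d := J)
      (h := -(1 - r)) c0 (Commute.one_right J) (by rw [d.Jρ]; abel)
      ((Commute.one_right ρ).sub_right ρr).neg_right
    refine SemiconjBy.mul_left (semiconjBy_of_eq (h1.add_right h2) ?_) gJ
    rw [one_mul, tensorS_neg, tensorS_sub]
    abel

/-- The coproducts twisted by `exp(ρ ⊗ J) exp(A ⊗ W) exp(H ⊗ σ)`, for `L`. -/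
theorem semiconjBy_Ft_L (h : RelL δ γ μ H E A B J σ ρ)
    (d : DerivedL δ γ μ H E A B J σ ρ u s r t W) (pH : IsPrimS H) (pE : IsPrimS E)
    (pA : IsPrimS A) (pB : IsPrimS B) (pJ : IsPrimS J) {F : (U 𝔤 ⊗[ℂ] U 𝔤)⟦X⟧}
    (hF : F = expS (ρ ⊗ₚ J) * (expS (A ⊗ₚ W) * expS (H ⊗ₚ σ))) :
    SemiconjBy F (comulS E) (E ⊗ₚ s + 1 ⊗ₚ E) ∧
    SemiconjBy F (comulS B) (B ⊗ₚ s + (s * t) ⊗ₚ B) ∧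
    SemiconjBy F (comulS A) (A ⊗ₚ u + r ⊗ₚ A - γ • ((E * (u * r)) ⊗ₚ (J * u))) ∧
    SemiconjBy F (comulS J) (J ⊗ₚ 1 + r ⊗ₚ J) := by
  obtain ⟨gE, gB, gA, gH, gJ⟩ := semiconjBy_FP_L h d pH pE pA pB pJ rfl
  have Eρ := d.comm_ρ E (Commute.refl E) h.EB
  have Bρ := d.comm_ρ B h.EB.symm (Commute.refl B)
  have ρu := d.comm_u ρ Eρ.symm
  have ρs := d.comm_s ρ Eρ.symm
  have ρr : Commute ρ r := d.comm_r ρ Eρ.symm Bρ.symm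
  have Js := d.comm_s J h.JE
  have Ju := d.comm_u J h.JE
  have c0 : PowerSeries.constantCoeff ρ = 0 ∨ PowerSeries.constantCoeff J = 0 := Or.inl d.cρ
  have r_eq : r = expS ((-μ) • ρ) := by rw [neg_smul, d.r_eq]
  subst hF
  refine ⟨?_, ?_, ?_, ?_⟩
  · exact SemiconjBy.mul_left ((expS_tensorS_commute c0 Eρ.symm Js).add_right
      (expS_tensorS_commute c0 (Commute.one_right ρ) h.JE)) gE
  · refine SemiconjBy.mul_left (SemiconjBy.add_right
      (expS_tensorS_commute c0 Bρ.symm Js) ?_) gB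
    have := expS_tensorS_shift_right d.cρ ρs h.JB
    rwa [← d.t_eq] at this
  · have h1 := expS_tensorS_commutator_left (x := ρ) (y := J) (c := A) (d := u)
      (h := -(γ • (E * (u * r)))) c0 (by rw [d.Aρ]; abel)
      (((Eρ.symm.mul_right (ρu.mul_right ρr)).smul_right γ).neg_right) Ju
    have h2 := expS_tensorS_shift_right (c := 1) d.cρ (Commute.one_right ρ) h.JA
    refine SemiconjBy.mul_left (semiconjBy_of_eq (h1.add_right h2) ?_) gA
    rw [← r_eq, one_mul, neg_tensorS, smul_tensorS, Ju.eq]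
    abel
  · have h1 := expS_tensorS_commutator_left (x := ρ) (y := J) (c := J) (d := 1)
      (h := -(1 - r)) c0 (by rw [d.Jρ]; abel)
      ((Commute.one_right ρ).sub_right ρr).neg_right (Commute.one_right J)
    have h2 := expS_tensorS_commute (x := ρ) (y := J) (c := 1) (d := J) c0
      (Commute.one_right ρ) (Commute.refl J)
    refine SemiconjBy.mul_left (semiconjBy_of_eq (h1.add_right h2) ?_) gJ
    rw [one_mul, neg_tensorS, sub_tensorS]
    abel

/-- `exp(A ⊗ W) exp(H ⊗ σ)`, `exp(J ⊗ ρ) exp(A ⊗ W) exp(H ⊗ σ)` and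
`exp(ρ ⊗ J) exp(A ⊗ W) exp(H ⊗ σ)` for `L`: primitive elements and twisting elements. -/
theorem isTwist_L (h : RelL δ γ μ H E A B J σ ρ)
    (d : DerivedL δ γ μ H E A B J σ ρ u s r t W) (pH : IsPrimS H) (pE : IsPrimS E)
    (pA : IsPrimS A) (pB : IsPrimS B) (pJ : IsPrimS J)
    {FP F Ft : (U 𝔤 ⊗[ℂ] U 𝔤)⟦X⟧} (hFP : FP = expS (A ⊗ₚ W) * expS (H ⊗ₚ σ))
    (hF : F = expS (J ⊗ₚ ρ) * FP) (hFt : Ft = expS (ρ ⊗ₚ J) * FP) :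
    IsTwist FP ∧ CounitZero ρ ∧ IsTwPrimitive FP J ∧ IsTwPrimitive F σ ∧ IsTwPrimitive F ρ ∧
      IsTwPrimitive Ft σ ∧ IsTwPrimitive Ft ρ ∧ IsUnit F ∧ IsUnit Ft := by
  obtain ⟨gE, gB, gA, gH, gJ⟩ := semiconjBy_FP_L h d pH pE pA pB pJ hFP
  obtain ⟨fE, fB, -⟩ := semiconjBy_F_L h d pH pE pA pB pJ (hFP ▸ hF)
  obtain ⟨kE, kB, -⟩ := semiconjBy_Ft_L h d pH pE pA pB pJ (hFP ▸ hFt)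
  have EW := d.comm_W E (Commute.refl E) h.EB
  have BW := d.comm_W B h.EB.symm (Commute.refl B)
  have Wu : Commute W u := d.comm_u W EW.symm
  have tE : Commute t E := by
    rw [d.t_eq']
    exact (Commute.one_left E).add_left (EW.symm.smul_left μ)
  have hU : IsUnit FP := by
    rw [hFP]
    exact (isUnit_expS (constantCoeff_tensorS (Or.inr d.cW))).mul
      (isUnit_expS (constantCoeff_tensorS (Or.inr d.cσ)))
  have hU1 : IsUnit F := by
    rw [hF]
    exact (isUnit_expS (constantCoeff_tensorS (Or.inr d.cρ))).mul hU
  have hU2 : IsUnit Ft := by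
    rw [hFt]
    exact (isUnit_expS (constantCoeff_tensorS (Or.inl d.cρ))).mul hU
  have s0 := isTwPrimitive_sigma hU h.delta_ne h.cE h.sigma d.s_eq' gE
  have s1 := isTwPrimitive_sigma hU1 h.delta_ne h.cE h.sigma d.s_eq' fE
  have s2 := isTwPrimitive_sigma hU2 h.delta_ne h.cE h.sigma d.s_eq' kE
  have w0 := semiconjBy_comulS_W d (a := 1) (b := 1) hU s0 (by rwa [mul_one])
    (Commute.one_left E) (Commute.one_left E)
  have w1 := semiconjBy_comulS_W d (a := t) (b := 1) hU1 s1 (by rwa [mul_one])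
    tE (Commute.one_left E)
  have w2 := semiconjBy_comulS_W d (a := 1) (b := t) hU2 s2 (by rwa [mul_one])
    (Commute.one_left E) tE
  have hρ : ρ = lnDiv μ W := by rw [h.rho, d.W_eq, d.u_eq]
  have eσ : CounitZero σ := by
    rw [h.sigma, sigma_eq_lnDiv h.delta_ne]
    exact (pE.counit.smul _).lnDiv δ
  have eW : CounitZero W := by
    rw [d.W_eq]
    exact pB.counit.mul_right u
  refine ⟨?_, ?_, twComul_eq hU gJ, s1, ?_, s2, ?_, hU1, hU2⟩
  -- W is primitive for Δ_{F_P}, so v = 1, in accordance with [A, W] = 1 - u.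
  · exact isTwist_expS_mul_expS (u := u) (v := 1) hFP (Or.inr d.cW) d.cσ pA.counit eW
      pH.counit eσ pH.comul gA w0 (semiconjBy_of_twComul_eq hU s0) d.AW (d.comm_σ A h.EA.symm)
      (d.comm_σ W EW.symm) (d.comm_u A h.EA.symm) (Commute.one_right A) Wu (Commute.one_right W)
  · rw [hρ]
    exact eW.lnDiv μ
  · rw [hρ]
    refine isTwPrimitive_lnDiv hU1 μ d.cW (semiconjBy_of_eq w1 ?_)
    -- With t = 1 + μW, the coproduct W ⊗ t + 1 ⊗ W says that 1 + μW is group-like.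
    rw [d.t_eq', tensorS_add, tensorS_smul]
    abel
  · rw [hρ]
    refine isTwPrimitive_lnDiv hU2 μ d.cW (semiconjBy_of_eq w2 ?_)
    rw [d.t_eq', add_tensorS, smul_tensorS]
    abel

end MainL

/-! ## Twists of `U(L')` -/

/-! ### Commutators with σ and ρ for L' -/

section DerivedRelations'

variable {R : Type*} [Ring R] [Algebra ℂ R]

/-- Consequences of the relations of `L'`, for `u = e^{-δσ}`, `s = e^{δσ}`, `r = e^{-μρ}` and
`t = e^{μρ}`. -/
structure DerivedL' (δ γ μ : ℂ) (H E A B J σ ρ u s r t : R⟦X⟧) : Prop where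
  s_eq : s = expS (δ • σ)
  r_eq : r = expS (-(μ • ρ))
  t_eq : t = expS (μ • ρ)
  s_eq' : s = 1 + γ • E
  t_eq' : t = 1 + μ • A
  Ar : (μ • A) * r = 1 - r
  cσ : PowerSeries.constantCoeff σ = 0
  cρ : PowerSeries.constantCoeff ρ = 0
  σu : Commute σ u
  ρr : Commute ρ r
  comm_σ : ∀ x, Commute x E → Commute x σ
  comm_u : ∀ x, Commute x E → Commute x u
  comm_s : ∀ x, Commute x E → Commute x s
  comm_ρ : ∀ x, Commute x A → Commute x ρ
  Hσ : H * σ = σ * H + (1 - u)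
  Jρ : J * ρ = ρ * J + (1 - r)
  Bρ : B * ρ = ρ * B + -(γ • (E * r))
  Hρ : H * ρ = ρ * H + δ • (A * r)

/-- Here ρ is a logarithm in the generator A itself, so no auxiliary W is needed: [H, A] and [B, A]
both commute with A, and the derivative of the logarithm gives [H, ρ] and [B, ρ]. -/
theorem RelL'.derived {δ γ μ : ℂ} {H E A B J σ ρ : R⟦X⟧} (h : RelL' δ γ μ H E A B J σ ρ) :
    DerivedL' δ γ μ H E A B J σ ρ (expS (-(δ • σ))) (expS (δ • σ)) (expS (-(μ • ρ)))
      (expS (μ • ρ)) := by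
  obtain ⟨cσ, comm_σ, s_eq', -, Hσ⟩ := sigma_facts h.delta_ne h.cE h.HE h.sigma
  obtain ⟨cρ, comm_ρ, t_eq', Ar, Jρ, hcomm⟩ := rho_facts h.cA h.JA h.rho
  have cδσ := constantCoeff_smulS δ cσ
  have cu := constantCoeff_neg cδσ
  refine ⟨rfl, rfl, rfl, s_eq', t_eq', Ar, cσ, cρ,
    commute_expS cu ((Commute.refl σ).smul_right δ).neg_right,
    commute_expS (constantCoeff_neg (constantCoeff_smulS μ cρ))
      ((Commute.refl ρ).smul_right μ).neg_right, comm_σ,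
    fun x hx => commute_expS cu ((comm_σ x hx).smul_right δ).neg_right,
    fun x hx => commute_expS cδσ ((comm_σ x hx).smul_right δ), comm_ρ, Hσ, Jρ, ?_, ?_⟩
  · have := hcomm B (-(γ • E)) (by rw [h.AB]; abel) (h.EA.symm.smul_right γ).neg_right
    rwa [neg_mul, smul_mul_assoc] at this
  · have := hcomm H (δ • A) h.HA ((Commute.refl A).smul_right δ)
    rwa [smul_mul_assoc] at this

end DerivedRelations'

/-! ### Twisted coproducts and twisting elements for L' -/

section TwistL'

variable {𝔤 : Type} [LieRing 𝔤] [LieAlgebra ℂ 𝔤]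
variable {δ γ μ : ℂ} {H E A B J σ ρ u s r t : (U 𝔤)⟦X⟧}

/-- The coproducts twisted by `exp(A ⊗ B) exp(H ⊗ σ)`, for `L'`. -/
theorem semiconjBy_FP_L' (h : RelL' δ γ μ H E A B J σ ρ)
    (d : DerivedL' δ γ μ H E A B J σ ρ u s r t) (pH : IsPrimS H) (pE : IsPrimS E)
    (pA : IsPrimS A) (pB : IsPrimS B) (pJ : IsPrimS J)
    {F : (U 𝔤 ⊗[ℂ] U 𝔤)⟦X⟧} (hF : F = expS (A ⊗ₚ B) * expS (H ⊗ₚ σ)) :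
    SemiconjBy F (comulS E) (E ⊗ₚ s + 1 ⊗ₚ E) ∧
    SemiconjBy F (comulS B) (B ⊗ₚ 1 + s ⊗ₚ B) ∧
    SemiconjBy F (comulS A) (A ⊗ₚ 1 + 1 ⊗ₚ A) ∧
    SemiconjBy F (comulS H) (H ⊗ₚ u + 1 ⊗ₚ H - δ • (A ⊗ₚ (B * u))) ∧
    SemiconjBy F (comulS J) (J ⊗ₚ 1 + 1 ⊗ₚ J) := by
  have c0 : PowerSeries.constantCoeff A = 0 ∨ PowerSeries.constantCoeff B = 0 := Or.inl h.cA
  have c1 : PowerSeries.constantCoeff H = 0 ∨ PowerSeries.constantCoeff σ = 0 := Or.inr d.cσ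
  have Bs := d.comm_s B h.EB.symm
  have Bu := d.comm_u B h.EB.symm
  subst hF
  refine ⟨?_, ?_, ?_, ?_, ?_⟩
  · rw [pE.comul]
    refine SemiconjBy.mul_left (y := E ⊗ₚ s + 1 ⊗ₚ E) ?_ ?_
    · exact (expS_tensorS_commute c0 h.EA.symm Bs).add_right
        (expS_tensorS_commute c0 (Commute.one_right A) h.EB.symm)
    · refine SemiconjBy.add_right ?_ ?_
      · have := expS_tensorS_shift_left (d := 1) d.cσ h.HE (Commute.one_right σ)
        rwa [one_mul, ← d.s_eq] at this
      · exact expS_tensorS_commute c1 (Commute.one_right H)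
          (d.comm_σ E (Commute.refl E)).symm
  · rw [pB.comul]
    refine SemiconjBy.mul_left (y := B ⊗ₚ 1 + 1 ⊗ₚ B) ?_ ?_
    · have h1 := expS_tensorS_commutator_left (x := A) (y := B) (c := B) (d := 1)
        (h := γ • E) c0 h.AB (h.EA.symm.smul_right γ) (Commute.one_right B)
      have h2 := expS_tensorS_commute (x := A) (y := B) (c := 1) (d := B) c0
        (Commute.one_right A) (Commute.refl B)
      refine semiconjBy_of_eq (h1.add_right h2) ?_
      rw [d.s_eq', add_tensorS, one_mul]
      abel
    · exact (expS_tensorS_commute c1 h.HB (Commute.one_right σ)).add_right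
        (expS_tensorS_commute c1 (Commute.one_right H) (d.comm_σ B h.EB.symm).symm)
  · rw [pA.comul]
    refine SemiconjBy.mul_left (y := A ⊗ₚ s + 1 ⊗ₚ A) ?_ ?_
    · have h1 := expS_tensorS_commute (x := A) (y := B) (c := A) (d := s) c0
        (Commute.refl A) Bs
      -- The inner factor stretches A ⊗ 1 to A ⊗ s, and the outer one contributes -A ⊗ γE; as s = 1
      -- + γE, A ends up primitive.
      have h2 := expS_tensorS_commutator_right (x := A) (y := B) (c := 1) (d := A)
        (h := -(γ • E)) c0 (Commute.one_right A) (by rw [h.AB]; abel)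
        (h.EB.symm.smul_right γ).neg_right
      refine semiconjBy_of_eq (h1.add_right h2) ?_
      rw [one_mul, d.s_eq', tensorS_neg, tensorS_add]
      abel
    · refine SemiconjBy.add_right ?_ ?_
      · have := expS_tensorS_shift_left (d := 1) d.cσ h.HA (Commute.one_right σ)
        rwa [one_mul, ← d.s_eq] at this
      · exact expS_tensorS_commute c1 (Commute.one_right H) (d.comm_σ A h.EA.symm).symm
  · rw [pH.comul]
    refine SemiconjBy.mul_left (y := H ⊗ₚ u + 1 ⊗ₚ H) ?_ ?_
    · have h1 := expS_tensorS_commutator_left (x := A) (y := B) (c := H) (d := u)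
        (h := -(δ • A)) c0 (by rw [h.HA]; abel) ((Commute.refl A).smul_right δ).neg_right Bu
      have h2 := expS_tensorS_commute (x := A) (y := B) (c := 1) (d := H) c0
        (Commute.one_right A) h.HB.symm
      refine semiconjBy_of_eq (h1.add_right h2) ?_
      rw [Bu.eq, neg_tensorS, smul_tensorS]
      abel
    · have h1 := expS_tensorS_commute (x := H) (y := σ) (c := H) (d := 1) c1
        (Commute.refl H) (Commute.one_right σ)
      have h2 := expS_tensorS_commutator_right (x := H) (y := σ) (c := 1) (d := H)
        (h := -(1 - u)) c1 (Commute.one_right H) (by rw [d.Hσ]; abel)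
        ((Commute.one_right σ).sub_right d.σu).neg_right
      refine semiconjBy_of_eq (h1.add_right h2) ?_
      rw [one_mul, tensorS_neg, tensorS_sub]
      abel
  · rw [pJ.comul]
    refine SemiconjBy.mul_left (y := J ⊗ₚ 1 + 1 ⊗ₚ J) ?_ ?_
    -- As for L, the opposite weights of A and B under J make the two corrections cancel.
    · have h1 := expS_tensorS_commutator_left (x := A) (y := B) (c := J) (d := 1)
        (h := -(μ • A)) c0 (by rw [h.JA]; abel)
        ((Commute.refl A).smul_right μ).neg_right (Commute.one_right B)
      have h2 := expS_tensorS_commutator_right (x := A) (y := B) (c := 1) (d := J)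
        (h := μ • B) c0 (Commute.one_right A) (by rw [h.JB, neg_smul]; abel)
        ((Commute.refl B).smul_right μ)
      refine semiconjBy_of_eq (h1.add_right h2) ?_
      rw [one_mul, one_mul, neg_tensorS, tensorS_smul, smul_tensorS]
      abel
    · exact (expS_tensorS_commute c1 h.JH.symm (Commute.one_right σ)).add_right
        (expS_tensorS_commute c1 (Commute.one_right H) (d.comm_σ J h.JE).symm)

/-- The coproducts twisted by `exp(J ⊗ ρ) exp(A ⊗ B) exp(H ⊗ σ)`, for `L'`. -/
theorem semiconjBy_F_L' (h : RelL' δ γ μ H E A B J σ ρ)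
    (d : DerivedL' δ γ μ H E A B J σ ρ u s r t) (pH : IsPrimS H) (pE : IsPrimS E)
    (pA : IsPrimS A) (pB : IsPrimS B) (pJ : IsPrimS J) {F : (U 𝔤 ⊗[ℂ] U 𝔤)⟦X⟧}
    (hF : F = expS (J ⊗ₚ ρ) * (expS (A ⊗ₚ B) * expS (H ⊗ₚ σ))) :
    SemiconjBy F (comulS E) (E ⊗ₚ s + 1 ⊗ₚ E) ∧
    SemiconjBy F (comulS B) (B ⊗ₚ r + s ⊗ₚ B + γ • ((J * s) ⊗ₚ (E * r))) ∧
    SemiconjBy F (comulS A) (A ⊗ₚ t + 1 ⊗ₚ A) ∧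
    SemiconjBy F (comulS J) (J ⊗ₚ r + 1 ⊗ₚ J) := by
  obtain ⟨gE, gB, gA, -, gJ⟩ := semiconjBy_FP_L' h d pH pE pA pB pJ rfl
  have Eρ := d.comm_ρ E h.EA
  have Js := d.comm_s J h.JE
  have c0 : PowerSeries.constantCoeff J = 0 ∨ PowerSeries.constantCoeff ρ = 0 := Or.inr d.cρ
  have r_eq : r = expS ((-μ) • ρ) := by rw [neg_smul, d.r_eq]
  subst hF
  refine ⟨?_, ?_, ?_, ?_⟩
  · exact SemiconjBy.mul_left ((expS_tensorS_commute c0 h.JE (d.comm_s ρ Eρ.symm)).add_right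
      (expS_tensorS_commute c0 (Commute.one_right J) Eρ.symm)) gE
  · have h1 := expS_tensorS_shift_left (d := 1) d.cρ h.JB (Commute.one_right ρ)
    have h2 := expS_tensorS_commutator_right (x := J) (y := ρ) (c := s) (d := B)
      (h := γ • (E * r)) c0 Js (by rw [d.Bρ]; abel)
      ((Eρ.symm.mul_right d.ρr).smul_right γ)
    refine SemiconjBy.mul_left (semiconjBy_of_eq (h1.add_right h2) ?_) gB
    rw [← r_eq, one_mul, tensorS_smul, Js.eq]
    abel
  · refine SemiconjBy.mul_left (SemiconjBy.add_right ?_ (expS_tensorS_commute c0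
      (Commute.one_right J) (d.comm_ρ A (Commute.refl A)).symm)) gA
    have := expS_tensorS_shift_left (d := 1) d.cρ h.JA (Commute.one_right ρ)
    rwa [one_mul, ← d.t_eq] at this
  · have h1 := expS_tensorS_commute (x := J) (y := ρ) (c := J) (d := 1) c0 (Commute.refl J)
      (Commute.one_right ρ)
    have h2 := expS_tensorS_commutator_right (x := J) (y := ρ) (c := 1) (d := J)
      (h := -(1 - r)) c0 (Commute.one_right J) (by rw [d.Jρ]; abel)
      ((Commute.one_right ρ).sub_right d.ρr).neg_right
    refine SemiconjBy.mul_left (semiconjBy_of_eq (h1.add_right h2) ?_) gJ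
    rw [one_mul, tensorS_neg, tensorS_sub]
    abel

/-- The coproducts twisted by `exp(ρ ⊗ J) exp(A ⊗ B) exp(H ⊗ σ)`, for `L'`. -/
theorem semiconjBy_Ft_L' (h : RelL' δ γ μ H E A B J σ ρ)
    (d : DerivedL' δ γ μ H E A B J σ ρ u s r t) (pH : IsPrimS H) (pE : IsPrimS E)
    (pA : IsPrimS A) (pB : IsPrimS B) (pJ : IsPrimS J) {F : (U 𝔤 ⊗[ℂ] U 𝔤)⟦X⟧}
    (hF : F = expS (ρ ⊗ₚ J) * (expS (A ⊗ₚ B) * expS (H ⊗ₚ σ))) :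
    SemiconjBy F (comulS E) (E ⊗ₚ s + 1 ⊗ₚ E) ∧
    SemiconjBy F (comulS B) (B ⊗ₚ 1 + (s * r) ⊗ₚ B + γ • ((E * r) ⊗ₚ J)) ∧
    SemiconjBy F (comulS A) (A ⊗ₚ 1 + t ⊗ₚ A) ∧
    SemiconjBy F (comulS H) (H ⊗ₚ u + 1 ⊗ₚ H - δ • ((A * r) ⊗ₚ (J * u))
      - δ • ((A * r) ⊗ₚ (B * u))) ∧
    SemiconjBy F (comulS J) (J ⊗ₚ 1 + r ⊗ₚ J) := by
  obtain ⟨gE, gB, gA, gH, gJ⟩ := semiconjBy_FP_L' h d pH pE pA pB pJ rfl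
  have Eρ := d.comm_ρ E h.EA
  have Aρ := d.comm_ρ A (Commute.refl A)
  have ρu := d.comm_u ρ Eρ.symm
  have ρs := d.comm_s ρ Eρ.symm
  have Js := d.comm_s J h.JE
  have Ju := d.comm_u J h.JE
  have c0 : PowerSeries.constantCoeff ρ = 0 ∨ PowerSeries.constantCoeff J = 0 := Or.inl d.cρ
  have r_eq : r = expS ((-μ) • ρ) := by rw [neg_smul, d.r_eq]
  subst hF
  refine ⟨?_, ?_, ?_, ?_, ?_⟩
  · exact SemiconjBy.mul_left ((expS_tensorS_commute c0 Eρ.symm Js).add_right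
      (expS_tensorS_commute c0 (Commute.one_right ρ) h.JE)) gE
  · have h1 := expS_tensorS_commutator_left (x := ρ) (y := J) (c := B) (d := 1)
      (h := γ • (E * r)) c0 (by rw [d.Bρ]; abel)
      ((Eρ.symm.mul_right d.ρr).smul_right γ) (Commute.one_right J)
    have h2 := expS_tensorS_shift_right d.cρ ρs h.JB
    refine SemiconjBy.mul_left (semiconjBy_of_eq (h1.add_right h2) ?_) gB
    rw [← r_eq, one_mul, smul_tensorS]
    abel
  · refine SemiconjBy.mul_left (SemiconjBy.add_right
      (expS_tensorS_commute c0 Aρ.symm (Commute.one_right J)) ?_) gA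
    have := expS_tensorS_shift_right (c := 1) d.cρ (Commute.one_right ρ) h.JA
    rwa [one_mul, ← d.t_eq] at this
  · have h1 := expS_tensorS_commutator_left (x := ρ) (y := J) (c := H) (d := u)
      (h := -(δ • (A * r))) c0 (by rw [d.Hρ]; abel)
      ((Aρ.symm.mul_right d.ρr).smul_right δ).neg_right Ju
    have h2 := expS_tensorS_commute (x := ρ) (y := J) (c := 1) (d := H) c0
      (Commute.one_right ρ) h.JH
    -- J now sits in the second leg, where B u has weight -μ; this puts r into the first leg.
    have h3 := expS_tensorS_shift_right (x := ρ) (y := J) (c := A) (d := B * u) (k := -μ)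
      d.cρ Aρ.symm
      (by rw [← mul_assoc, h.JB, add_mul, mul_assoc, Ju.eq, mul_assoc, smul_mul_assoc])
    refine SemiconjBy.mul_left (semiconjBy_of_eq
      ((h1.add_right h2).sub_right (semiconjBy_smul δ h3)) ?_) gH
    rw [← r_eq, neg_tensorS, smul_tensorS, Ju.eq]
    abel
  · have h1 := expS_tensorS_commutator_left (x := ρ) (y := J) (c := J) (d := 1)
      (h := -(1 - r)) c0 (by rw [d.Jρ]; abel)
      ((Commute.one_right ρ).sub_right d.ρr).neg_right (Commute.one_right J)
    have h2 := expS_tensorS_commute (x := ρ) (y := J) (c := 1) (d := J) c0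
      (Commute.one_right ρ) (Commute.refl J)
    refine SemiconjBy.mul_left (semiconjBy_of_eq (h1.add_right h2) ?_) gJ
    rw [one_mul, neg_tensorS, sub_tensorS]
    abel

/-- `exp(A ⊗ B) exp(H ⊗ σ)`, `exp(J ⊗ ρ) exp(A ⊗ B) exp(H ⊗ σ)` and
`exp(ρ ⊗ J) exp(A ⊗ B) exp(H ⊗ σ)` for `L'`: primitive elements and twisting elements. -/
theorem isTwist_L' (h : RelL' δ γ μ H E A B J σ ρ)
    (d : DerivedL' δ γ μ H E A B J σ ρ u s r t) (pH : IsPrimS H) (pE : IsPrimS E)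
    (pA : IsPrimS A) (pB : IsPrimS B) (pJ : IsPrimS J)
    {FP F Ft : (U 𝔤 ⊗[ℂ] U 𝔤)⟦X⟧} (hFP : FP = expS (A ⊗ₚ B) * expS (H ⊗ₚ σ))
    (hF : F = expS (J ⊗ₚ ρ) * FP) (hFt : Ft = expS (ρ ⊗ₚ J) * FP) :
    IsTwist FP ∧ CounitZero ρ ∧ IsTwPrimitive FP J ∧ IsTwPrimitive F σ ∧ IsTwPrimitive F ρ ∧
      IsTwPrimitive Ft σ ∧ IsTwPrimitive Ft ρ ∧ IsUnit F ∧ IsUnit Ft := by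
  obtain ⟨gE, gB, gA, gH, gJ⟩ := semiconjBy_FP_L' h d pH pE pA pB pJ hFP
  obtain ⟨fE, -, fA, -⟩ := semiconjBy_F_L' h d pH pE pA pB pJ (hFP ▸ hF)
  obtain ⟨kE, -, kA, -⟩ := semiconjBy_Ft_L' h d pH pE pA pB pJ (hFP ▸ hFt)
  have hU : IsUnit FP := by
    rw [hFP]
    exact (isUnit_expS (constantCoeff_tensorS (Or.inl h.cA))).mul
      (isUnit_expS (constantCoeff_tensorS (Or.inr d.cσ)))
  have hU1 : IsUnit F := by
    rw [hF]
    exact (isUnit_expS (constantCoeff_tensorS (Or.inr d.cρ))).mul hU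
  have hU2 : IsUnit Ft := by
    rw [hFt]
    exact (isUnit_expS (constantCoeff_tensorS (Or.inl d.cρ))).mul hU
  have s0 := isTwPrimitive_sigma hU h.delta_ne h.cE h.sigma d.s_eq' gE
  have s1 := isTwPrimitive_sigma hU1 h.delta_ne h.cE h.sigma d.s_eq' fE
  have s2 := isTwPrimitive_sigma hU2 h.delta_ne h.cE h.sigma d.s_eq' kE
  have eσ : CounitZero σ := by
    rw [h.sigma, sigma_eq_lnDiv h.delta_ne]
    exact (pE.counit.smul _).lnDiv δ
  refine ⟨?_, ?_, twComul_eq hU gJ, s1, ?_, s2, ?_, hU1, hU2⟩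
  -- Now A is primitive and B has Δ(B) = B ⊗ 1 + s ⊗ B, in accordance with [A, B] = γE = s - 1.
  · exact isTwist_expS_mul_expS (u := 1) (v := s) hFP (Or.inl h.cA) d.cσ pA.counit pB.counit
      pH.counit eσ pH.comul gA gB (semiconjBy_of_twComul_eq hU s0)
      (by rw [d.s_eq', add_sub_cancel_left, h.AB]) (d.comm_σ A h.EA.symm)
      (d.comm_σ B h.EB.symm) (Commute.one_right A) (d.comm_s A h.EA.symm) (Commute.one_right B)
      (d.comm_s B h.EB.symm)
  · rw [h.rho]
    exact pA.counit.lnDiv μ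
  · rw [h.rho]
    refine isTwPrimitive_lnDiv hU1 μ h.cA (semiconjBy_of_eq fA ?_)
    rw [d.t_eq', tensorS_add, tensorS_smul]
    abel
  · rw [h.rho]
    refine isTwPrimitive_lnDiv hU2 μ h.cA (semiconjBy_of_eq kA ?_)
    rw [d.t_eq', add_tensorS, smul_tensorS]
    abel

end TwistL'

/-! ## The series in `U(L)` and `U(L')` -/

section Instances

variable (δ γ μ : ℂ)

theorem isPrimS_cst {𝔤 : Type} [LieRing 𝔤] [LieAlgebra ℂ 𝔤] (x : 𝔤) : IsPrimS (cst x) :=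
  ⟨comulS_cst x, counitZero_cst x⟩

theorem isPrimS_zcst {𝔤 : Type} [LieRing 𝔤] [LieAlgebra ℂ 𝔤] (x : 𝔤) : IsPrimS (zcst x) :=
  ⟨comulS_zcst x, counitZero_zcst x⟩

theorem relL (hδ : δ ≠ 0) : RelL δ γ μ (LieL.H δ γ μ) (LieL.E δ γ μ) (LieL.A δ γ μ)
    (LieL.B δ γ μ) (LieL.J δ γ μ) (LieL.sigma δ γ μ) (LieL.rho δ γ μ) := by
  obtain ⟨HE, HA, HB, AB, EA, EB, JH, JE, JA, JB⟩ := LieL.relations δ γ μ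
  refine ⟨hδ, constantCoeff_zcst _, constantCoeff_zcst _, ?_, ?_, ?_, ?_, ?_, ?_, ?_, ?_, ?_, ?_,
    rfl, rfl⟩
  · exact (cst_mul_zcst _ _).trans (by rw [HE, zcst_smul]; rfl)
  · exact (cst_mul_cst _ _).trans (by rw [HA, cst_zero, add_zero]; rfl)
  · exact (cst_mul_zcst _ _).trans (by rw [HB, zcst_smul]; rfl)
  · exact (cst_mul_zcst _ _).trans (by rw [AB, zcst_smul]; rfl)
  · exact (zcst_mul_cst _ _).trans (by rw [EA, zcst_zero, add_zero]; rfl)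
  · exact (zcst_mul_zcst _ _).trans (by rw [EB, zcst_zero, mul_zero, add_zero]; rfl)
  · exact (cst_mul_cst _ _).trans (by rw [JH, cst_zero, add_zero]; rfl)
  · exact (cst_mul_zcst _ _).trans (by rw [JE, zcst_zero, add_zero]; rfl)
  · exact (cst_mul_cst _ _).trans (by rw [JA, cst_smul]; rfl)
  · exact (cst_mul_zcst _ _).trans (by rw [JB, zcst_smul]; rfl)

theorem relL' (hδ : δ ≠ 0) : RelL' δ γ μ (LieL'.H δ γ μ) (LieL'.E δ γ μ) (LieL'.A δ γ μ)
    (LieL'.B δ γ μ) (LieL'.J δ γ μ) (LieL'.sigma δ γ μ) (LieL'.rho δ γ μ) := by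
  obtain ⟨HE, HA, HB, AB, EA, EB, JH, JE, JA, JB⟩ := LieL'.relations δ γ μ
  refine ⟨hδ, constantCoeff_zcst _, constantCoeff_zcst _, ?_, ?_, ?_, ?_, ?_, ?_, ?_, ?_, ?_, ?_,
    rfl, rfl⟩
  · exact (cst_mul_zcst _ _).trans (by rw [HE, zcst_smul]; rfl)
  · exact (cst_mul_zcst _ _).trans (by rw [HA, zcst_smul]; rfl)
  · exact (cst_mul_cst _ _).trans (by rw [HB, cst_zero, add_zero]; rfl)
  · exact (zcst_mul_cst _ _).trans (by rw [AB, zcst_smul]; rfl)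
  · exact (zcst_mul_zcst _ _).trans (by rw [EA, zcst_zero, mul_zero, add_zero]; rfl)
  · exact (zcst_mul_cst _ _).trans (by rw [EB, zcst_zero, add_zero]; rfl)
  · exact (cst_mul_cst _ _).trans (by rw [JH, cst_zero, add_zero]; rfl)
  · exact (cst_mul_zcst _ _).trans (by rw [JE, zcst_zero, add_zero]; rfl)
  · exact (cst_mul_zcst _ _).trans (by rw [JA, zcst_smul]; rfl)
  · exact (cst_mul_cst _ _).trans (by rw [JB, cst_smul]; rfl)

theorem flip21_expS_tensorS {𝔤 : Type} [LieRing 𝔤] [LieAlgebra ℂ 𝔤] (a b : (U 𝔤)⟦X⟧) :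
    flip21 (expS (a ⊗ₚ b)) = expS (b ⊗ₚ a) := by
  rw [expS, flip21_evalSeries, flip21_tensorS, expS]

end Instances

end PET

end

/-! ### The main theorem -/

open PET in
theorem mainTheorem1 (δ γ μ : ℂ) (hδ : δ ≠ 0) (hγ : γ ≠ 0) :
    (let H := LieL.H δ γ μ
     let E := LieL.E δ γ μ
     let A := LieL.A δ γ μ
     let B := LieL.B δ γ μ
     let J := LieL.J δ γ μ
     let σ := LieL.sigma δ γ μ
     let ρ := LieL.rho δ γ μ
     let FP := LieL.FP δ γ μ
     let Φ := LieL.Phi δ γ μ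
     let F := LieL.F δ γ μ
     let Ft := LieL.Ft δ γ μ
     -- the twisting elements
     (IsTwist F ∧ IsTwist Ft) ∧
     -- primitive elements
     (IsTwPrimitive FP J ∧
      IsTwPrimitive F σ ∧ IsTwPrimitive F ρ ∧ IsTwPrimitive Ft σ ∧ IsTwPrimitive Ft ρ) ∧
     -- the coproduct twisted by F
     (twComul F J = J ⊗ₚ expS (-(μ • ρ)) + 1 ⊗ₚ J ∧
      twComul F H = H ⊗ₚ expS (-(δ • σ)) + 1 ⊗ₚ H
        - δ • (J ⊗ₚ (B * expS (-((2 * δ) • σ) - μ • ρ)))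
        - δ • (A ⊗ₚ (B * expS (-((2 * δ) • σ) - μ • ρ))) ∧
      twComul F A = A ⊗ₚ expS (-(δ • σ) - μ • ρ) + 1 ⊗ₚ A
        - γ • (J ⊗ₚ (E * expS (-(δ • σ) - μ • ρ))) ∧
      twComul F B = B ⊗ₚ expS (δ • σ + μ • ρ) + expS (δ • σ) ⊗ₚ B ∧
      twComul F E = E ⊗ₚ expS (δ • σ) + 1 ⊗ₚ E) ∧
     -- the coproduct twisted by F̃
     (twComul Ft J = J ⊗ₚ 1 + expS (-(μ • ρ)) ⊗ₚ J ∧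
      twComul Ft A = A ⊗ₚ expS (-(δ • σ)) + expS (-(μ • ρ)) ⊗ₚ A
        - γ • ((E * expS (-(δ • σ) - μ • ρ)) ⊗ₚ (J * expS (-(δ • σ)))) ∧
      twComul Ft B = B ⊗ₚ expS (δ • σ) + expS (δ • σ + μ • ρ) ⊗ₚ B ∧
      twComul Ft E = E ⊗ₚ expS (δ • σ) + 1 ⊗ₚ E) ∧
     -- factorization
     (twComulId FP Φ = leg13 Φ * leg23 Φ ∧
      idTwComul F Φ = leg12 Φ * leg13 Φ ∧
      twComulId Ft (flip21 Φ) = leg13 (flip21 Φ) * leg23 (flip21 Φ) ∧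
      idTwComul FP (flip21 Φ) = leg12 (flip21 Φ) * leg13 (flip21 Φ))) ∧
    (let H := LieL'.H δ γ μ
     let E := LieL'.E δ γ μ
     let A := LieL'.A δ γ μ
     let B := LieL'.B δ γ μ
     let J := LieL'.J δ γ μ
     let σ := LieL'.sigma δ γ μ
     let ρ := LieL'.rho δ γ μ
     let FP := LieL'.FP δ γ μ
     let Φ := LieL'.Phi δ γ μ
     let F := LieL'.F δ γ μ
     let Ft := LieL'.Ft δ γ μ
     -- the twisting elements
     (IsTwist F ∧ IsTwist Ft) ∧
     -- primitive elements
     (IsTwPrimitive FP J ∧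
      IsTwPrimitive F σ ∧ IsTwPrimitive F ρ ∧ IsTwPrimitive Ft σ ∧ IsTwPrimitive Ft ρ) ∧
     -- the coproduct twisted by F'
     (twComul F J = J ⊗ₚ expS (-(μ • ρ)) + 1 ⊗ₚ J ∧
      twComul F A = A ⊗ₚ expS (μ • ρ) + 1 ⊗ₚ A ∧
      twComul F B = B ⊗ₚ expS (-(μ • ρ)) + expS (δ • σ) ⊗ₚ B
        + γ • ((J * expS (δ • σ)) ⊗ₚ (E * expS (-(μ • ρ)))) ∧
      twComul F E = E ⊗ₚ expS (δ • σ) + 1 ⊗ₚ E) ∧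
     -- the coproduct twisted by F̃'
     (twComul Ft J = J ⊗ₚ 1 + expS (-(μ • ρ)) ⊗ₚ J ∧
      twComul Ft H = H ⊗ₚ expS (-(δ • σ)) + 1 ⊗ₚ H
        - δ • ((A * expS (-(μ • ρ))) ⊗ₚ (J * expS (-(δ • σ))))
        - δ • ((A * expS (-(μ • ρ))) ⊗ₚ (B * expS (-(δ • σ)))) ∧
      (μ ≠ 0 → twComul Ft H = H ⊗ₚ expS (-(δ • σ)) + 1 ⊗ₚ H
        + (δ / μ) • ((expS (-(μ • ρ)) - 1) ⊗ₚ (J * expS (-(δ • σ))))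
        - δ • ((A * expS (-(μ • ρ))) ⊗ₚ (B * expS (-(δ • σ))))) ∧
      twComul Ft A = A ⊗ₚ 1 + expS (μ • ρ) ⊗ₚ A ∧
      twComul Ft B = B ⊗ₚ 1 + expS (δ • σ - μ • ρ) ⊗ₚ B
        + γ • ((E * expS (-(μ • ρ))) ⊗ₚ J) ∧
      twComul Ft E = E ⊗ₚ expS (δ • σ) + 1 ⊗ₚ E) ∧
     -- factorization
     (twComulId FP Φ = leg13 Φ * leg23 Φ ∧
      idTwComul F Φ = leg12 Φ * leg13 Φ ∧
      twComulId Ft (flip21 Φ) = leg13 (flip21 Φ) * leg23 (flip21 Φ) ∧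
      idTwComul FP (flip21 Φ) = leg12 (flip21 Φ) * leg13 (flip21 Φ))) := by
  constructor
  · intro H E A B J σ ρ FP Φ F Ft
    have h : RelL δ γ μ H E A B J σ ρ := relL δ γ μ hδ
    have d := h.derived
    have pH : IsPrimS H := isPrimS_cst _
    have pE : IsPrimS E := isPrimS_zcst _
    have pA : IsPrimS A := isPrimS_cst _
    have pB : IsPrimS B := isPrimS_zcst _
    have pJ : IsPrimS J := isPrimS_cst _
    have hΦ : flip21 Φ = expS (ρ ⊗ₚ J) := flip21_expS_tensorS J ρ
    have hF : F = expS (J ⊗ₚ ρ) * FP := rfl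
    have hFt : Ft = expS (ρ ⊗ₚ J) * FP := by rw [← hΦ]; rfl
    have hFP : FP = expS (A ⊗ₚ (B * expS (-(δ • σ)))) * expS (H ⊗ₚ σ) := rfl
    have hΦ' : Φ = expS (J ⊗ₚ ρ) := rfl
    clear_value FP F Ft Φ H E A B J σ ρ
    obtain ⟨tFP, eρ, pFJ, p1, p2, p3, p4, hU, hUt⟩ :=
      isTwist_L h d pH pE pA pB pJ hFP hF hFt
    obtain ⟨fE, fB, fA, fH, fJ⟩ := semiconjBy_F_L h d pH pE pA pB pJ (hFP ▸ hF)
    obtain ⟨kE, kB, kA, kJ⟩ := semiconjBy_Ft_L h d pH pE pA pB pJ (hFP ▸ hFt)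
    obtain ⟨t1, q1, q2⟩ := isTwist_expS_mul tFP d.cρ pJ.counit eρ pFJ (hF ▸ p2)
    obtain ⟨t2, q3, q4⟩ := isTwist_expS_mul' tFP d.cρ pJ.counit eρ pFJ (hFt ▸ p4)
    rw [← hF] at t1 q2
    rw [← hFt] at t2 q3
    rw [← hΦ'] at q1 q2
    rw [← hΦ] at q3 q4
    -- Exponentials of sums of multiples of σ and ρ split because E commutes with B, hence σ with ρ.
    -- The exponent 2δ is split once more to match the form in which the coproduct of H was
    -- computed.
    have σρ : Commute σ ρ :=
      (d.comm_σ ρ (d.comm_ρ E (Commute.refl E) h.EB).symm).symm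
    have e1 : expS (-(δ • σ) - μ • ρ) = expS (-(δ • σ)) * expS (-(μ • ρ)) := by
      have := expS_add_of_commute_smul d.cσ d.cρ σρ (-δ) (-μ)
      rwa [neg_smul, neg_smul, ← sub_eq_add_neg] at this
    have e2 : expS (δ • σ + μ • ρ) = expS (δ • σ) * expS (μ • ρ) :=
      expS_add_of_commute_smul d.cσ d.cρ σρ δ μ
    have e3 : expS (-((2 * δ) • σ) - μ • ρ) =
        expS (-(δ • σ)) * (expS (-(δ • σ)) * expS (-(μ • ρ))) := by
      have h1 := expS_add_of_commute_smul d.cσ d.cρ σρ (-(2 * δ)) (-μ)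
      have h2 := expS_add_of_commute_smul d.cσ d.cσ (Commute.refl σ) (-δ) (-δ)
      rw [← add_smul, show -δ + -δ = -(2 * δ) by ring] at h2
      rw [h2, mul_assoc] at h1
      simpa only [neg_smul, ← sub_eq_add_neg] using h1
    rw [e1, e2, e3]
    exact ⟨⟨t1, t2⟩, ⟨pFJ, p1, p2, p3, p4⟩,
      ⟨twComul_eq hU fJ, twComul_eq hU fH, twComul_eq hU fA, twComul_eq hU fB, twComul_eq hU fE⟩,
      ⟨twComul_eq hUt kJ, twComul_eq hUt kA, twComul_eq hUt kB, twComul_eq hUt kE⟩,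
      q1, q2, q3, q4⟩
  · intro H E A B J σ ρ FP Φ F Ft
    have h : RelL' δ γ μ H E A B J σ ρ := relL' δ γ μ hδ
    have d := h.derived
    have pH : IsPrimS H := isPrimS_cst _
    have pE : IsPrimS E := isPrimS_zcst _
    have pA : IsPrimS A := isPrimS_zcst _
    have pB : IsPrimS B := isPrimS_cst _
    have pJ : IsPrimS J := isPrimS_cst _
    have hΦ : flip21 Φ = expS (ρ ⊗ₚ J) := flip21_expS_tensorS J ρ
    have hF : F = expS (J ⊗ₚ ρ) * FP := rfl
    have hFt : Ft = expS (ρ ⊗ₚ J) * FP := by rw [← hΦ]; rfl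
    have hFP : FP = expS (A ⊗ₚ B) * expS (H ⊗ₚ σ) := rfl
    have hΦ' : Φ = expS (J ⊗ₚ ρ) := rfl
    clear_value FP F Ft Φ H E A B J σ ρ
    obtain ⟨tFP, eρ, pFJ, p1, p2, p3, p4, hU, hUt⟩ :=
      isTwist_L' h d pH pE pA pB pJ hFP hF hFt
    obtain ⟨fE, fB, fA, fJ⟩ := semiconjBy_F_L' h d pH pE pA pB pJ (hFP ▸ hF)
    obtain ⟨kE, kB, kA, kH, kJ⟩ := semiconjBy_Ft_L' h d pH pE pA pB pJ (hFP ▸ hFt)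
    obtain ⟨t1, q1, q2⟩ := isTwist_expS_mul tFP d.cρ pJ.counit eρ pFJ (hF ▸ p2)
    obtain ⟨t2, q3, q4⟩ := isTwist_expS_mul' tFP d.cρ pJ.counit eρ pFJ (hFt ▸ p4)
    rw [← hF] at t1 q2
    rw [← hFt] at t2 q3
    rw [← hΦ'] at q1 q2
    rw [← hΦ] at q3 q4
    have σρ : Commute σ ρ := (d.comm_σ ρ (d.comm_ρ E h.EA).symm).symm
    have e1 : expS (δ • σ - μ • ρ) = expS (δ • σ) * expS (-(μ • ρ)) := by
      have := expS_add_of_commute_smul d.cσ d.cρ σρ δ (-μ)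
      rwa [neg_smul, ← sub_eq_add_neg] at this
    rw [e1]
    refine ⟨⟨t1, t2⟩, ⟨pFJ, p1, p2, p3, p4⟩,
      ⟨twComul_eq hU fJ, twComul_eq hU fA, twComul_eq hU fB, twComul_eq hU fE⟩,
      ⟨twComul_eq hUt kJ, twComul_eq hUt kH, fun hμ => ?_, twComul_eq hUt kA, twComul_eq hUt kB,
        twComul_eq hUt kE⟩, q1, q2, q3, q4⟩
    rw [twComul_eq hUt kH]
    -- From μA = e^{μρ} - 1 one gets μA e^{-μρ} = 1 - e^{-μρ}; division by μ gives the alternative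
    -- form of the third term.
    have e4 : expS (-(μ • ρ)) - 1 = -(μ • (A * expS (-(μ • ρ)))) := by
      rw [← smul_mul_assoc, d.Ar, neg_sub]
    rw [e4, neg_tensorS, smul_tensorS, smul_neg, smul_smul, div_mul_cancel₀ _ hμ]
    abel
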